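/- Let $S$ be an infinite set of labels and let $\mathcal C$ be one of the following two categories. **$\mathcal C=\mathrm{LRF}$.** Objects are the finite (possibly empty) rooted forests $F$ with vertices labeled injectively by elements of $S$; isomorphisms are bijections of the vertices preserving roots and incidences (labels need not match). An admissible cut $C$ of $F$ consists, for every tree of $F$, of either the full cut or a set of edges at most one of which lies on any path from a leaf to the root. $P_C(F)$ is the forest of the branches that are cut off (the whole tree for a full cut) and $R_C(F)$ is the remaining forest containing the other roots. The subobjects of $F$ are the $A=P_C(F)$, with quotient $F/A=R_C(F)$, one for each admissible cut $C$. **$\mathcal C=\mathrm{LFG}$.** Objects are the (possibly empty) Feynman graphs of $\phi^3$ theory with half-edges labeled by elements of $S$: finite graphs in which each half-edge is incident to exactly one vertex and adjacent to at most one other half-edge (forming an internal edge; half-edges adjacent to no other are called external edges), each vertex is incident to exactly three half-edges, and each connected component has $2$ or $3$ external edges and at least one loop. Isomorphisms are bijections of vertices and of half-edges preserving all incidences (labels need not match). The subobjects of $\Gamma$ are the subgraphs $\gamma\subset\Gamma$: Feynman graphs formed by some vertices of $\Gamma$, all half-edges of $\Gamma$ at these vertices, and some of the internal edges of $\Gamma$,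 such that for every component of $\gamma$ with two external edges, either both or none of these are external edges of $\Gamma$. The quotient $\Gamma/\gamma$ is obtained by contracting each component of $\gamma$ with three external edges to a vertex incident to these three half-edges, and by removing each component with two external edges and joining the two half-edges of $\Gamma$ that were adjacent to its external edges; components of $\gamma$ that are whole components of $\Gamma$ are removed, so that $\Gamma/\Gamma=\emptyset$. Let $\mathrm{Iso}(\mathcal C)$ be the set of isomorphism classes. The Ringel–Hall product of functions on $\mathrm{Iso}(\mathcal C)$ is $(f\times g)(M)=\sum_{N\subset M}f(N)\,g(M/N)$, the sum being over the subobjects $N$ of $M$. Let $\mathfrak n_{\mathcal C}$ be the space of finitely supported $f:\mathrm{Iso}(\mathcal C)\to\mathbb Q$ that are primitive: $f(M\oplus N)=f(M)\,\delta_\emptyset(N)+\delta_\emptyset(M)\,f(N)$ for all $M,N$, where $\oplus$ is disjoint union and $\delta_A$ is the delta function of a class $A$. Let $\mathrm H^*_{\mathcal C}$ be the $\mathbb Q$-vector space with basis $\{\phi_A : A\in\mathrm{Iso}(\mathcal C)\}$ (the restricted dual of the space of finitely supported functions, with the basis dual to the $\delta_A$), and let functions on $\mathrm{Iso}(\mathcal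 C)$ act on it linearly by $$f\cdot\phi_B=-\sum_{N\subset B}f(N)\,\phi_{B/N},\qquad\text{so that, with } X_A=\delta_A,\qquad X_A\cdot\phi_B=-\sum_{N\subset B,\ N\simeq A}\phi_{B/N}.$$ **Theorem.** The quotient of a Feynman graph by a subgraph is again a Feynman graph, and the product and the action above do not depend on the choice of representatives of isomorphism classes. With the bracket $[f,g]=f\times g-g\times f$, $\mathfrak n_{\mathcal C}$ is a Lie algebra (the Connes–Kreimer Lie algebra, in its Ringel–Hall form), and the action above makes $\mathrm H^*_{\mathcal C}$ a representation of it (the elimination representation): $[f,g]\cdot\phi=f\cdot(g\cdot\phi)-g\cdot(f\cdot\phi)$ for $f,g\in\mathfrak n_{\mathcal C}$. For every $M\in\mathrm{Iso}(\mathcal C)$, the span $\mathrm H_{quot(M)}\subset\mathrm H^*_{\mathcal C}$ of the $\phi_A$, where $A$ runs over the isomorphism classes of quotients of $M$, is finite-dimensional and stable under the action of every $X_A$, $A\in\mathrm{Iso}(\mathcal C)$, and of $\mathfrak n_{\mathcal C}$; that is, it is a finite-dimensional representation of $\mathfrak n_{\mathcal C}$. -/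

import Mathlib

universe u

/-! ### Finitary categories of combinatorial objects, and their Ringel-Hall algebras -/

/-- The data of `LRF` and `LFG` from which Ringel-Hall algebras are built: objects, isomorphism of
objects, the empty object, disjoint unions, and for every object `B` its (finitely many) subobjects
`A ⊂ B`, each with its underlying object `A` and its quotient `B / A`.
This record is only used for the two concrete instances `LRF` and `LFG` below. -/
structure HallData where
  Obj : Type u
  isoSetoid : Setoid Obj
  empty : Obj
  /-- `IsDisjointUnion M N T`: `T` is the disjoint union `M ⊕ N` (`M`, `N` disjointly labeled). -/
  IsDisjointUnion : Obj → Obj → Obj → Prop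
  Sub : Obj → Type u
  finite_sub : ∀ B, Finite (Sub B)
  /-- The object underlying a subobject. -/
  sub : (B : Obj) → Sub B → Obj
  /-- The quotient by a subobject. -/
  quo : (B : Obj) → Sub B → Obj

namespace HallData

variable (C : HallData.{u})

/-- The set of isomorphism classes of objects. -/
abbrev Iso : Type u := Quotient C.isoSetoid

variable {C}

/-- The isomorphism class of an object. -/
def cls (B : C.Obj) : C.Iso := Quotient.mk C.isoSetoid B

noncomputable instance (B : C.Obj) : Fintype (C.Sub B) :=
  have := C.finite_sub B
  Fintype.ofFinite _

open Classical in
/-- The delta function `δ_A` of an isomorphism class. -/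
noncomputable def delta (A : C.Iso) : C.Iso → ℚ := Pi.single A 1

/-- The Ringel-Hall product `(f × g)(M) = ∑_{N ⊂ M} f(N) g(M/N)`. -/
noncomputable def hallMul (f g : C.Iso → ℚ) : C.Iso → ℚ := fun M =>
  ∑ N : C.Sub M.out, f (cls (C.sub M.out N)) * g (cls (C.quo M.out N))

/-- The commutator bracket of the Ringel-Hall product. -/
noncomputable def hallBracket (f g : C.Iso → ℚ) : C.Iso → ℚ := hallMul f g - hallMul g f

variable (C)

/-- The Ringel-Hall Lie algebra `n_C`: the finitely supported functions `f` on isomorphism classes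
that are primitive for the coproduct `Δ(f)(M, N) = f(M ⊕ N)`, i.e. `Δ(f) = f ⊗ 1 + 1 ⊗ f`, where the
unit `1` of the Ringel-Hall algebra is the delta function of the empty object. -/
noncomputable def hallLie : Submodule ℚ (C.Iso → ℚ) where
  carrier := {f | (Function.support f).Finite ∧
    ∀ M N T : C.Obj, C.IsDisjointUnion M N T →
      f (cls T) = f (cls M) * delta (cls C.empty) (cls N)
        + delta (cls C.empty) (cls M) * f (cls N)}
  zero_mem' := by
    refine ⟨?_, ?_⟩
    · simp
    · intros; simp
  add_mem' := by
    rintro f g ⟨hf, hf'⟩ ⟨hg, hg'⟩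
    refine ⟨(hf.union hg).subset (Function.support_add f g), ?_⟩
    intro M N T h
    simp only [Pi.add_apply, hf' M N T h, hg' M N T h]
    ring
  smul_mem' := by
    rintro c f ⟨hf, hf'⟩
    refine ⟨hf.subset (Function.support_const_smul_subset c f), ?_⟩
    intro M N T h
    simp only [Pi.smul_apply, smul_eq_mul, hf' M N T h]
    ring

/-- The restricted dual `H*_C` of the Ringel-Hall algebra: the vector space with basis
`φ_A`, `A ∈ Iso(C)`. -/
abbrev DualHall : Type u := C.Iso →₀ ℚ

variable {C}

/-- The dual basis vector `φ_A`. -/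
noncomputable def phi (A : C.Iso) : C.DualHall := Finsupp.single A 1

/-- The elimination action `X_A · φ_B = - ∑_{A ⊂ B} φ_{B/A}` on the restricted dual, extended
linearly: `f · φ_B = - ∑_{N ⊂ B} f(N) φ_{B/N}`. The element `X_A` is `δ_A`. -/
noncomputable def elim : (C.Iso → ℚ) →ₗ[ℚ] Module.End ℚ C.DualHall where
  toFun f := Finsupp.linearCombination ℚ fun B : C.Iso =>
    -∑ N : C.Sub B.out, f (cls (C.sub B.out N)) • phi (cls (C.quo B.out N))
  map_add' f g := by
    refine Finsupp.lhom_ext' fun B => LinearMap.ext_ring ?_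
    simp [add_smul, Finset.sum_add_distrib, add_comm]
  map_smul' c f := by
    refine Finsupp.lhom_ext' fun B => LinearMap.ext_ring ?_
    simp [mul_smul, Finset.smul_sum]

/-- `Quot(M)`: the isomorphism classes of quotients of `M`. -/
def quotients (M : C.Iso) : Set C.Iso :=
  {E | ∃ (B : C.Obj) (N : C.Sub B), cls B = M ∧ cls (C.quo B N) = E}

/-- `H_quot(M)`: the span of the `φ_A`, `A ∈ Quot(M)`. -/
noncomputable def hallQuot (M : C.Iso) : Submodule ℚ C.DualHall :=
  Submodule.span ℚ (phi '' quotients M)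

end HallData

/-! ### Labeled rooted forests -/

/-- A finite rooted forest whose vertices are elements of the label set `S`, given by its
parent-child edges; the roots are the vertices without a parent. -/
@[ext]
structure RootedForest (S : Type u) where
  verts : Set S
  finite_verts : verts.Finite
  /-- `parent p c`: there is an edge from `p` to its child `c`. -/
  parent : S → S → Prop
  parent_mem : ∀ p c, parent p c → p ∈ verts ∧ c ∈ verts
  parent_unique : ∀ p q c, parent p c → parent q c → p = q
  acyclic : ∀ v, ¬ Relation.TransGen parent v v

namespace RootedForest

variable {S : Type u}

/-- The forest on `F.verts ∩ D` whose edges are those of `F` with both ends in `D`. -/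
def restrict (F : RootedForest S) (D : Set S) : RootedForest S where
  verts := F.verts ∩ D
  finite_verts := F.finite_verts.inter_of_left D
  parent p c := F.parent p c ∧ p ∈ D ∧ c ∈ D
  parent_mem p c h := ⟨⟨(F.parent_mem p c h.1).1, h.2.1⟩, ⟨(F.parent_mem p c h.1).2, h.2.2⟩⟩
  parent_unique p q c h h' := F.parent_unique p q c h.1 h'.1
  acyclic v h := F.acyclic v (Relation.TransGen.mono (fun _ _ h => h.1) _ _ h)

/-- The empty forest. -/
def empty (S : Type u) : RootedForest S where
  verts := ∅
  finite_verts := Set.finite_empty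
  parent _ _ := False
  parent_mem _ _ h := h.elim
  parent_unique _ _ _ h := h.elim
  acyclic v h := by
    obtain ⟨_, h, _⟩ := Relation.TransGen.head'_iff.mp h
    exact h

/-- An isomorphism of forests: a bijection of vertices that preserves the parent relation (hence
also roots and trees); labels are not required to match. -/
def Isomorphic (F G : RootedForest S) : Prop :=
  ∃ f : S → S, Set.BijOn f F.verts G.verts ∧
    ∀ p ∈ F.verts, ∀ c ∈ F.verts, F.parent p c ↔ G.parent (f p) (f c)

/-- An admissible cut of a forest. A cut edge is recorded by its lower end (the child), and a vertex
of `cut` that is a root means that the full cut is taken on its tree. Admissible: at most one cut on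
every path from a leaf to a root, i.e. no vertex of `cut` is a proper descendant of another one. -/
@[ext]
structure AdmissibleCut (F : RootedForest S) where
  cut : Set S
  cut_subset : cut ⊆ F.verts
  antichain : ∀ c ∈ cut, ∀ d ∈ cut, Relation.ReflTransGen F.parent c d → c = d

/-- The vertices below a cut. -/
def AdmissibleCut.below {F : RootedForest S} (c : AdmissibleCut F) : Set S :=
  {v | ∃ t ∈ c.cut, Relation.ReflTransGen F.parent t v}

/-- `P_C(F)`: the forest of branches that are cut off. -/
def AdmissibleCut.P {F : RootedForest S} (c : AdmissibleCut F) : RootedForest S :=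
  F.restrict c.below

/-- `R_C(F)`: what remains and contains the roots (of the trees that are not fully cut). -/
def AdmissibleCut.R {F : RootedForest S} (c : AdmissibleCut F) : RootedForest S :=
  F.restrict c.belowᶜ

theorem AdmissibleCut.finite (F : RootedForest S) : Finite (AdmissibleCut F) := by
  have : Finite (𝒫 F.verts) := F.finite_verts.finite_subsets
  refine Finite.of_injective
    (fun c : AdmissibleCut F => (⟨c.cut, c.cut_subset⟩ : 𝒫 F.verts)) ?_
  intro c d h
  exact AdmissibleCut.ext (congrArg Subtype.val h)

/-- Isomorphism of forests as an equivalence relation. -/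
def isoSetoid (S : Type u) : Setoid (RootedForest S) where
  r := Isomorphic
  iseqv :=
    { refl := fun F => ⟨id, Set.bijOn_id _, fun _ _ _ _ => Iff.rfl⟩
      symm := by
        rintro F G ⟨f, hf, h⟩
        rcases F.verts.eq_empty_or_nonempty with h0 | ⟨x, _⟩
        · have h1 : G.verts = ∅ := by rw [← hf.image_eq, h0, Set.image_empty]
          refine ⟨id, ?_, ?_⟩
          · rw [h0, h1]; exact Set.bijOn_id _
          · intro p hp; rw [h1] at hp; exact hp.elim
        · have : Nonempty S := ⟨x⟩
          have hinv := hf.invOn_invFunOn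
          have hg := hf.symm hinv.symm
          refine ⟨_, hg, fun p hp c hc => ?_⟩
          rw [h _ (hg.mapsTo hp) _ (hg.mapsTo hc), hinv.2 hp, hinv.2 hc]
      trans := by
        rintro F G K ⟨f, hf, h⟩ ⟨g, hg, h'⟩
        refine ⟨g ∘ f, hg.comp hf, fun p hp c hc => ?_⟩
        rw [h p hp c hc, h' _ (hf.mapsTo hp) _ (hf.mapsTo hc)]
        rfl }

end RootedForest

/-- The category `LRF` of labeled rooted forests: the subobjects of `F` are the `P_C(F)`, with
quotients `R_C(F)`, for `C` an admissible cut of `F`. -/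
def LRF (S : Type u) : HallData.{u} where
  Obj := RootedForest S
  isoSetoid := RootedForest.isoSetoid S
  empty := RootedForest.empty S
  IsDisjointUnion M N T := Disjoint M.verts N.verts ∧ T.verts = M.verts ∪ N.verts ∧
    ∀ p c, T.parent p c ↔ M.parent p c ∨ N.parent p c
  Sub F := RootedForest.AdmissibleCut F
  finite_sub := RootedForest.AdmissibleCut.finite
  sub _ c := c.P
  quo _ c := c.R

/-! ### Labeled Feynman graphs -/

/-- The incidence data of a graph with half-edges in the label set `S`: a vertex is given as the set
of half-edges incident to it, an internal edge as the pair of half-edges that form it. -/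
@[ext]
structure HalfEdgeGraph (S : Type u) where
  verts : Set (Set S)
  edges : Set (Set S)

namespace HalfEdgeGraph

variable {S : Type u}

/-- The set of half-edges. -/
def halves (G : HalfEdgeGraph S) : Set S := ⋃₀ G.verts

/-- The external edges: the half-edges not adjacent to another half-edge. -/
def ext_edges (G : HalfEdgeGraph S) : Set S := G.halves \ ⋃₀ G.edges

/-- The half-edges of the connected component containing the half-edge `h`. -/
def comp (G : HalfEdgeGraph S) (h : S) : Set S :=
  {k | Relation.ReflTransGen (fun a b => ∃ x ∈ G.verts ∪ G.edges, a ∈ x ∧ b ∈ x) h k}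

/-- The external edges of the connected component containing the half-edge `h`. -/
def legs (G : HalfEdgeGraph S) (h : S) : Set S := G.comp h ∩ G.ext_edges

/-- Feynman graphs (possibly empty or disconnected): finite graphs in which every vertex has exactly
three half-edges, each half-edge is at exactly one vertex and adjacent to at most one other
half-edge, and every connected component has `2` or `3` external edges and at least one loop
(first Betti number `#edges - #vertices + 1 ≥ 1`). -/
structure IsFeynman (G : HalfEdgeGraph S) : Prop where
  finite_verts : G.verts.Finite
  vert_card : ∀ v ∈ G.verts, v.ncard = 3
  vert_disjoint : G.verts.PairwiseDisjoint id
  edge_card : ∀ e ∈ G.edges, e.ncard = 2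
  edge_disjoint : G.edges.PairwiseDisjoint id
  edge_subset : ∀ e ∈ G.edges, e ⊆ G.halves
  legs_card : ∀ h ∈ G.halves, (G.legs h).ncard = 2 ∨ (G.legs h).ncard = 3
  loop : ∀ h ∈ G.halves,
    {v ∈ G.verts | v ⊆ G.comp h}.ncard ≤ {e ∈ G.edges | e ⊆ G.comp h}.ncard

/-- An isomorphism of graphs: a bijection of half-edges inducing bijections of the vertices and of
the internal edges; labels are not required to match. -/
def Isomorphic (G K : HalfEdgeGraph S) : Prop :=
  ∃ f : S → S, Set.BijOn f G.halves K.halves ∧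
    (f '' ·) '' G.verts = K.verts ∧ (f '' ·) '' G.edges = K.edges

/-- `γ` is a subgraph of `G` that can be contracted: a Feynman graph formed by some of the vertices
of `G`, with all half-edges at them, and some of the internal edges of `G`, such that no component of
`γ` with two external edges has exactly one of them external in `G`. (The half-edges of `G` adjacent
to the two external edges of such a component have to be joined in the quotient; if both external
edges are external in `G`, then it is a component of `G` and is just removed.) -/
structure IsSubgraph (γ G : HalfEdgeGraph S) : Prop where
  isFeynman : γ.IsFeynman
  verts_subset : γ.verts ⊆ G.verts
  edges_subset : γ.edges ⊆ G.edges
  two_legs : ∀ h ∈ γ.halves, (γ.legs h).ncard = 2 →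
    γ.legs h ⊆ G.ext_edges ∨ Disjoint (γ.legs h) G.ext_edges

/-- The vertices of the quotient: those of `G` outside `γ`, and one new vertex for every component of
`γ` with three external edges, incident to these (none for a component of `γ` that is a whole
component of `G`, so that `G / G` is empty). -/
def contractVerts (G γ : HalfEdgeGraph S) : Set (Set S) :=
  {v | v ∈ G.verts ∧ v ∉ γ.verts} ∪
    {v | ∃ h ∈ γ.halves, v = γ.legs h ∧ v.ncard = 3 ∧ ¬ v ⊆ G.ext_edges}

/-- Half-edges that are adjacent in `G` by an edge not in `γ`, or are the two external edges of a
component of `γ`. -/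
def Linked (G γ : HalfEdgeGraph S) (a b : S) : Prop :=
  (∃ e ∈ G.edges, e ∉ γ.edges ∧ a ∈ e ∧ b ∈ e) ∨
    (∃ h ∈ γ.halves, (γ.legs h).ncard = 2 ∧ a ∈ γ.legs h ∧ b ∈ γ.legs h)

/-- The quotient `G / γ`: every component of `γ` with three external edges is contracted to a vertex;
every component with two external edges is removed and the half-edges adjacent to these are joined.
Hence two remaining half-edges are adjacent if they are joined in `G` by an edge not in `γ` or by a
chain of such edges and components of `γ` with two external edges. -/
def contract (G γ : HalfEdgeGraph S) : HalfEdgeGraph S where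
  verts := contractVerts G γ
  edges := {e | ∃ a ∈ ⋃₀ contractVerts G γ, ∃ b ∈ ⋃₀ contractVerts G γ,
    a ≠ b ∧ Relation.ReflTransGen (Linked G γ) a b ∧ e = {a, b}}

theorem IsFeynman.finite_halves {G : HalfEdgeGraph S} (hG : G.IsFeynman) : G.halves.Finite :=
  hG.finite_verts.sUnion fun v hv => Set.finite_of_ncard_ne_zero (by rw [hG.vert_card v hv]; simp)

theorem IsFeynman.finite_edges {G : HalfEdgeGraph S} (hG : G.IsFeynman) : G.edges.Finite :=
  hG.finite_halves.finite_subsets.subset fun e he => hG.edge_subset e he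

/-- The empty graph. -/
def empty (S : Type u) : HalfEdgeGraph S := ⟨∅, ∅⟩

theorem isFeynman_empty (S : Type u) : (empty S).IsFeynman := by
  constructor <;> simp [empty, halves]

theorem image_image_of_leftInvOn {f g : S → S} {H : Set S} (h : Set.LeftInvOn g f H)
    {X : Set (Set S)} (hX : ∀ x ∈ X, x ⊆ H) : (g '' ·) '' ((f '' ·) '' X) = X := by
  rw [Set.image_image]
  conv_rhs => rw [← Set.image_id X]
  refine Set.image_congr fun x hx => ?_
  rw [Set.image_image]
  conv_rhs => rw [id, ← Set.image_id x]
  exact Set.image_congr fun a ha => h (hX x hx ha)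

/-- Isomorphism of Feynman graphs as an equivalence relation. -/
def isoSetoid (S : Type u) : Setoid {G : HalfEdgeGraph S // G.IsFeynman} where
  r G K := Isomorphic G.1 K.1
  iseqv :=
    { refl := fun G => ⟨id, Set.bijOn_id _, by simp, by simp⟩
      symm := by
        rintro ⟨G, hG⟩ ⟨K, hK⟩ ⟨f, hf, hv, he⟩
        dsimp only at hf hv he
        rcases isEmpty_or_nonempty S with hS | hS
        · have h1 : G.halves = ∅ := Set.eq_empty_of_isEmpty _
          have h2 : K.halves = ∅ := Set.eq_empty_of_isEmpty _
          refine ⟨f, ?_, ?_, ?_⟩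
          · dsimp only; rw [h1, h2]; exact Set.bijOn_empty _
          · have : (f '' · : Set S → Set S) = id := funext fun _ => Subsingleton.elim _ _
            rw [this, Set.image_id] at hv ⊢; exact hv.symm
          · have : (f '' · : Set S → Set S) = id := funext fun _ => Subsingleton.elim _ _
            rw [this, Set.image_id] at he ⊢; exact he.symm
        · have hinv := hf.invOn_invFunOn
          refine ⟨_, hf.symm hinv.symm, ?_, ?_⟩
          · dsimp only; rw [← hv]
            exact image_image_of_leftInvOn hinv.1 fun x hx => Set.subset_sUnion_of_mem hx
          · dsimp only; rw [← he]
            exact image_image_of_leftInvOn hinv.1 hG.edge_subset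
      trans := by
        rintro G K L ⟨f, hf, hv, he⟩ ⟨g, hg, hv', he'⟩
        refine ⟨g ∘ f, hg.comp hf, ?_, ?_⟩
        · rw [← hv', ← hv, Set.image_image]; simp only [Set.image_comp]
        · rw [← he', ← he, Set.image_image]; simp only [Set.image_comp] }

theorem finite_subgraphs {G : HalfEdgeGraph S} (hG : G.IsFeynman) (p : HalfEdgeGraph S → Prop) :
    Finite {γ : HalfEdgeGraph S // γ.IsSubgraph G ∧ p γ} := by
  have : Finite (𝒫 G.verts) := hG.finite_verts.finite_subsets
  have : Finite (𝒫 G.edges) := hG.finite_edges.finite_subsets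
  refine Finite.of_injective
    (fun γ : {γ : HalfEdgeGraph S // γ.IsSubgraph G ∧ p γ} =>
      ((⟨γ.1.verts, γ.2.1.verts_subset⟩, ⟨γ.1.edges, γ.2.1.edges_subset⟩) :
        𝒫 G.verts × 𝒫 G.edges)) ?_
  intro a b h
  rw [Prod.mk.injEq] at h
  exact Subtype.ext (HalfEdgeGraph.ext (congrArg Subtype.val h.1) (congrArg Subtype.val h.2))

end HalfEdgeGraph

/-- The category `LFG` of labeled Feynman graphs: the subobjects of `G` are its subgraphs `γ`, with
quotients `G / γ`. -/
def LFG (S : Type u) : HallData.{u} where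
  Obj := {G : HalfEdgeGraph S // G.IsFeynman}
  isoSetoid := HalfEdgeGraph.isoSetoid S
  empty := ⟨HalfEdgeGraph.empty S, HalfEdgeGraph.isFeynman_empty S⟩
  IsDisjointUnion M N T := Disjoint M.1.halves N.1.halves ∧ T.1.verts = M.1.verts ∪ N.1.verts ∧
    T.1.edges = M.1.edges ∪ N.1.edges
  Sub G := {γ : HalfEdgeGraph S // γ.IsSubgraph G.1 ∧ (G.1.contract γ).IsFeynman}
  finite_sub G := HalfEdgeGraph.finite_subgraphs G.2 _
  sub _ γ := ⟨γ.1, γ.2.1.isFeynman⟩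
  quo G γ := ⟨G.1.contract γ.1, γ.2.2⟩

open HallData

/-! The theorem is formal once the properties collected in `IsFinitary` are known. The essential one
is `exists_flag_equiv`: flags L ⊂ N ⊂ M correspond to pairs of a subobject L of M and a subobject
N/L of M/L, with (M/L)/(N/L) ≃ M/N. Summing over flags in both ways (`sum_flag`) makes the product
associative, whence the Jacobi identity, and gives `elim_elim`; the minus sign in the action
compensates the reversal of order there, so that brackets go to commutators. The same correspondence
says that a quotient of a quotient of M is a quotient of M, so `hallQuot` is stable; it is
finite-dimensional because M has finitely many subobjects. For primitive f and g, subobjects of a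
disjoint union are pairs of subobjects, and f × g fails to be primitive only by a term symmetric in
f and g, which cancels in the bracket (`hallMul_disjointUnion`).

For forests, an admissible cut is the same as a set D of vertices closed under children, and the
flag correspondence sends E ⊂ D to (E, D \ E).

For graphs, the difficulty lies in components with two external edges: an edge of G/γ may come from
a long chain alternating between edges outside γ and leg pairs of γ. These are two matchings, and an
alternating path has exactly two ends (`exists_other_end`), so every surviving internal half-edge
has exactly one partner. Contraction then preserves components and their external edges
(`comp_contract`, `legs_contract`). The count 3V = 2E + #legs reduces the loop condition to the
absence of isolated vertices, so quotients are Feynman graphs. The inverse of N ↦ N/L is `lift`,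
which adds to L the vertices of M kept in K and all edges on chains that end in edges of K. -/

open HallData

/-! ### Formal consequences of the finitary properties -/

namespace HallData

variable {C : HallData.{u}}

/-- The properties of the two categories from which the theorem follows formally. -/
structure IsFinitary (C : HallData.{u}) : Prop where
  exists_equiv_of_cls_eq : ∀ B B' : C.Obj, cls B = cls B' → ∃ e : C.Sub B ≃ C.Sub B',
    ∀ N, cls (C.sub B' (e N)) = cls (C.sub B N) ∧ cls (C.quo B' (e N)) = cls (C.quo B N)
  -- A flag L ⊂ N ⊂ M is (N, L) on the left and (L, N/L) on the right; the three equations match its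
  -- layers L, N/L and M/N.
  exists_flag_equiv : ∀ M : C.Obj,
    ∃ e : (Σ N : C.Sub M, C.Sub (C.sub M N)) ≃ (Σ L : C.Sub M, C.Sub (C.quo M L)), ∀ x,
      cls (C.sub M (e x).1) = cls (C.sub (C.sub M x.1) x.2) ∧
      cls (C.sub (C.quo M (e x).1) (e x).2) = cls (C.quo (C.sub M x.1) x.2) ∧
      cls (C.quo (C.quo M (e x).1) (e x).2) = cls (C.quo M x.1)
  exists_union_equiv : ∀ M N T : C.Obj, C.IsDisjointUnion M N T →
    ∃ e : C.Sub M × C.Sub N ≃ C.Sub T, ∀ x,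
      C.IsDisjointUnion (C.sub M x.1) (C.sub N x.2) (C.sub T (e x)) ∧
      C.IsDisjointUnion (C.quo M x.1) (C.quo N x.2) (C.quo T (e x))
  -- Uniqueness here and in `exists_top` makes the delta function of the empty object a two-sided
  -- unit.
  exists_bot : ∀ M : C.Obj, ∃ N : C.Sub M, cls (C.quo M N) = cls M ∧
    ∀ N', cls (C.sub M N') = cls C.empty ↔ N' = N
  exists_top : ∀ M : C.Obj, ∃ N : C.Sub M, cls (C.sub M N) = cls M ∧
    ∀ N', cls (C.quo M N') = cls C.empty ↔ N' = N
  -- The size is the number of vertices in both categories; it serves to bound supports of products.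
  exists_size : ∃ s : C.Iso → ℕ, (∀ n, {A | s A ≤ n}.Finite) ∧
    ∀ (M : C.Obj) (N : C.Sub M), s (cls M) ≤ s (cls (C.sub M N)) + s (cls (C.quo M N))

theorem cls_out (M : C.Iso) : cls M.out = M := Quotient.out_eq _

theorem delta_apply (A B : C.Iso) [Decidable (B = A)] : delta A B = if B = A then 1 else 0 := by
  classical
  simp [delta, Pi.single_apply]

namespace IsFinitary

variable (hC : C.IsFinitary)
include hC

/-- A sum over the subobjects of `M` depends only on the isomorphism class of `M`. -/
theorem sum_sub_out {V : Type*} [AddCommMonoid V] (F : C.Iso → C.Iso → V) (M : C.Obj) :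
    ∑ N : C.Sub (cls M).out, F (cls (C.sub _ N)) (cls (C.quo _ N)) =
      ∑ N : C.Sub M, F (cls (C.sub M N)) (cls (C.quo M N)) := by
  obtain ⟨e, he⟩ := hC.exists_equiv_of_cls_eq M (cls M).out (cls_out _).symm
  refine (Fintype.sum_equiv e _ _ fun N => ?_).symm
  rw [(he N).1, (he N).2]

theorem hallMul_cls (f g : C.Iso → ℚ) (M : C.Obj) :
    hallMul f g (cls M) = ∑ N : C.Sub M, f (cls (C.sub M N)) * g (cls (C.quo M N)) :=
  hC.sum_sub_out (fun a b => f a * g b) M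

theorem elim_phi_cls (f : C.Iso → ℚ) (B : C.Obj) :
    elim f (phi (cls B)) = -∑ N : C.Sub B, f (cls (C.sub B N)) • phi (cls (C.quo B N)) := by
  rw [← hC.sum_sub_out (fun a b => f a • phi b) B]
  simp [elim, phi]

/-- A sum over flags of subobjects, read off in two ways. -/
theorem sum_flag {V : Type*} [AddCommMonoid V] (F : C.Iso → C.Iso → C.Iso → V) (M : C.Obj) :
    ∑ N : C.Sub M, ∑ L : C.Sub (C.sub M N),
        F (cls (C.sub _ L)) (cls (C.quo _ L)) (cls (C.quo M N)) =
      ∑ L : C.Sub M, ∑ K : C.Sub (C.quo M L),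
        F (cls (C.sub M L)) (cls (C.sub _ K)) (cls (C.quo _ K)) := by
  obtain ⟨e, he⟩ := hC.exists_flag_equiv M
  rw [← Fintype.sum_sigma', ← Fintype.sum_sigma']
  refine Fintype.sum_equiv e _ _ fun x => ?_
  rw [(he x).1, (he x).2.1, (he x).2.2]

theorem hallMul_assoc (f g h : C.Iso → ℚ) :
    hallMul (hallMul f g) h = hallMul f (hallMul g h) := by
  funext M
  rw [← cls_out M]
  generalize M.out = M
  simp only [hC.hallMul_cls, Finset.sum_mul, Finset.mul_sum, ← mul_assoc]
  exact hC.sum_flag (fun a b c => f a * g b * h c) M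

omit hC in
theorem hallMul_sub (f g h : C.Iso → ℚ) : hallMul f (g - h) = hallMul f g - hallMul f h := by
  funext M
  simp [hallMul, mul_sub]

omit hC in
theorem sub_hallMul (f g h : C.Iso → ℚ) : hallMul (f - g) h = hallMul f h - hallMul g h := by
  funext M
  simp [hallMul, sub_mul]

theorem hallBracket_jacobi (f g h : C.Iso → ℚ) :
    hallBracket f (hallBracket g h) =
      hallBracket (hallBracket f g) h + hallBracket g (hallBracket f h) := by
  simp only [hallBracket, hallMul_sub, sub_hallMul, hC.hallMul_assoc]
  abel

/-- Acting by g divides out a subobject L first, and f then acts on B/L, so the flag is weighted by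
g × f. The two signs cancel, while `elim` of the product carries one. -/
theorem elim_elim (f g : C.Iso → ℚ) : elim f * elim g = -elim (hallMul g f) := by
  refine Finsupp.lhom_ext' fun B => LinearMap.ext_ring ?_
  change elim f (elim g (phi B)) = -elim (hallMul g f) (phi B)
  rw [← cls_out B]
  generalize B.out = B
  simp only [hC.elim_phi_cls, map_neg, map_sum, map_smul, neg_neg, smul_neg,
    Finset.sum_neg_distrib, hC.hallMul_cls, Finset.sum_smul, Finset.smul_sum, smul_smul]
  exact (hC.sum_flag (fun a b c => (g a * f b) • phi c) B).symm

theorem elim_hallBracket (f g : C.Iso → ℚ) : elim (hallBracket f g) = ⁅elim f, elim g⁆ := by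
  rw [Ring.lie_def, hC.elim_elim, hC.elim_elim, hallBracket, map_sub]
  abel

theorem elim_delta_phi_cls (A : C.Iso) (B : C.Obj) : elim (delta A) (phi (cls B)) =
    -∑ᶠ N : {N : C.Sub B // cls (C.sub B N) = A}, phi (cls (C.quo B N.1)) := by
  classical
  have := Fintype.ofFinite {N : C.Sub B // cls (C.sub B N) = A}
  rw [hC.elim_phi_cls, finsum_eq_sum_of_fintype,
    ← Finset.sum_subtype (Finset.univ.filter fun N => cls (C.sub B N) = A) (by simp)
      fun N => phi (cls (C.quo B N)), Finset.sum_filter]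
  simp [delta_apply]

theorem sum_delta_sub_mul (h : C.Iso → ℚ) (M : C.Obj) :
    ∑ N : C.Sub M, delta (cls C.empty) (cls (C.sub M N)) * h (cls (C.quo M N)) = h (cls M) := by
  classical
  obtain ⟨N, hN, hN'⟩ := hC.exists_bot M
  rw [← hN]
  simp [delta_apply, hN']

theorem sum_mul_delta_quo (h : C.Iso → ℚ) (M : C.Obj) :
    ∑ N : C.Sub M, h (cls (C.sub M N)) * delta (cls C.empty) (cls (C.quo M N)) = h (cls M) := by
  classical
  obtain ⟨N, hN, hN'⟩ := hC.exists_top M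
  rw [← hN]
  simp [delta_apply, hN']

/-- Primitivity expands the summand at a pair of subobjects into four products, each of which
factors over M and N; the factors containing the unit collapse. The last bracket is symmetric in f
and g, hence absent from the commutator. -/
theorem hallMul_disjointUnion {f g : C.Iso → ℚ} (hf : f ∈ C.hallLie) (hg : g ∈ C.hallLie)
    {M N T : C.Obj} (h : C.IsDisjointUnion M N T) :
    hallMul f g (cls T) = hallMul f g (cls M) * delta (cls C.empty) (cls N) +
      delta (cls C.empty) (cls M) * hallMul f g (cls N) +
      (f (cls M) * g (cls N) + g (cls M) * f (cls N)) := by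
  obtain ⟨e, he⟩ := hC.exists_union_equiv M N T h
  set ε := delta (cls C.empty)
  have h1 : hallMul f g (cls T) = ∑ x : C.Sub M × C.Sub N,
      (f (cls (C.sub M x.1)) * ε (cls (C.sub N x.2)) +
        ε (cls (C.sub M x.1)) * f (cls (C.sub N x.2))) *
      (g (cls (C.quo M x.1)) * ε (cls (C.quo N x.2)) +
        ε (cls (C.quo M x.1)) * g (cls (C.quo N x.2))) := by
    rw [hC.hallMul_cls]
    refine (Fintype.sum_equiv e _ _ fun x => ?_).symm
    rw [hf.2 _ _ _ (he x).1, hg.2 _ _ _ (he x).2]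
  have h2 : hallMul f g (cls T) =
      (∑ x, f (cls (C.sub M x)) * g (cls (C.quo M x))) *
        (∑ y, ε (cls (C.sub N y)) * ε (cls (C.quo N y))) +
      (∑ x, f (cls (C.sub M x)) * ε (cls (C.quo M x))) *
        (∑ y, ε (cls (C.sub N y)) * g (cls (C.quo N y))) +
      ((∑ x, ε (cls (C.sub M x)) * g (cls (C.quo M x))) *
        (∑ y, f (cls (C.sub N y)) * ε (cls (C.quo N y))) +
      (∑ x, ε (cls (C.sub M x)) * ε (cls (C.quo M x))) *
        (∑ y, f (cls (C.sub N y)) * g (cls (C.quo N y)))) := by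
    rw [h1]
    simp only [Fintype.sum_mul_sum, ← Fintype.sum_prod_type', ← Finset.sum_add_distrib]
    refine Finset.sum_congr rfl fun x _ => ?_
    ring
  rw [h2, hC.sum_delta_sub_mul, hC.sum_delta_sub_mul, hC.sum_delta_sub_mul, hC.sum_delta_sub_mul,
    hC.sum_mul_delta_quo, hC.sum_mul_delta_quo, hC.hallMul_cls, hC.hallMul_cls]
  ring

/-- A nonzero value at M needs a subobject in the support of f with quotient in the support of g,
which bounds the size of M by subadditivity. -/
theorem finite_support_hallMul {f g : C.Iso → ℚ} (hf : (Function.support f).Finite)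
    (hg : (Function.support g).Finite) : (Function.support (hallMul f g)).Finite := by
  obtain ⟨s, hs, hs'⟩ := hC.exists_size
  obtain ⟨a, ha⟩ := (hf.image s).bddAbove
  obtain ⟨b, hb⟩ := (hg.image s).bddAbove
  refine (hs (a + b)).subset fun M hM => ?_
  rw [← cls_out M] at hM ⊢
  generalize M.out = M at hM
  rw [Function.mem_support, hC.hallMul_cls] at hM
  obtain ⟨N, -, hN⟩ := Finset.exists_ne_zero_of_sum_ne_zero hM
  exact (hs' M N).trans (add_le_add (ha ⟨_, left_ne_zero_of_mul hN, rfl⟩)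
    (hb ⟨_, right_ne_zero_of_mul hN, rfl⟩))

theorem hallBracket_mem {f g : C.Iso → ℚ} (hf : f ∈ C.hallLie) (hg : g ∈ C.hallLie) :
    hallBracket f g ∈ C.hallLie := by
  refine ⟨((hC.finite_support_hallMul hf.1 hg.1).union
    (hC.finite_support_hallMul hg.1 hf.1)).subset (Function.support_sub _ _), fun M N T h => ?_⟩
  simp only [hallBracket, Pi.sub_apply, hC.hallMul_disjointUnion hf hg h,
    hC.hallMul_disjointUnion hg hf h]
  ring

theorem quotients_cls (M : C.Obj) :
    quotients (cls M) = Set.range fun N : C.Sub M => cls (C.quo M N) := by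
  ext E
  constructor
  · rintro ⟨B, N, hB, rfl⟩
    obtain ⟨e, he⟩ := hC.exists_equiv_of_cls_eq B M hB
    exact ⟨e N, (he N).2⟩
  · rintro ⟨N, rfl⟩
    exact ⟨M, N, rfl, rfl⟩

theorem finiteDimensional_hallQuot (M : C.Iso) : FiniteDimensional ℚ (hallQuot M) := by
  rw [← cls_out M]
  refine FiniteDimensional.span_of_finite ℚ (Set.Finite.image _ ?_)
  rw [hC.quotients_cls]
  exact Set.finite_range _

/-- A quotient (M/L)/K is M/N, where N is the first component of the flag corresponding to (L, K).
-/
theorem elim_mem_hallQuot (f : C.Iso → ℚ) (M : C.Iso) {φ : C.DualHall} (hφ : φ ∈ hallQuot M) :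
    elim f φ ∈ hallQuot M := by
  suffices h : hallQuot M ≤ (hallQuot M).comap (elim f) from h hφ
  refine Submodule.span_le.2 ?_
  rw [← cls_out M]
  generalize M.out = M
  rw [hC.quotients_cls]
  rintro _ ⟨_, ⟨L, rfl⟩, rfl⟩
  rw [SetLike.mem_coe, Submodule.mem_comap, hC.elim_phi_cls]
  refine neg_mem (sum_mem fun K _ => Submodule.smul_mem _ _ (Submodule.subset_span ?_))
  refine Set.mem_image_of_mem _ ?_
  rw [hC.quotients_cls]
  obtain ⟨e, he⟩ := hC.exists_flag_equiv M
  refine ⟨(e.symm ⟨L, K⟩).1, ?_⟩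
  have := (he (e.symm ⟨L, K⟩)).2.2
  rw [e.apply_symm_apply] at this
  exact this.symm

end IsFinitary

end HallData

/-! ### Relabeling -/

/-- Isomorphisms are controlled only on the finitely many labels in use; extended to permutations of
all labels, they become transport of structure. -/
theorem Set.Finite.exists_perm_eqOn {S : Type*} {s : Set S} (hs : s.Finite) {f : S → S}
    (hf : s.InjOn f) : ∃ σ : Equiv.Perm S, s.EqOn σ f := by
  have := hs.to_subtype
  obtain ⟨σ, hσ⟩ := Equiv.Perm.exists_extending_pair (fun x : s => (x : S)) (fun x : s => f x)
    Subtype.val_injective hf.injective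
  exact ⟨σ, fun x hx => hσ ⟨x, hx⟩⟩

/-- Any n labels will do: a set of at most n labels injects into them, and the injection extends to
a permutation. Objects of bounded size thus have representatives on one finite label set. -/
theorem exists_finite_label_set (S : Type*) [Infinite S] (n : ℕ) : ∃ T : Set S, T.Finite ∧
    ∀ s : Set S, s.Finite → s.ncard ≤ n → ∃ σ : Equiv.Perm S, σ '' s ⊆ T := by
  obtain ⟨T, hT⟩ := Infinite.exists_subset_card_eq S n
  refine ⟨T, T.finite_toSet, fun s hs hn => ?_⟩
  have h : Cardinal.mk s ≤ Cardinal.mk (T : Set S) := by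
    have := hs.to_subtype
    rw [← Nat.cast_card, ← Nat.cast_card (α := (T : Set S)), Nat.cast_le, Nat.card_coe_set_eq,
      Nat.card_coe_set_eq, Set.ncard_coe_finset, hT]
    exact hn
  have := hs.to_subtype
  obtain ⟨i⟩ := h
  obtain ⟨σ, hσ⟩ := Equiv.Perm.exists_extending_pair (α := s) (fun x => x.1) (fun x => (i x).1)
    Subtype.val_injective (Subtype.val_injective.comp i.injective)
  refine ⟨σ, ?_⟩
  rintro _ ⟨x, hx, rfl⟩
  have := hσ ⟨x, hx⟩
  simp only at this
  rw [this]
  exact (i ⟨x, hx⟩).2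

/-! ### Rooted forests: admissible cuts as down sets -/

namespace RootedForest

variable {S : Type u}

/-- The forest with vertices relabeled by a permutation of the label set. -/
def map (σ : Equiv.Perm S) (F : RootedForest S) : RootedForest S where
  verts := σ '' F.verts
  finite_verts := F.finite_verts.image σ
  parent p c := F.parent (σ.symm p) (σ.symm c)
  parent_mem p c h := by
    have := F.parent_mem _ _ h
    exact ⟨⟨_, this.1, by simp⟩, ⟨_, this.2, by simp⟩⟩
  parent_unique p q c h h' := σ.symm.injective (F.parent_unique _ _ _ h h')
  acyclic v h := F.acyclic (σ.symm v) (Relation.TransGen.lift σ.symm (fun _ _ h => h) _ _ h)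

theorem isomorphic_map (σ : Equiv.Perm S) (F : RootedForest S) : Isomorphic F (F.map σ) :=
  ⟨σ, σ.injective.injOn.bijOn_image, fun p _ c _ => by simp [map]⟩

theorem Isomorphic.exists_perm {F G : RootedForest S} (h : Isomorphic F G) :
    ∃ σ, G = F.map σ := by
  obtain ⟨f, hf, h⟩ := h
  obtain ⟨σ, hσ⟩ := F.finite_verts.exists_perm_eqOn hf.injOn
  have hv : G.verts = σ '' F.verts := by rw [← hf.image_eq, hσ.image_eq]
  refine ⟨σ, RootedForest.ext hv ?_⟩
  ext p c
  constructor
  · intro hp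
    have := G.parent_mem p c hp
    rw [hv] at this
    obtain ⟨⟨p, hp', rfl⟩, ⟨c, hc', rfl⟩⟩ := this
    rw [hσ hp', hσ hc', ← h p hp' c hc'] at hp
    simpa [map] using hp
  · intro hp
    have := F.parent_mem _ _ hp
    have hp2 := (h _ this.1 _ this.2).1 hp
    rw [← hσ this.1, ← hσ this.2] at hp2
    simpa using hp2

theorem map_restrict (σ : Equiv.Perm S) (F : RootedForest S) (D : Set S) :
    (F.restrict D).map σ = (F.map σ).restrict (σ '' D) := by
  refine RootedForest.ext (Set.image_inter σ.injective) ?_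
  ext p c
  simp [map, restrict, Equiv.image_eq_preimage_symm]

theorem restrict_restrict (F : RootedForest S) (D E : Set S) :
    (F.restrict D).restrict E = F.restrict (D ∩ E) := by
  refine RootedForest.ext (Set.inter_assoc _ _ _) ?_
  ext p c
  simp only [restrict, Set.mem_inter_iff]
  tauto

theorem restrict_congr {F : RootedForest S} {D E : Set S} (h : F.verts ∩ D = F.verts ∩ E) :
    F.restrict D = F.restrict E := by
  refine RootedForest.ext h ?_
  ext p c
  have h' : ∀ x ∈ F.verts, x ∈ D ↔ x ∈ E := fun x hx => by
    have := Set.ext_iff.1 h x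
    simpa [hx] using this
  simp only [restrict]
  refine and_congr_right fun hp => ?_
  rw [h' _ (F.parent_mem _ _ hp).1, h' _ (F.parent_mem _ _ hp).2]

theorem restrict_eq_self {F : RootedForest S} {D : Set S} (h : F.verts ⊆ D) :
    F.restrict D = F := by
  refine RootedForest.ext (Set.inter_eq_left.2 h) ?_
  ext p c
  exact ⟨fun h => h.1, fun hp =>
    ⟨hp, h (F.parent_mem _ _ hp).1, h (F.parent_mem _ _ hp).2⟩⟩

theorem eq_empty_of_verts {F : RootedForest S} (h : F.verts = ∅) : F = empty S := by
  refine RootedForest.ext h ?_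
  ext p c
  refine ⟨fun hp => ?_, False.elim⟩
  have := (F.parent_mem _ _ hp).1
  rw [h] at this
  exact this

theorem isomorphic_empty_iff {F : RootedForest S} : Isomorphic F (empty S) ↔ F.verts = ∅ := by
  constructor
  · rintro ⟨f, hf, -⟩
    exact Set.image_eq_empty.1 hf.image_eq
  · intro h
    rw [eq_empty_of_verts h]
    exact (isoSetoid S).refl _

/-- The sets of vertices of a forest that contain the children of their members. -/
abbrev DownSet (F : RootedForest S) : Type u :=
  {D : Set S // D ⊆ F.verts ∧ ∀ p c, F.parent p c → p ∈ D → c ∈ D}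

theorem DownSet.mem_of_reflTransGen {F : RootedForest S} (D : DownSet F) {p c : S}
    (h : Relation.ReflTransGen F.parent p c) (hp : p ∈ D.1) : c ∈ D.1 := by
  induction h with
  | refl => exact hp
  | tail _ h ih => exact D.2.2 _ _ h ih

/-- The ancestors of v inside D are finite in number and ordered by acyclicity, so one of them is
minimal. -/
theorem DownSet.exists_top {F : RootedForest S} (D : DownSet F) {v : S} (hv : v ∈ D.1) :
    ∃ t ∈ D.1, (∀ p, F.parent p t → p ∉ D.1) ∧ Relation.ReflTransGen F.parent t v := by
  have hfin : {u | u ∈ D.1 ∧ Relation.ReflTransGen F.parent u v}.Finite :=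
    F.finite_verts.subset fun u hu => D.2.1 hu.1
  have hwf : {u | u ∈ D.1 ∧ Relation.ReflTransGen F.parent u v}.WellFoundedOn
      (Relation.TransGen F.parent) :=
    haveI : IsStrictOrder S (Relation.TransGen F.parent) :=
      { irrefl := F.acyclic, trans := fun _ _ _ => Relation.TransGen.trans }
    hfin.wellFoundedOn
  obtain ⟨⟨t, ht, htv⟩, -, hmin⟩ := hwf.has_min Set.univ ⟨⟨v, hv, .refl⟩, trivial⟩
  exact ⟨t, ht, fun p hp hpD => hmin ⟨p, hpD, .head hp htv⟩ trivial (.single hp), htv⟩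

/-- An admissible cut is determined by the set of vertices below it. -/
def cutEquiv (F : RootedForest S) : AdmissibleCut F ≃ DownSet F where
  toFun c := ⟨c.below, by
    rintro v ⟨t, ht, htv⟩
    induction htv with
    | refl => exact c.cut_subset ht
    | tail _ h _ => exact (F.parent_mem _ _ h).2,
    fun p q hpq ⟨t, ht, htp⟩ => ⟨t, ht, htp.tail hpq⟩⟩
  invFun D :=
    -- The tops of D. A root lying in D is always a top, in accordance with the convention for full
    -- cuts.
    { cut := {t | t ∈ D.1 ∧ ∀ p, F.parent p t → p ∉ D.1}
      cut_subset := fun t ht => D.2.1 ht.1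
      antichain := fun c hc d hd h => by
        rcases Relation.ReflTransGen.cases_tail h with h | ⟨p, hp, hpd⟩
        · exact h.symm
        · exact (hd.2 p hpd (D.mem_of_reflTransGen hp hc.1)).elim }
  left_inv c := by
    apply AdmissibleCut.ext
    ext t
    constructor
    · rintro ⟨⟨s, hs, hst⟩, h⟩
      rcases Relation.ReflTransGen.cases_tail hst with rfl | ⟨p, hp, hpt⟩
      · exact hs
      · exact (h p hpt ⟨s, hs, hp⟩).elim
    · refine fun ht => ⟨⟨t, ht, .refl⟩, fun p hp ⟨s, hs, hsp⟩ => ?_⟩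
      have hst := c.antichain s hs t ht (hsp.tail hp)
      subst hst
      exact F.acyclic s (Relation.TransGen.tail' hsp hp)
  right_inv D := by
    apply Subtype.ext
    ext v
    constructor
    · rintro ⟨t, ht, htv⟩
      exact D.mem_of_reflTransGen htv ht.1
    · intro hv
      obtain ⟨t, h1, h2, h3⟩ := D.exists_top hv
      exact ⟨t, ⟨h1, h2⟩, h3⟩

/-- The type of the second component depends on the first, but both are plain sets of vertices;
comparing these avoids heterogeneous equality. -/
theorem DownSet.sigma_ext {F : RootedForest S} {f : Set S → RootedForest S}
    {x y : Σ D : DownSet F, DownSet (f D.1)} (h : x.1.1 = y.1.1) (h' : x.2.1 = y.2.1) : x = y := by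
  obtain ⟨⟨D, hD⟩, ⟨E, hE⟩⟩ := x
  obtain ⟨⟨D', hD'⟩, ⟨E', hE'⟩⟩ := y
  obtain rfl : D = D' := h
  obtain rfl : E = E' := h'
  rfl

/-- A down set of a down set, as a down set whose quotient contains a down set. -/
def DownSet.flagEquiv (F : RootedForest S) :
    (Σ D : DownSet F, DownSet (F.restrict D.1)) ≃ (Σ E : DownSet F, DownSet (F.restrict E.1ᶜ)) where
  toFun x := ⟨⟨x.2.1, fun v hv => (x.2.2.1 hv).1, fun p c h hp =>
      x.2.2.2 p c ⟨h, (x.2.2.1 hp).2, x.1.2.2 p c h (x.2.2.1 hp).2⟩ hp⟩,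
    ⟨x.1.1 \ x.2.1, fun v hv => ⟨x.1.2.1 hv.1, hv.2⟩, fun p c h hp =>
      ⟨x.1.2.2 p c h.1 hp.1, h.2.2⟩⟩⟩
  invFun x := ⟨⟨x.1.1 ∪ x.2.1, Set.union_subset x.1.2.1 fun v hv => (x.2.2.1 hv).1,
      fun p c h hp => by
        by_cases hc : c ∈ x.1.1
        · exact Or.inl hc
        · have hp' : p ∉ x.1.1 := fun hp' => hc (x.1.2.2 p c h hp')
          exact Or.inr (x.2.2.2 p c ⟨h, hp', hc⟩ (hp.resolve_left hp'))⟩,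
    ⟨x.1.1, fun v hv => ⟨x.1.2.1 hv, Or.inl hv⟩, fun p c h hp => x.1.2.2 p c h.1 hp⟩⟩
  left_inv x := DownSet.sigma_ext (f := F.restrict)
    (Set.union_sdiff_cancel fun v hv => (x.2.2.1 hv).2) rfl
  right_inv x := DownSet.sigma_ext (f := fun D => F.restrict Dᶜ) rfl <|
    Set.union_sdiff_cancel_left fun v hv => (x.2.2.1 hv.2).2 hv.1

end RootedForest

namespace RootedForest

variable {S : Type u}

theorem cls_LRF_eq {F G : RootedForest S} :
    cls (C := LRF S) F = cls (C := LRF S) G ↔ Isomorphic F G :=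
  Quotient.eq (r := isoSetoid S)

/-- Relabeling of down sets. -/
def DownSet.mapEquiv (σ : Equiv.Perm S) (F : RootedForest S) : DownSet F ≃ DownSet (F.map σ) where
  toFun D := ⟨σ '' D.1, Set.image_mono D.2.1, fun p c h hp => by
    rw [Equiv.image_eq_preimage_symm] at hp ⊢
    exact D.2.2 _ _ h hp⟩
  invFun D := ⟨σ ⁻¹' D.1, fun v hv => by
      obtain ⟨w, hw, h⟩ := D.2.1 hv
      rwa [← σ.injective h], fun p c h hp => D.2.2 (σ p) (σ c) (by simpa [map] using h) hp⟩
  left_inv D := Subtype.ext (σ.injective.preimage_image _)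
  right_inv D := Subtype.ext (σ.surjective.image_preimage _)

/-- `T` is the disjoint union of `M` and `N`. -/
def IsUnion (M N T : RootedForest S) : Prop :=
  Disjoint M.verts N.verts ∧ T.verts = M.verts ∪ N.verts ∧
    ∀ p c, T.parent p c ↔ M.parent p c ∨ N.parent p c

theorem IsUnion.restrict {M N T : RootedForest S} (h : IsUnion M N T) (D : Set S) :
    IsUnion (M.restrict D) (N.restrict D) (T.restrict D) := by
  refine ⟨h.1.mono Set.inter_subset_left Set.inter_subset_left, ?_, fun p c => ?_⟩
  · simp only [RootedForest.restrict, h.2.1, Set.union_inter_distrib_right]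
  · simp only [RootedForest.restrict, h.2.2, or_and_right]

/-- The down sets of a disjoint union. -/
def DownSet.unionEquiv {M N T : RootedForest S} (h : IsUnion M N T) :
    DownSet M × DownSet N ≃ DownSet T where
  toFun x := ⟨x.1.1 ∪ x.2.1, by
      rw [h.2.1]; exact Set.union_subset_union x.1.2.1 x.2.2.1, fun p c hpc hp => by
        rcases (h.2.2 p c).1 hpc with hM | hN
        · refine Or.inl (x.1.2.2 p c hM (hp.resolve_right fun hp => ?_))
          exact Set.disjoint_left.1 h.1 (M.parent_mem _ _ hM).1 (x.2.2.1 hp)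
        · refine Or.inr (x.2.2.2 p c hN (hp.resolve_left fun hp => ?_))
          exact Set.disjoint_left.1 h.1 (x.1.2.1 hp) (N.parent_mem _ _ hN).1⟩
  invFun D := (⟨D.1 ∩ M.verts, Set.inter_subset_right, fun p c hpc hp =>
      ⟨D.2.2 p c ((h.2.2 p c).2 (Or.inl hpc)) hp.1, (M.parent_mem _ _ hpc).2⟩⟩,
    ⟨D.1 ∩ N.verts, Set.inter_subset_right, fun p c hpc hp =>
      ⟨D.2.2 p c ((h.2.2 p c).2 (Or.inr hpc)) hp.1, (N.parent_mem _ _ hpc).2⟩⟩)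
  left_inv x := by
    have h1 := x.1.2.1
    have h2 := x.2.2.1
    have h3 := Set.disjoint_left.1 h.1
    refine Prod.ext (Subtype.ext ?_) (Subtype.ext ?_) <;> ext v <;>
      simp only [Set.mem_inter_iff, Set.mem_union] <;>
      have h1 := @h1 v <;> have h2 := @h2 v <;> have h3 := @h3 v <;> tauto
  right_inv D := by
    refine Subtype.ext ((Set.inter_union_distrib_left _ _ _).symm.trans ?_)
    rw [← h.2.1]
    exact Set.inter_eq_left.2 D.2.1

theorem finite_setOf_verts_subset {T : Set S} (hT : T.Finite) :
    {F : RootedForest S | F.verts ⊆ T}.Finite := by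
  refine Set.Finite.of_finite_image (f := fun F => (F.verts, {x : S × S | F.parent x.1 x.2}))
    ((hT.finite_subsets.prod (hT.prod hT).finite_subsets).subset ?_) ?_
  · rintro _ ⟨F, hF, rfl⟩
    exact ⟨hF, fun x hx => ⟨hF (F.parent_mem _ _ hx).1, hF (F.parent_mem _ _ hx).2⟩⟩
  · rintro F - G - h
    simp only [Prod.mk.injEq] at h
    refine RootedForest.ext h.1 ?_
    ext p c
    exact Set.ext_iff.1 h.2 (p, c)

theorem Isomorphic.ncard_eq {F G : RootedForest S} (h : Isomorphic F G) :
    F.verts.ncard = G.verts.ncard := by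
  obtain ⟨f, hf, -⟩ := h
  rw [← hf.image_eq, hf.injOn.ncard_image]

theorem AdmissibleCut.below_subset {F : RootedForest S} (c : AdmissibleCut F) :
    c.below ⊆ F.verts :=
  (cutEquiv F c).2.1

theorem below_cutEquiv_symm {F : RootedForest S} (D : DownSet F) :
    ((cutEquiv F).symm D).below = D.1 :=
  congrArg Subtype.val ((cutEquiv F).apply_symm_apply D)

theorem below_eq_iff {F : RootedForest S} {c : AdmissibleCut F} {D : DownSet F} :
    c.below = D.1 ↔ c = (cutEquiv F).symm D := by
  rw [Equiv.eq_symm_apply, Subtype.ext_iff]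
  rfl

theorem exists_cut_map_equiv (σ : Equiv.Perm S) (F : RootedForest S) :
    ∃ e : AdmissibleCut F ≃ AdmissibleCut (F.map σ), ∀ c,
      (e c).P = c.P.map σ ∧ (e c).R = c.R.map σ := by
  refine ⟨(cutEquiv F).trans ((DownSet.mapEquiv σ F).trans (cutEquiv _).symm), fun c => ?_⟩
  have h : (((cutEquiv F).trans ((DownSet.mapEquiv σ F).trans (cutEquiv _).symm)) c).below =
    σ '' c.below := below_cutEquiv_symm _
  rw [AdmissibleCut.P, AdmissibleCut.P, AdmissibleCut.R, AdmissibleCut.R, h, map_restrict,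
    map_restrict, Set.image_compl_eq σ.bijective]
  exact ⟨rfl, rfl⟩

theorem exists_cut_flag_equiv (F : RootedForest S) :
    ∃ e : (Σ c : AdmissibleCut F, AdmissibleCut c.P) ≃ (Σ c : AdmissibleCut F, AdmissibleCut c.R),
      ∀ x, (e x).1.P = x.2.P ∧ (e x).2.P = x.2.R ∧ (e x).2.R = x.1.R := by
  -- Behind an existential only the effect on underlying vertex sets remains visible, and that
  -- determines everything below.
  have e1 : ∃ e : (Σ c : AdmissibleCut F, AdmissibleCut c.P) ≃
      (Σ D : DownSet F, DownSet (F.restrict D.1)),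
      ∀ x, (e x).1.1 = x.1.below ∧ (e x).2.1 = x.2.below :=
    ⟨(cutEquiv F).sigmaCongr fun c => cutEquiv c.P, fun _ => ⟨rfl, rfl⟩⟩
  have e2 : ∃ e : (Σ c : AdmissibleCut F, AdmissibleCut c.R) ≃
      (Σ D : DownSet F, DownSet (F.restrict D.1ᶜ)),
      ∀ x, (e x).1.1 = x.1.below ∧ (e x).2.1 = x.2.below :=
    ⟨(cutEquiv F).sigmaCongr fun c => cutEquiv c.R, fun _ => ⟨rfl, rfl⟩⟩
  obtain ⟨e1, h1⟩ := e1
  obtain ⟨e2, h2⟩ := e2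
  refine ⟨e1.trans ((DownSet.flagEquiv F).trans e2.symm), fun x => ?_⟩
  set y := (e1.trans ((DownSet.flagEquiv F).trans e2.symm)) x
  have hy : e2 y = DownSet.flagEquiv F (e1 x) := e2.apply_symm_apply _
  have h3 : y.1.below = x.2.below := by
    rw [← (h2 y).1, ← (h1 x).2, hy]
    rfl
  have h4 : y.2.below = x.1.below \ x.2.below := by
    rw [← (h2 y).2, ← (h1 x).1, ← (h1 x).2, hy]
    rfl
  have h5 : x.2.below ⊆ x.1.below := x.2.below_subset.trans Set.inter_subset_right
  refine ⟨?_, ?_, ?_⟩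
  · change F.restrict y.1.below = (F.restrict x.1.below).restrict x.2.below
    rw [h3, restrict_restrict, Set.inter_eq_right.2 h5]
  · change (F.restrict y.1.belowᶜ).restrict y.2.below =
      (F.restrict x.1.below).restrict x.2.belowᶜ
    rw [h3, h4, restrict_restrict, restrict_restrict, Set.sdiff_eq, Set.inter_left_comm,
      Set.inter_self]
  · change (F.restrict y.1.belowᶜ).restrict y.2.belowᶜ = F.restrict x.1.belowᶜ
    rw [h3, h4, restrict_restrict, ← Set.compl_union, Set.union_sdiff_cancel h5]

theorem inter_eq_inter_union {A B D E : Set S} (h : Disjoint A B) (hE : E ⊆ B) :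
    A ∩ D = A ∩ (D ∪ E) := by
  rw [Set.inter_union_distrib_left, (h.mono_right hE).inter_eq, Set.union_empty]

theorem exists_cut_union_equiv {M N T : RootedForest S} (h : IsUnion M N T) :
    ∃ e : AdmissibleCut M × AdmissibleCut N ≃ AdmissibleCut T,
      ∀ x, IsUnion x.1.P x.2.P (e x).P ∧ IsUnion x.1.R x.2.R (e x).R := by
  refine ⟨((cutEquiv M).prodCongr (cutEquiv N)).trans
    ((DownSet.unionEquiv h).trans (cutEquiv T).symm), fun x => ?_⟩
  set y := (((cutEquiv M).prodCongr (cutEquiv N)).trans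
    ((DownSet.unionEquiv h).trans (cutEquiv T).symm)) x
  have he : y.below = x.1.below ∪ x.2.below := below_cutEquiv_symm _
  have hM : M.verts ∩ x.1.below = M.verts ∩ y.below := by
    rw [he]
    exact inter_eq_inter_union h.1 x.2.below_subset
  have hN : N.verts ∩ x.2.below = N.verts ∩ y.below := by
    rw [he, Set.union_comm]
    exact inter_eq_inter_union h.1.symm x.1.below_subset
  have hM' : M.verts ∩ x.1.belowᶜ = M.verts ∩ y.belowᶜ := by
    rw [← Set.sdiff_eq, ← Set.sdiff_eq, ← Set.sdiff_self_inter, hM, Set.sdiff_self_inter]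
  have hN' : N.verts ∩ x.2.belowᶜ = N.verts ∩ y.belowᶜ := by
    rw [← Set.sdiff_eq, ← Set.sdiff_eq, ← Set.sdiff_self_inter, hN, Set.sdiff_self_inter]
  rw [AdmissibleCut.P, AdmissibleCut.P, AdmissibleCut.R, AdmissibleCut.R, restrict_congr hM,
    restrict_congr hN, restrict_congr hM', restrict_congr hN']
  exact ⟨h.restrict _, h.restrict _⟩

theorem exists_bot_cut (F : RootedForest S) :
    ∃ c : AdmissibleCut F, c.R = F ∧ ∀ c' : AdmissibleCut F, c'.P.verts = ∅ ↔ c' = c := by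
  refine ⟨(cutEquiv F).symm ⟨∅, by simp⟩, restrict_eq_self ?_, fun c => ?_⟩
  · rw [below_cutEquiv_symm]
    simp
  · rw [← below_eq_iff]
    exact iff_of_eq (congrArg (· = ∅) (Set.inter_eq_right.2 c.below_subset))

theorem exists_top_cut (F : RootedForest S) :
    ∃ c : AdmissibleCut F, c.P = F ∧ ∀ c' : AdmissibleCut F, c'.R.verts = ∅ ↔ c' = c := by
  refine ⟨(cutEquiv F).symm ⟨F.verts, subset_rfl, fun p c h _ => (F.parent_mem _ _ h).2⟩,
    restrict_eq_self ?_, fun c => ?_⟩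
  · rw [below_cutEquiv_symm]
  · rw [← below_eq_iff]
    change F.verts ∩ c.belowᶜ = ∅ ↔ c.below = F.verts
    rw [← Set.sdiff_eq, Set.sdiff_eq_empty]
    exact ⟨fun h => c.below_subset.antisymm h, fun h => h.ge⟩

theorem isFinitary_LRF [Infinite S] : (LRF S).IsFinitary where
  exists_equiv_of_cls_eq F G h := by
    obtain ⟨σ, rfl⟩ := (cls_LRF_eq.1 h).exists_perm
    obtain ⟨e, he⟩ := exists_cut_map_equiv σ F
    exact ⟨e, fun c => ⟨(congrArg cls (he c).1).trans (cls_LRF_eq.2 (isomorphic_map σ _)).symm,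
      (congrArg cls (he c).2).trans (cls_LRF_eq.2 (isomorphic_map σ _)).symm⟩⟩
  exists_flag_equiv F := by
    obtain ⟨e, he⟩ := exists_cut_flag_equiv F
    exact ⟨e, fun x => ⟨congrArg cls (he x).1, congrArg cls (he x).2.1, congrArg cls (he x).2.2⟩⟩
  exists_union_equiv M N T h := exists_cut_union_equiv h
  exists_bot F := by
    obtain ⟨c, h, h'⟩ := exists_bot_cut F
    exact ⟨c, congrArg cls h, fun c' => cls_LRF_eq.trans (isomorphic_empty_iff.trans (h' c'))⟩
  exists_top F := by
    obtain ⟨c, h, h'⟩ := exists_top_cut F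
    exact ⟨c, congrArg cls h, fun c' => cls_LRF_eq.trans (isomorphic_empty_iff.trans (h' c'))⟩
  exists_size := by
    refine ⟨Quotient.lift (s := isoSetoid S) (fun F => F.verts.ncard) fun _ _ => Isomorphic.ncard_eq,
      fun n => ?_, fun F c => ?_⟩
    · obtain ⟨T, hT, hT'⟩ := exists_finite_label_set S n
      refine ((finite_setOf_verts_subset hT).image (cls (C := LRF S))).subset fun A hA => ?_
      induction A using Quotient.inductionOn with | h F =>
      obtain ⟨σ, hσ⟩ := hT' F.verts F.finite_verts hA
      exact ⟨F.map σ, hσ, (cls_LRF_eq.2 (isomorphic_map σ F)).symm⟩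
    · change F.verts.ncard ≤ (F.verts ∩ c.below).ncard + (F.verts ∩ c.belowᶜ).ncard
      exact (Set.ncard_inter_add_ncard_sdiff_eq_ncard F.verts c.below F.finite_verts).ge

end RootedForest

/-! ### Trivalent graphs: components and the loop condition -/

theorem Set.ncard_sUnion_of_pairwiseDisjoint {S : Type*} {X : Set (Set S)} {k : ℕ}
    (hX : X.Finite) (hk : ∀ x ∈ X, x.ncard = k) (hf : ∀ x ∈ X, x.Finite)
    (hd : X.PairwiseDisjoint id) : (⋃₀ X).ncard = X.ncard * k := by
  induction X, hX using Set.Finite.induction_on with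
  | empty => simp
  | @insert a X ha hX ih =>
    rw [Set.sUnion_insert, Set.ncard_union_eq _ (hf a (Set.mem_insert _ _))
      (hX.sUnion fun x hx => hf x (Set.mem_insert_of_mem _ hx)), hk a (Set.mem_insert _ _),
      ih (fun x hx => hk x (Set.mem_insert_of_mem _ hx))
        (fun x hx => hf x (Set.mem_insert_of_mem _ hx)) (hd.subset (Set.subset_insert _ _)),
      Set.ncard_insert_of_notMem ha hX]
    · ring
    · refine Set.disjoint_sUnion_right.2 fun x hx =>
        hd (Set.mem_insert _ _) (Set.mem_insert_of_mem _ hx) ?_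
      rintro rfl
      exact ha hx

theorem Set.PairwiseDisjoint.eq_of_mem {S : Type*} {X : Set (Set S)} (h : X.PairwiseDisjoint id)
    {e e' : Set S} (he : e ∈ X) (he' : e' ∈ X) {x : S} (hx : x ∈ e) (hx' : x ∈ e') : e = e' :=
  h.elim he he' (Set.not_disjoint_iff.2 ⟨x, hx, hx'⟩)

theorem reflTransGen_symm {S : Type*} {r : S → S → Prop} (hr : ∀ a b, r a b → r b a) {a b : S}
    (h : Relation.ReflTransGen r a b) : Relation.ReflTransGen r b a := by
  induction h with
  | refl => exact .refl
  | tail _ h ih => exact .head (hr _ _ h) ih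

namespace HalfEdgeGraph

variable {S : Type u}

/-- Finite graphs in which every vertex has exactly three half-edges and every half-edge is at
exactly one vertex and adjacent to at most one other half-edge. -/
structure IsTrivalent (G : HalfEdgeGraph S) : Prop where
  finite_verts : G.verts.Finite
  vert_card : ∀ v ∈ G.verts, v.ncard = 3
  vert_disjoint : G.verts.PairwiseDisjoint id
  edge_card : ∀ e ∈ G.edges, e.ncard = 2
  edge_disjoint : G.edges.PairwiseDisjoint id
  edge_subset : ∀ e ∈ G.edges, e ⊆ G.halves

theorem IsFeynman.isTrivalent {G : HalfEdgeGraph S} (h : G.IsFeynman) : G.IsTrivalent :=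
  ⟨h.finite_verts, h.vert_card, h.vert_disjoint, h.edge_card, h.edge_disjoint, h.edge_subset⟩

section Components

variable {G : HalfEdgeGraph S} {h k : S}

theorem mem_comp_self : h ∈ G.comp h := Relation.ReflTransGen.refl

theorem mem_comp_symm (hk : k ∈ G.comp h) : h ∈ G.comp k :=
  reflTransGen_symm (fun _ _ ⟨x, hx, ha, hb⟩ => ⟨x, hx, hb, ha⟩) hk

theorem mem_comp_trans {l : S} (hk : k ∈ G.comp h) (hl : l ∈ G.comp k) : l ∈ G.comp h :=
  Relation.ReflTransGen.trans hk hl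

theorem comp_eq (hk : k ∈ G.comp h) : G.comp k = G.comp h :=
  Set.Subset.antisymm (fun _ hl => mem_comp_trans hk hl)
    fun _ hl => mem_comp_trans (mem_comp_symm hk) hl

theorem legs_eq (hk : k ∈ G.comp h) : G.legs k = G.legs h := by
  rw [legs, legs, comp_eq hk]

theorem mem_legs_self (hh : h ∈ G.ext_edges) : h ∈ G.legs h := ⟨mem_comp_self, hh⟩

theorem subset_comp {x : Set S} (hx : x ∈ G.verts ∪ G.edges) (hk : k ∈ x) (hkh : k ∈ G.comp h) :
    x ⊆ G.comp h := fun _ hl => mem_comp_trans hkh (.single ⟨x, hx, hk, hl⟩)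

theorem comp_subset {D : Set S} (hh : h ∈ D)
    (hD : ∀ x ∈ G.verts ∪ G.edges, ∀ a ∈ x, a ∈ D → x ⊆ D) : G.comp h ⊆ D := by
  intro k hk
  induction hk with
  | refl => exact hh
  | tail _ h ih =>
    obtain ⟨x, hx, ha, hb⟩ := h
    exact hD x hx _ ha ih hb

theorem legs_subset_ext : G.legs h ⊆ G.ext_edges := Set.inter_subset_right

theorem legs_subset_comp : G.legs h ⊆ G.comp h := Set.inter_subset_left

theorem legs_subset_halves : G.legs h ⊆ G.halves := fun _ hx => hx.2.1

/-- A graph contains the component of a half-edge in a larger graph if it contains the vertices and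
edges there. -/
theorem comp_eq_of_subset {A B : HalfEdgeGraph S} (hv : A.verts ⊆ B.verts)
    (he : A.edges ⊆ B.edges)
    (hc : ∀ x ∈ B.verts ∪ B.edges, ∀ a ∈ x, a ∈ A.comp h → x ∈ A.verts ∪ A.edges) :
    B.comp h = A.comp h :=
  (comp_subset mem_comp_self fun x hx a ha h => subset_comp (hc x hx a ha h) ha h).antisymm
    (comp_subset mem_comp_self fun _ hx _ ha h =>
      subset_comp (Set.union_subset_union hv he hx) ha h)

theorem comp_mono {A B : HalfEdgeGraph S} (hv : A.verts ⊆ B.verts) (he : A.edges ⊆ B.edges) :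
    A.comp h ⊆ B.comp h :=
  comp_subset mem_comp_self fun _ hx _ ha h => subset_comp (Set.union_subset_union hv he hx) ha h

end Components

namespace IsTrivalent

variable {G : HalfEdgeGraph S} (hG : G.IsTrivalent) {h k : S}
include hG

theorem vert_finite {v : Set S} (hv : v ∈ G.verts) : v.Finite :=
  Set.finite_of_ncard_ne_zero (by rw [hG.vert_card v hv]; simp)

theorem edge_finite {e : Set S} (he : e ∈ G.edges) : e.Finite :=
  Set.finite_of_ncard_ne_zero (by rw [hG.edge_card e he]; simp)

theorem finite_halves : G.halves.Finite := hG.finite_verts.sUnion fun _ => hG.vert_finite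

theorem finite_edges : G.edges.Finite :=
  hG.finite_halves.finite_subsets.subset fun e he => hG.edge_subset e he

theorem nonempty_of_vert {v : Set S} (hv : v ∈ G.verts) : v.Nonempty :=
  Set.nonempty_of_ncard_ne_zero (by rw [hG.vert_card v hv]; simp)

theorem nonempty_of_edge {e : Set S} (he : e ∈ G.edges) : e.Nonempty :=
  Set.nonempty_of_ncard_ne_zero (by rw [hG.edge_card e he]; simp)

theorem comp_subset_halves (hh : h ∈ G.halves) : G.comp h ⊆ G.halves := by
  refine comp_subset hh fun x hx a _ _ => ?_
  rcases hx with hx | hx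
  · exact Set.subset_sUnion_of_mem hx
  · exact hG.edge_subset x hx

/-- Double count of the half-edges of a component: three at each vertex; two on each internal edge,
plus the external ones. -/
theorem card_comp (hh : h ∈ G.halves) :
    {v ∈ G.verts | v ⊆ G.comp h}.ncard * 3 =
      {e ∈ G.edges | e ⊆ G.comp h}.ncard * 2 + (G.legs h).ncard := by
  have h1 : ⋃₀ {v ∈ G.verts | v ⊆ G.comp h} = G.comp h := by
    refine (Set.sUnion_subset fun v hv => hv.2).antisymm fun k hk => ?_
    obtain ⟨v, hv, hkv⟩ := hG.comp_subset_halves hh hk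
    exact ⟨v, ⟨hv, subset_comp (Or.inl hv) hkv hk⟩, hkv⟩
  have h2 : G.comp h = ⋃₀ {e ∈ G.edges | e ⊆ G.comp h} ∪ G.legs h := by
    refine Set.Subset.antisymm (fun k hk => ?_)
      (Set.union_subset (Set.sUnion_subset fun v hv => hv.2) legs_subset_comp)
    by_cases hke : k ∈ ⋃₀ G.edges
    · obtain ⟨e, he, hke⟩ := hke
      exact Or.inl ⟨e, ⟨he, subset_comp (Or.inr he) hke hk⟩, hke⟩
    · exact Or.inr ⟨hk, hG.comp_subset_halves hh hk, hke⟩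
  have hfin := hG.finite_halves.subset (hG.comp_subset_halves hh)
  rw [← Set.ncard_sUnion_of_pairwiseDisjoint (hG.finite_verts.subset fun v hv => hv.1)
      (fun v hv => hG.vert_card v hv.1) (fun v hv => hG.vert_finite hv.1)
      (hG.vert_disjoint.subset fun v hv => hv.1),
    ← Set.ncard_sUnion_of_pairwiseDisjoint (hG.finite_edges.subset fun v hv => hv.1)
      (fun v hv => hG.edge_card v hv.1) (fun v hv => hG.edge_finite hv.1)
      (hG.edge_disjoint.subset fun v hv => hv.1), h1]
  conv_lhs => rw [h2]
  refine Set.ncard_union_eq ?_ (hfin.subset (Set.sUnion_subset fun v hv => hv.2))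
    (hfin.subset legs_subset_comp)
  refine Set.disjoint_left.2 fun k ⟨e, he, hk⟩ hk' => hk'.2.2 ⟨e, he.1, hk⟩

theorem comp_eq_vert {v : Set S} (hv : v ∈ G.verts) (hve : v ⊆ G.ext_edges) (hh : h ∈ v) :
    G.comp h = v := by
  refine (comp_subset hh fun x hx a ha hav => ?_).antisymm
    (subset_comp (Or.inl hv) hh mem_comp_self)
  rcases hx with hx | hx
  · rw [hG.vert_disjoint.eq_of_mem hx hv ha hav]
  · exact ((hve hav).2 ⟨x, hx, ha⟩).elim

/-- By `card_comp`, 3V = 2E + l with l = 2 or 3 and V > 0, so V > E occurs only for V = 1, E = 0, l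
= 3. The loop condition therefore only excludes isolated vertices. -/
theorem isFeynman (h1 : ∀ h ∈ G.halves, (G.legs h).ncard = 2 ∨ (G.legs h).ncard = 3)
    (h2 : ∀ v ∈ G.verts, ¬ v ⊆ G.ext_edges) : G.IsFeynman where
  __ := hG
  legs_card := h1
  loop h hh := by
    have hc := hG.card_comp hh
    obtain ⟨v, hv, hhv⟩ := id hh
    have hvc : v ⊆ G.comp h := subset_comp (Or.inl hv) hhv mem_comp_self
    obtain ⟨x, hx, hx'⟩ := Set.not_subset.1 (h2 v hv)
    have hx2 : x ∈ ⋃₀ G.edges := by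
      by_contra hx2
      exact hx' ⟨⟨v, hv, hx⟩, hx2⟩
    obtain ⟨e, he, hxe⟩ := hx2
    have hV : 0 < {v ∈ G.verts | v ⊆ G.comp h}.ncard :=
      (Set.ncard_pos (hG.finite_verts.subset fun v hv => hv.1)).2 ⟨v, hv, hvc⟩
    have hE : 0 < {e ∈ G.edges | e ⊆ G.comp h}.ncard :=
      (Set.ncard_pos (hG.finite_edges.subset fun v hv => hv.1)).2
        ⟨e, he, subset_comp (Or.inr he) hxe (hvc hx)⟩
    have := h1 h hh
    omega

end IsTrivalent

/-- Such a vertex would be a whole component without edges, against the loop condition. -/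
theorem IsFeynman.not_vert_subset_ext {G : HalfEdgeGraph S} (hG : G.IsFeynman) {v : Set S}
    (hv : v ∈ G.verts) : ¬ v ⊆ G.ext_edges := by
  intro hve
  obtain ⟨h, hh⟩ := hG.isTrivalent.nonempty_of_vert hv
  have hc := hG.isTrivalent.comp_eq_vert hv hve hh
  have h1 := hG.loop h ⟨v, hv, hh⟩
  have hV : 0 < {v ∈ G.verts | v ⊆ G.comp h}.ncard :=
    (Set.ncard_pos (hG.finite_verts.subset fun v hv => hv.1)).2 ⟨v, hv, hc.ge⟩
  obtain ⟨e, he, hec⟩ := Set.nonempty_of_ncard_ne_zero (hV.trans_le h1).ne'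
  obtain ⟨x, hx⟩ := hG.isTrivalent.nonempty_of_edge he
  rw [hc] at hec
  exact (hve (hec hx)).2 ⟨e, he, hx⟩

theorem IsFeynman.exists_leg {G : HalfEdgeGraph S} (hG : G.IsFeynman) {h : S}
    (hh : h ∈ G.halves) : (G.legs h).Nonempty := by
  refine Set.nonempty_of_ncard_ne_zero ?_
  rcases hG.legs_card h hh with h | h <;> rw [h] <;> simp

end HalfEdgeGraph

/-! ### Alternating paths of two matchings -/

section Matchings

variable {S : Type*}

/-- Two labels belong to a common member of one of two families of sets. -/
def MatchStep (X Y : Set (Set S)) (a b : S) : Prop :=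
  (∃ e ∈ X, a ∈ e ∧ b ∈ e) ∨ (∃ e ∈ Y, a ∈ e ∧ b ∈ e)

/-- The involution swaps the two members of each pair and fixes every other label. -/
theorem exists_involution_of_matching {X : Set (Set S)} (hX : ∀ e ∈ X, e.ncard = 2)
    (hd : X.PairwiseDisjoint id) : ∃ α : Equiv.Perm S, (∀ x, α (α x) = x) ∧
      (∀ e ∈ X, ∀ x ∈ e, α x ≠ x ∧ α x ∈ e ∧ ∀ y ∈ e, y = x ∨ y = α x) ∧
      ∀ x, x ∉ ⋃₀ X → α x = x := by
  have key : ∀ x, ∃ y, (∀ e ∈ X, x ∈ e → y ≠ x ∧ y ∈ e ∧ ∀ z ∈ e, z = x ∨ z = y) ∧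
      (x ∉ ⋃₀ X → y = x) := by
    intro x
    by_cases hx : x ∈ ⋃₀ X
    · obtain ⟨e, he, hxe⟩ := hx
      have h2 := hX e he
      obtain ⟨a, b, hab, rfl⟩ := Set.ncard_eq_two.1 h2
      have : ∃ y, y ≠ x ∧ y ∈ ({a, b} : Set S) ∧ ∀ z ∈ ({a, b} : Set S), z = x ∨ z = y := by
        rcases hxe with rfl | rfl
        · exact ⟨b, hab.symm, by simp, by simp⟩
        · exact ⟨a, hab, by simp, by simp [or_comm]⟩
      obtain ⟨y, hy⟩ := this
      refine ⟨y, fun e' he' hxe' => ?_, fun h => (h ⟨_, he, hxe⟩).elim⟩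
      rwa [hd.eq_of_mem he' he hxe' hxe]
    · exact ⟨x, fun e he hxe => (hx ⟨e, he, hxe⟩).elim, fun _ => rfl⟩
  choose α h1 h2 using key
  have hinv : Function.Involutive α := by
    intro x
    by_cases hx : x ∈ ⋃₀ X
    · obtain ⟨e, he, hxe⟩ := hx
      have h3 := h1 x e he hxe
      have h4 := h1 (α x) e he h3.2.1
      exact ((h3.2.2 _ h4.2.1).resolve_right h4.1)
    · rw [h2 x hx, h2 x hx]
  exact ⟨hinv.toPerm, hinv, fun e he x hx => h1 x e he hx, h2⟩

/-- A maximal alternating path of two matchings has exactly two ends. -/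
theorem exists_other_end {X Y : Set (Set S)} (hX : ∀ e ∈ X, e.ncard = 2)
    (hXd : X.PairwiseDisjoint id) (hY : ∀ e ∈ Y, e.ncard = 2) (hYd : Y.PairwiseDisjoint id)
    (hfin : (⋃₀ X).Finite) (hXY : ∀ e ∈ Y, ∀ a ∈ e, a ∈ ⋃₀ X → e ⊆ ⋃₀ X) {r : S}
    (hr : r ∈ ⋃₀ X) (hrY : r ∉ ⋃₀ Y) :
    ∃ r', r' ≠ r ∧ r' ∉ ⋃₀ Y ∧ Relation.ReflTransGen (MatchStep X Y) r r' ∧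
      ∀ s, s ∉ ⋃₀ Y → Relation.ReflTransGen (MatchStep X Y) r s → s = r ∨ s = r' := by
  obtain ⟨α, hα, hαX, hα'⟩ := exists_involution_of_matching hX hXd
  obtain ⟨β, hβ, hβY, hβ'⟩ := exists_involution_of_matching hY hYd
  have hαmem : ∀ x ∈ ⋃₀ X, α x ∈ ⋃₀ X ∧ α x ≠ x := by
    rintro x ⟨e, he, hx⟩
    exact ⟨⟨e, he, (hαX e he x hx).2.1⟩, (hαX e he x hx).1⟩
  have hβmem : ∀ x ∈ ⋃₀ X, β x ∈ ⋃₀ X := by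
    intro x hx
    by_cases hxY : x ∈ ⋃₀ Y
    · obtain ⟨e, he, hxe⟩ := hxY
      exact hXY e he x hxe hx (hβY e he x hxe).2.1
    · rwa [hβ' x hxY]
  have hαstep : ∀ x ∈ ⋃₀ X, MatchStep X Y x (α x) := by
    rintro x ⟨e, he, hx⟩
    exact Or.inl ⟨e, he, hx, (hαX e he x hx).2.1⟩
  have hβstep : ∀ x, Relation.ReflTransGen (MatchStep X Y) x (β x) := by
    intro x
    by_cases hxY : x ∈ ⋃₀ Y
    · obtain ⟨e, he, hxe⟩ := hxY
      exact .single (Or.inr ⟨e, he, hxe, (hβY e he x hxe).2.1⟩)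
    · rw [hβ' x hxY]
  have hβr := hβ' r hrY
  have hβfix : ∀ x, x ∉ ⋃₀ Y ↔ β x = x := by
    refine fun x => ⟨hβ' x, ?_⟩
    rintro h ⟨e, he, hx⟩
    exact (hβY e he x hx).1 h
  -- α and β generate a dihedral action. Since β fixes r, the alternating path of r is its orbit
  -- under p = αβ; on exponents, β acts by k ↦ -k and α by k ↦ 1 - k.
  obtain ⟨p, hp⟩ : ∃ p : Equiv.Perm S, p = α * β := ⟨_, rfl⟩
  have hpinv : ∀ x, p⁻¹ x = β (α x) := by
    intro x
    rw [Equiv.Perm.inv_eq_iff_eq, hp, Equiv.Perm.mul_apply, hβ, hα]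
  have hpow : ∀ n : ℕ, (p ^ n) r ∈ ⋃₀ X ∧
      Relation.ReflTransGen (MatchStep X Y) r ((p ^ n) r) := by
    intro n
    induction n with
    | zero => exact ⟨hr, .refl⟩
    | succ n ih =>
      have h : (p ^ (n + 1)) r = α (β ((p ^ n) r)) := by
        rw [pow_succ', Equiv.Perm.mul_apply]
        conv_lhs => rw [hp]
        conv_rhs => rw [hp]
        rfl
      rw [h]
      have := hβmem _ ih.1
      exact ⟨(hαmem _ this).1, (ih.2.trans (hβstep _)).tail (hαstep _ this)⟩
  have hβp : ∀ k : ℤ, β ((p ^ k) r) = (p ^ (-k)) r := by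
    have hconj : β * p * β⁻¹ = p⁻¹ := by
      ext x
      rw [hpinv, hp]
      simp [Equiv.Perm.mul_apply]
    intro k
    have := congrArg (fun q : Equiv.Perm S => q r) (conj_zpow (i := k) (a := β) (b := p))
    simp only [hconj, Equiv.Perm.mul_apply] at this
    rw [Equiv.Perm.inv_eq_iff_eq.2 hβr.symm, inv_zpow, ← zpow_neg] at this
    exact this.symm
  have hαp : ∀ k : ℤ, α ((p ^ k) r) = (p ^ (1 - k)) r := by
    intro k
    have : α ((p ^ k) r) = p (β ((p ^ k) r)) := by rw [hp, Equiv.Perm.mul_apply, hβ]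
    rw [this, hβp, sub_eq_add_neg, zpow_one_add, Equiv.Perm.mul_apply]
  have hclass : ∀ s, Relation.ReflTransGen (MatchStep X Y) r s → ∃ k : ℤ, s = (p ^ k) r := by
    intro s hs
    induction hs with
    | refl => exact ⟨0, by simp⟩
    | tail _ hstep ih =>
      obtain ⟨k, rfl⟩ := ih
      rcases hstep with ⟨e, he, ha, hb⟩ | ⟨e, he, ha, hb⟩
      · rcases (hαX e he _ ha).2.2 _ hb with h | h
        · exact ⟨k, h⟩
        · exact ⟨1 - k, h.trans (hαp k)⟩
      · rcases (hβY e he _ ha).2.2 _ hb with h | h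
        · exact ⟨k, h⟩
        · exact ⟨-k, h.trans (hβp k)⟩
  have hdvd : ∀ k : ℤ, (p ^ k) r = r ↔ (MulAction.period p r : ℤ) ∣ k := fun k =>
    MulAction.zpow_smul_eq_iff_period_dvd (g := p) (a := r)
  obtain ⟨n, hn⟩ : ∃ n, n = MulAction.period p r := ⟨_, rfl⟩
  rw [← hn] at hdvd
  -- The period is 0 by convention if no positive power fixes r; then the powers would give
  -- infinitely many labels in a finite set.
  have hn0 : 0 < n := by
    rw [Nat.pos_iff_ne_zero]
    rintro rfl
    have hinj : Function.Injective fun k : ℕ => (p ^ k) r := by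
      intro i j hij
      have : (p ^ ((j : ℤ) - i)) r = r := by
        rw [sub_eq_neg_add, zpow_add, Equiv.Perm.mul_apply, zpow_natCast]
        simp only at hij
        rw [← hij, zpow_neg, zpow_natCast]
        simp
      rw [hdvd] at this
      simp at this
      omega
    exact Set.infinite_of_injective_forall_mem hinj (fun k => (hpow k).1) hfin
  -- If n were odd, k = (n + 1) / 2 would satisfy 1 - k ≡ k modulo n, so α would fix a label that it
  -- has to move.
  have heven : n % 2 = 0 := by
    by_contra hodd
    have h1 : (p ^ ((n + 1) / 2 : ℕ)) r = (p ^ (1 - ((n + 1) / 2 : ℕ) : ℤ)) r := by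
      have h2 : (p ^ (n : ℤ)) r = r := (hdvd _).2 dvd_rfl
      have h3 : (1 - ((n + 1) / 2 : ℕ) : ℤ) + n = ((n + 1) / 2 : ℕ) := by omega
      rw [← zpow_natCast]
      conv_lhs => rw [← h3, zpow_add, Equiv.Perm.mul_apply, h2]
    rw [← hαp, zpow_natCast] at h1
    exact (hαmem _ (hpow _).1).2 h1.symm
  -- The ends of the path are the fixed points of β, that is 2k ≡ 0 modulo n; as n is even, these
  -- are k = 0 and k = n / 2.
  have hfixed : ∀ k : ℤ, (p ^ k) r ∉ ⋃₀ Y ↔ (n : ℤ) ∣ 2 * k := by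
    intro k
    rw [hβfix, hβp, ← hdvd, two_mul, zpow_add, Equiv.Perm.mul_apply, zpow_neg,
      Equiv.Perm.inv_eq_iff_eq, eq_comm]
  refine ⟨(p ^ (n / 2)) r, fun h => ?_, ?_, (hpow _).2, fun s hs hrs => ?_⟩
  · have := (hdvd (n / 2 : ℕ)).1 (by rwa [zpow_natCast])
    have := Nat.le_of_dvd (by omega) (Int.natCast_dvd_natCast.1 this)
    omega
  · rw [← zpow_natCast, hfixed]
    exact ⟨1, by omega⟩
  · obtain ⟨k, rfl⟩ := hclass s hrs
    obtain ⟨c, hc⟩ := (hfixed k).1 hs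
    obtain ⟨m, rfl⟩ : ∃ m, n = 2 * m := ⟨n / 2, by omega⟩
    have hk : k = m * c := by
      push_cast at hc
      linarith
    rcases Int.even_or_odd' c with ⟨d, rfl | rfl⟩
    · exact Or.inl ((hdvd k).2 ⟨d, by rw [hk]; push_cast; ring⟩)
    · right
      have h1 : (p ^ ((2 * m : ℕ) * d : ℤ)) r = r := (hdvd _).2 ⟨d, rfl⟩
      have h2 : k = m + (2 * m : ℕ) * d := by rw [hk]; push_cast; ring
      rw [h2, zpow_add, Equiv.Perm.mul_apply, h1, Nat.mul_div_cancel_left _ two_pos, zpow_natCast]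

end Matchings

/-! ### Contraction of a subgraph -/

namespace HalfEdgeGraph

variable {S : Type u}

/-- The edges outside a subgraph. -/
def freeEdges (M L : HalfEdgeGraph S) : Set (Set S) := {e | e ∈ M.edges ∧ e ∉ L.edges}

/-- The pairs of external edges of the components with two external edges. -/
def legPairs (L : HalfEdgeGraph S) : Set (Set S) := {p | ∃ h ∈ L.halves, p = L.legs h ∧ p.ncard = 2}

/-- Half-edges connected by a chain of edges outside `L` and components of `L` with two external
edges. -/
def Chain (M L : HalfEdgeGraph S) : S → S → Prop := Relation.ReflTransGen (Linked M L)

/-- Free edges and leg pairs are the two matchings to which `exists_other_end` is applied. -/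
theorem linked_iff {M L : HalfEdgeGraph S} {a b : S} :
    Linked M L a b ↔ MatchStep (freeEdges M L) (legPairs L) a b := by
  constructor
  · rintro (⟨e, h1, h2, h3⟩ | ⟨h, h1, h2, h3⟩)
    · exact Or.inl ⟨e, ⟨h1, h2⟩, h3⟩
    · exact Or.inr ⟨_, ⟨h, h1, rfl, h2⟩, h3⟩
  · rintro (⟨e, ⟨h1, h2⟩, h3⟩ | ⟨_, ⟨h, h1, rfl, h2⟩, h3⟩)
    · exact Or.inl ⟨e, h1, h2, h3⟩
    · exact Or.inr ⟨h, h1, h2, h3⟩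

theorem linked_eq (M L : HalfEdgeGraph S) :
    Linked M L = MatchStep (freeEdges M L) (legPairs L) := by
  ext a b
  exact linked_iff

theorem Linked.symm {M L : HalfEdgeGraph S} {a b : S} (h : Linked M L a b) : Linked M L b a := by
  rcases h with ⟨e, h1, h2, h3, h4⟩ | ⟨h, h1, h2, h3, h4⟩
  · exact Or.inl ⟨e, h1, h2, h4, h3⟩
  · exact Or.inr ⟨h, h1, h2, h4, h3⟩

theorem Chain.symm {M L : HalfEdgeGraph S} {a b : S} (h : Chain M L a b) : Chain M L b a :=
  reflTransGen_symm (fun _ _ => Linked.symm) h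

theorem Chain.trans {M L : HalfEdgeGraph S} {a b c : S} (h : Chain M L a b)
    (h' : Chain M L b c) : Chain M L a c := Relation.ReflTransGen.trans h h'

theorem chain_of_freeEdges {M L : HalfEdgeGraph S} {e : Set S} (he : e ∈ freeEdges M L) {a b : S}
    (ha : a ∈ e) (hb : b ∈ e) : Chain M L a b := .single (Or.inl ⟨e, he.1, he.2, ha, hb⟩)

theorem chain_of_legs {M L : HalfEdgeGraph S} {h : S} (hh : h ∈ L.halves)
    (h2 : (L.legs h).ncard = 2) {a b : S} (ha : a ∈ L.legs h) (hb : b ∈ L.legs h) :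
    Chain M L a b := .single (Or.inr ⟨h, hh, h2, ha, hb⟩)

theorem legPairs_disjoint (L : HalfEdgeGraph S) : L.legPairs.PairwiseDisjoint id := by
  rintro _ ⟨h, -, rfl, -⟩ _ ⟨k, -, rfl, -⟩ hne
  refine Set.disjoint_left.2 fun x hx hx' => hne ?_
  rw [← legs_eq hx.1, ← legs_eq hx'.1]

theorem mem_legPairs_iff {L : HalfEdgeGraph S} {x : S} :
    x ∈ ⋃₀ L.legPairs ↔ x ∈ L.ext_edges ∧ (L.legs x).ncard = 2 := by
  constructor
  · rintro ⟨_, ⟨h, -, rfl, h2⟩, hx⟩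
    exact ⟨hx.2, by rw [legs_eq hx.1, h2]⟩
  · rintro ⟨hx, h2⟩
    exact ⟨_, ⟨x, hx.1, rfl, h2⟩, mem_legs_self hx⟩

namespace IsSubgraph

variable {M L : HalfEdgeGraph S} (hL : L.IsSubgraph M) (hM : M.IsTrivalent) {x y h : S}

include hL in
theorem halves_subset : L.halves ⊆ M.halves := Set.sUnion_subset_sUnion hL.verts_subset

include hL in
theorem ext_of_ext (hx : x ∈ L.halves) (hxM : x ∈ M.ext_edges) : x ∈ L.ext_edges :=
  ⟨hx, fun ⟨e, he, hxe⟩ => hxM.2 ⟨e, hL.edges_subset he, hxe⟩⟩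

include hL in
theorem comp_subset_comp : L.comp h ⊆ M.comp h := comp_mono hL.verts_subset hL.edges_subset

include hL hM

theorem ext_of_free (hx : x ∈ ⋃₀ freeEdges M L) (hxL : x ∈ L.halves) : x ∈ L.ext_edges := by
  obtain ⟨e, he, hxe⟩ := hx
  refine ⟨hxL, fun ⟨e', he', hxe'⟩ => he.2 ?_⟩
  rwa [hM.edge_disjoint.eq_of_mem he.1 (hL.edges_subset he') hxe hxe']

theorem mem_verts (hv : h ∈ L.halves) {v : Set S} (hvM : v ∈ M.verts) (hh : h ∈ v) :
    v ∈ L.verts := by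
  obtain ⟨w, hw, hhw⟩ := hv
  rwa [hM.vert_disjoint.eq_of_mem hvM (hL.verts_subset hw) hh hhw]

omit hL in
theorem _root_.HalfEdgeGraph.IsTrivalent.mem_halves_of_free (hx : x ∈ ⋃₀ freeEdges M L) :
    x ∈ M.halves := by
  obtain ⟨e, he, hxe⟩ := hx
  exact hM.edge_subset e he.1 hxe

omit hL hM in
theorem _root_.HalfEdgeGraph.not_ext_of_free (hx : x ∈ ⋃₀ freeEdges M L) : x ∉ M.ext_edges := by
  obtain ⟨e, he, hxe⟩ := hx
  exact fun h => h.2 ⟨e, he.1, hxe⟩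

omit hL hM in
theorem _root_.HalfEdgeGraph.free_of_not_ext (hx : x ∈ M.halves) (hx' : x ∉ M.ext_edges)
    (hxL : x ∈ ⋃₀ L.edges → x ∈ L.halves ∧ x ∈ L.ext_edges) : x ∈ ⋃₀ freeEdges M L := by
  have : x ∈ ⋃₀ M.edges := by
    by_contra h
    exact hx' ⟨hx, h⟩
  obtain ⟨e, he, hxe⟩ := this
  exact ⟨e, ⟨he, fun heL => (hxL ⟨e, heL, hxe⟩).2.2 ⟨e, heL, hxe⟩⟩, hxe⟩

omit hM in
theorem free_of_ext (hx : x ∈ L.ext_edges) (hx' : x ∉ M.ext_edges) : x ∈ ⋃₀ freeEdges M L :=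
  free_of_not_ext (hL.halves_subset hx.1) hx' fun _ => ⟨hx.1, hx⟩

/-- A component of a subgraph all of whose external edges are external is a whole component. -/
theorem comp_eq_of_legs_subset (hh : h ∈ L.halves) (hl : L.legs h ⊆ M.ext_edges) :
    M.comp h = L.comp h := by
  refine comp_eq_of_subset hL.verts_subset hL.edges_subset fun x hx a ha hah => ?_
  have haL := hL.isFeynman.isTrivalent.comp_subset_halves hh hah
  rcases hx with hx | hx
  · exact Or.inl (hL.mem_verts hM haL hx ha)
  · refine Or.inr ?_
    by_contra hxL
    have := hL.ext_of_free hM ⟨x, ⟨hx, hxL⟩, ha⟩ haL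
    exact (hl ⟨hah, this⟩).2 ⟨x, hx, ha⟩

theorem legs_eq_of_legs_subset (hh : h ∈ L.halves) (hl : L.legs h ⊆ M.ext_edges) :
    M.legs h = L.legs h := by
  have hc := hL.comp_eq_of_legs_subset hM hh hl
  refine Set.Subset.antisymm (fun x hx => ?_) fun x hx => ⟨hc ▸ hx.1, hl hx⟩
  have hxL : x ∈ L.comp h := hc ▸ hx.1
  exact ⟨hxL, hL.ext_of_ext (hL.isFeynman.isTrivalent.comp_subset_halves hh hxL) hx.2⟩

omit hM in
-- By `two_legs`, if one leg of a pair is internal in M then so is the other, and a leg of L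
-- internal in M lies on a free edge. So an alternating path cannot stop in the middle of a removed
-- component.
theorem free_of_pair {p : Set S} (hp : p ∈ L.legPairs) (hx : x ∈ p) (hx' : x ∈ ⋃₀ freeEdges M L) :
    p ⊆ ⋃₀ freeEdges M L := by
  obtain ⟨h, hh, rfl, h2⟩ := hp
  intro y hy
  rcases hL.two_legs h hh h2 with h | h
  · exact (not_ext_of_free hx' (h hx)).elim
  · exact hL.free_of_ext hy.2 (Set.disjoint_left.1 h hy)

theorem mem_halves_contract_iff : x ∈ (M.contract L).halves ↔ x ∈ M.halves ∧
    (x ∈ L.halves → x ∈ L.ext_edges ∧ (L.legs x).ncard = 3 ∧ ¬ L.legs x ⊆ M.ext_edges) := by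
  constructor
  · rintro ⟨v, ⟨hv, hvL⟩ | ⟨h, hh, rfl, h3, hne⟩, hx⟩
    · exact ⟨⟨v, hv, hx⟩, fun hxL => (hvL (hL.mem_verts hM hxL hv hx)).elim⟩
    · refine ⟨hL.halves_subset hx.2.1, fun _ => ⟨hx.2, ?_⟩⟩
      rw [legs_eq hx.1]
      exact ⟨h3, hne⟩
  · rintro ⟨hx, hxL⟩
    by_cases h : x ∈ L.halves
    · obtain ⟨h1, h2, h3⟩ := hxL h
      exact ⟨_, Or.inr ⟨x, h, rfl, h2, h3⟩, mem_legs_self h1⟩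
    · obtain ⟨v, hv, hxv⟩ := hx
      exact ⟨v, Or.inl ⟨hv, fun hvL => h ⟨v, hvL, hxv⟩⟩, hxv⟩

theorem contract_halves_subset : (M.contract L).halves ⊆ M.halves :=
  fun _ hx => ((hL.mem_halves_contract_iff hM).1 hx).1

theorem not_mem_legPairs (hx : x ∈ (M.contract L).halves) : x ∉ ⋃₀ L.legPairs := by
  intro h
  rw [mem_legPairs_iff] at h
  have := (((hL.mem_halves_contract_iff hM).1 hx).2 h.1.1).2.1
  omega

omit hL hM in
theorem _root_.HalfEdgeGraph.mem_contract_of_leg (hh : h ∈ L.halves) (h3 : (L.legs h).ncard = 3)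
    (hne : ¬ L.legs h ⊆ M.ext_edges) : L.legs h ⊆ (M.contract L).halves :=
  fun _ hx => ⟨_, Or.inr ⟨h, hh, rfl, h3, hne⟩, hx⟩

theorem mem_contract_of_not_mem (hx : x ∈ M.halves) (hxL : x ∉ L.halves) :
    x ∈ (M.contract L).halves :=
  (hL.mem_halves_contract_iff hM).2 ⟨hx, fun h => (hxL h).elim⟩

/-- With `not_mem_legPairs`: among half-edges on free edges, the survivors are precisely the ends of
alternating paths. -/
theorem mem_contract_of_free (hx : x ∈ ⋃₀ freeEdges M L) (hx' : x ∉ ⋃₀ L.legPairs) :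
    x ∈ (M.contract L).halves := by
  refine (hL.mem_halves_contract_iff hM).2 ⟨hM.mem_halves_of_free hx, fun hxL => ?_⟩
  have h1 := hL.ext_of_free hM hx hxL
  rw [mem_legPairs_iff] at hx'
  exact ⟨h1, (hL.isFeynman.legs_card x hxL).resolve_left fun h => hx' ⟨h1, h⟩,
    fun h => not_ext_of_free hx (h (mem_legs_self h1))⟩

theorem free_of_mem_contract (hx : x ∈ (M.contract L).halves) (hx' : x ∉ M.ext_edges) :
    x ∈ ⋃₀ freeEdges M L := by
  have := (hL.mem_halves_contract_iff hM).1 hx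
  refine free_of_not_ext this.1 hx' fun ⟨e, he, hxe⟩ => ?_
  have hxL := hL.isFeynman.edge_subset e he hxe
  exact ⟨hxL, (this.2 hxL).1⟩

omit hM in
theorem chain_free (hx : x ∈ ⋃₀ freeEdges M L) (hxy : Chain M L x y) :
    y ∈ ⋃₀ freeEdges M L := by
  induction hxy with
  | refl => exact hx
  | tail _ h ih =>
    rw [linked_iff] at h
    rcases h with ⟨e, he, -, hb⟩ | ⟨p, hp, ha, hb⟩
    · exact ⟨e, he, hb⟩
    · exact hL.free_of_pair hp ha ih hb

omit hM in
theorem chain_subset_comp (hxy : Chain M L x y) : y ∈ M.comp x := by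
  induction hxy with
  | refl => exact mem_comp_self
  | tail _ h ih =>
    rcases h with ⟨e, h1, h2, h3, h4⟩ | ⟨h, h1, h2, h3, h4⟩
    · exact subset_comp (Or.inr h1) h3 ih h4
    · exact mem_comp_trans ih (hL.comp_subset_comp (mem_comp_trans (mem_comp_symm h3.1) h4.1))

omit hL in
theorem finite_free : (⋃₀ freeEdges M L).Finite :=
  hM.finite_halves.subset fun _ => hM.mem_halves_of_free

/-- A remaining half-edge is adjacent to exactly one other in the quotient if it is internal. -/
theorem exists_partner (hx : x ∈ (M.contract L).halves) (hx' : x ∉ M.ext_edges) :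
    ∃ y ∈ (M.contract L).halves, y ≠ x ∧ Chain M L x y ∧
      ∀ z ∈ (M.contract L).halves, Chain M L x z → z = x ∨ z = y := by
  have hxX := hL.free_of_mem_contract hM hx hx'
  obtain ⟨y, h1, h2, h3, h4⟩ := exists_other_end (X := freeEdges M L) (Y := L.legPairs)
    (fun e he => hM.edge_card e he.1) (hM.edge_disjoint.subset fun e he => he.1)
    (by rintro _ ⟨h, -, rfl, h2⟩; exact h2) L.legPairs_disjoint (finite_free hM)
    (fun p hp a ha haX => hL.free_of_pair hp ha haX) hxX (hL.not_mem_legPairs hM hx)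
  rw [← linked_eq] at h3 h4
  exact ⟨y, hL.mem_contract_of_free hM (hL.chain_free hxX h3) h2, h1, h3,
    fun z hz hxz => h4 z (hL.not_mem_legPairs hM hz) hxz⟩

/-- A chain of edges ends if its component is not entirely removed. -/
theorem exists_end (hx : x ∈ ⋃₀ freeEdges M L) (hy : y ∈ (M.contract L).halves)
    (hxy : y ∈ M.comp x) : ∃ z ∈ (M.contract L).halves, Chain M L x z := by
  by_contra! hcon
  have hpair : ∀ z, Chain M L x z → z ∈ L.ext_edges ∧ (L.legs z).ncard = 2 := fun z hxz => by
    rw [← mem_legPairs_iff]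
    by_contra hz
    exact hcon z (hL.mem_contract_of_free hM (hL.chain_free hx hxz) hz) hxz
  -- If no survivor is reached, the two-legged components of L met by the chain form a set closed
  -- under the vertices and edges of M. It contains the whole component of x, hence y, which then
  -- cannot survive.
  have hsub : M.comp x ⊆ {a | ∃ z, Chain M L x z ∧ a ∈ L.comp z} := by
    refine comp_subset ⟨x, .refl, mem_comp_self⟩ ?_
    rintro e he a ha ⟨z, hxz, haz⟩ b hb
    have hz := hpair z hxz
    have haL := hL.isFeynman.isTrivalent.comp_subset_halves hz.1.1 haz
    rcases he with he | he
    · exact ⟨z, hxz, subset_comp (Or.inl (hL.mem_verts hM haL he ha)) ha haz hb⟩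
    · by_cases heL : e ∈ L.edges
      · exact ⟨z, hxz, subset_comp (Or.inr heL) ha haz hb⟩
      · have haE := hL.ext_of_free hM ⟨e, ⟨he, heL⟩, ha⟩ haL
        exact ⟨b, (hxz.trans (chain_of_legs hz.1.1 hz.2 (mem_legs_self hz.1) ⟨haz, haE⟩)).trans
          (chain_of_freeEdges ⟨he, heL⟩ ha hb), mem_comp_self⟩
  obtain ⟨z, hxz, hyz⟩ := hsub hxy
  have hz := hpair z hxz
  have h3 := (((hL.mem_halves_contract_iff hM).1 hy).2
    (hL.isFeynman.isTrivalent.comp_subset_halves hz.1.1 hyz)).2.1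
  rw [legs_eq hyz, hz.2] at h3
  omega

omit hL hM in
theorem _root_.HalfEdgeGraph.mem_comp_contract (hx : x ∈ (M.contract L).halves)
    (hy : y ∈ (M.contract L).halves) (hxy : Chain M L x y) : y ∈ (M.contract L).comp x := by
  by_cases h : x = y
  · exact h ▸ mem_comp_self
  · exact .single ⟨{x, y}, Or.inr ⟨x, hx, y, hy, h, hxy, rfl⟩, by simp, by simp⟩

/-- Contraction neither merges nor splits components. For the harder inclusion, each half-edge of M
is represented by survivors (itself if outside L, otherwise the ends of chains from the legs of its
component of L), and connectedness of the representatives to x propagates along vertices and edges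
of M. -/
theorem comp_contract (hx : x ∈ (M.contract L).halves) :
    (M.contract L).comp x = M.comp x ∩ (M.contract L).halves := by
  set Q := M.contract L with hQ
  have hLT := hL.isFeynman.isTrivalent
  refine Set.Subset.antisymm (comp_subset ⟨mem_comp_self, hx⟩ ?_) ?_
  · rintro e (he | he) a ha ⟨hac, haQ⟩ b hb
    · refine ⟨?_, e, he, hb⟩
      rcases he with ⟨he, -⟩ | ⟨h, hh, rfl, -⟩
      · exact subset_comp (Or.inl he) ha hac hb
      · exact mem_comp_trans hac
          (hL.comp_subset_comp (mem_comp_trans (mem_comp_symm ha.1) hb.1))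
    · obtain ⟨c, hc, d, hd, -, hcd, rfl⟩ := he
      rcases ha with rfl | rfl <;> rcases hb with rfl | rfl
      · exact ⟨hac, haQ⟩
      · exact ⟨mem_comp_trans hac (hL.chain_subset_comp hcd), hd⟩
      · exact ⟨mem_comp_trans hac (hL.chain_subset_comp (Chain.symm hcd)), hc⟩
      · exact ⟨hac, haQ⟩
  · -- the half-edges all of whose representatives in the quotient are connected to `x`
    have key : M.comp x ⊆ {a | a ∈ M.comp x ∧ (a ∉ L.halves → a ∈ Q.comp x) ∧ (a ∈ L.halves →
        ∀ l ∈ L.legs a, ∀ r ∈ Q.halves, Chain M L l r → r ∈ Q.comp x)} := by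
      refine comp_subset ⟨mem_comp_self, fun _ => mem_comp_self, fun hxL l hl r hr hlr => ?_⟩ ?_
      · obtain ⟨h1, h2, h3⟩ := ((hL.mem_halves_contract_iff hM).1 hx).2 hxL
        have hlQ := mem_contract_of_leg hxL h2 h3 hl
        refine mem_comp_trans ?_ (mem_comp_contract hlQ hr hlr)
        exact subset_comp (Or.inl (Or.inr ⟨x, hxL, rfl, h2, h3⟩)) (mem_legs_self h1)
          mem_comp_self hl
      · rintro e he a ha ⟨hac, ha1, ha2⟩ b hb
        have hbc : b ∈ M.comp x := subset_comp he ha hac hb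
        by_cases heL : e ∈ L.verts ∪ L.edges
        · have haL : a ∈ L.halves := heL.elim (fun h => ⟨e, h, ha⟩) fun h => hLT.edge_subset e h ha
          have hbL : b ∈ L.halves := heL.elim (fun h => ⟨e, h, hb⟩) fun h => hLT.edge_subset e h hb
          refine ⟨hbc, fun h => (h hbL).elim, fun _ => ?_⟩
          rw [legs_eq (subset_comp heL ha mem_comp_self hb)]
          exact ha2 haL
        · rw [Set.mem_union, not_or] at heL
          rcases he with he | he
          · have haL : a ∉ L.halves := fun h => heL.1 (hL.mem_verts hM h he ha)
            have hbL : b ∉ L.halves := fun h => heL.1 (hL.mem_verts hM h he hb)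
            refine ⟨hbc, fun _ => ?_, fun h => (hbL h).elim⟩
            exact subset_comp (Or.inl (Or.inl ⟨he, heL.1⟩)) ha (ha1 haL) hb
          · have hef : e ∈ freeEdges M L := ⟨he, heL.2⟩
            -- As x survives, the chain through e has a surviving end r, which represents both a and
            -- b.
            obtain ⟨r, hr, har⟩ := hL.exists_end hM ⟨e, hef, ha⟩ hx (mem_comp_symm hac)
            have hrx : r ∈ Q.comp x := by
              by_cases haL : a ∈ L.halves
              · exact ha2 haL a (mem_legs_self (hL.ext_of_free hM ⟨e, hef, ha⟩ haL)) r hr har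
              · exact mem_comp_trans (ha1 haL)
                  (mem_comp_contract (hL.mem_contract_of_not_mem hM (hM.edge_subset e he ha) haL)
                    hr har)
            have hrb : Chain M L r b := har.symm.trans (chain_of_freeEdges hef ha hb)
            refine ⟨hbc, fun hbL => ?_, fun hbL l hl s hs hls => ?_⟩
            · exact mem_comp_trans hrx (mem_comp_contract hr
                (hL.mem_contract_of_not_mem hM (hM.edge_subset e he hb) hbL) hrb)
            · have hbE := hL.ext_of_free hM ⟨e, hef, hb⟩ hbL
              rcases hL.isFeynman.legs_card b hbL with h2 | h3
              · exact mem_comp_trans hrx (mem_comp_contract hr hs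
                  ((hrb.trans (chain_of_legs hbL h2 (mem_legs_self hbE) hl)).trans hls))
              · have hne : ¬ L.legs b ⊆ M.ext_edges := fun h =>
                  not_ext_of_free ⟨e, hef, hb⟩ (h (mem_legs_self hbE))
                have hsub := mem_contract_of_leg hbL h3 hne
                have hb' := mem_comp_trans hrx
                  (mem_comp_contract hr (hsub (mem_legs_self hbE)) hrb)
                have hl' : l ∈ Q.comp x := subset_comp (Or.inl (Or.inr ⟨b, hbL, rfl, h3, hne⟩))
                  (mem_legs_self hbE) hb' hl
                exact mem_comp_trans hl' (mem_comp_contract (hsub hl) hs hls)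
    rintro y ⟨hy, hyQ⟩
    obtain ⟨-, h1, h2⟩ := key hy
    by_cases hyL : y ∈ L.halves
    · exact h2 hyL y (mem_legs_self (((hL.mem_halves_contract_iff hM).1 hyQ).2 hyL).1) y hyQ .refl
    · exact h1 hyL

/-- A surviving half-edge internal in M gets a partner from `exists_partner`; one external in M lies
on no edge of M and on no leg pair, so no chain leaves it. -/
theorem ext_contract : (M.contract L).ext_edges = (M.contract L).halves ∩ M.ext_edges := by
  ext x
  constructor
  · rintro ⟨hx, hx'⟩
    refine ⟨hx, ?_⟩
    by_contra hxM
    obtain ⟨y, hy, hyx, hxy, -⟩ := hL.exists_partner hM hx hxM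
    exact hx' ⟨{x, y}, ⟨x, hx, y, hy, hyx.symm, hxy, rfl⟩, by simp⟩
  · rintro ⟨hx, hxM⟩
    refine ⟨hx, ?_⟩
    have hno : ∀ y, Linked M L x y → False := by
      rintro y (⟨e, he, -, hxe, -⟩ | ⟨h, hh, h2, hxh, -⟩)
      · exact hxM.2 ⟨e, he, hxe⟩
      · exact hL.not_mem_legPairs hM hx ⟨_, ⟨h, hh, rfl, h2⟩, hxh⟩
    have hno' : ∀ y, Chain M L x y → y = x := by
      intro y hy
      rcases Relation.ReflTransGen.cases_head hy with h | ⟨z, hz, -⟩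
      · exact h.symm
      · exact (hno z hz).elim
    rintro ⟨_, ⟨a, -, b, -, hab, hch, rfl⟩, hxe⟩
    rcases hxe with rfl | rfl
    · exact hab (hno' b hch).symm
    · exact hab (hno' a (Chain.symm hch))

/-- The point is that no external edge y of M in the component of x is lost. If y lies in L, its
component of L is not a whole component of M, since x survives; then `two_legs` rules out two legs,
so there are three and y survives. -/
theorem legs_contract (hx : x ∈ (M.contract L).halves) : (M.contract L).legs x = M.legs x := by
  rw [legs, legs, hL.comp_contract hM hx, hL.ext_contract hM]
  refine Set.Subset.antisymm (fun y hy => ⟨hy.1.1, hy.2.2⟩) fun y hy => ?_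
  suffices hyQ : y ∈ (M.contract L).halves from ⟨⟨hy.1, hyQ⟩, hyQ, hy.2⟩
  refine (hL.mem_halves_contract_iff hM).2 ⟨hy.2.1, fun hyL => ?_⟩
  have hyE := hL.ext_of_ext hyL hy.2
  have hne : ¬ L.legs y ⊆ M.ext_edges := fun hsub => by
    have hxy : x ∈ L.comp y := by
      rw [← hL.comp_eq_of_legs_subset hM hyL hsub]
      exact mem_comp_symm hy.1
    have h3 := (((hL.mem_halves_contract_iff hM).1 hx).2
      (hL.isFeynman.isTrivalent.comp_subset_halves hyL hxy)).2.2
    rw [legs_eq hxy] at h3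
    exact h3 hsub
  refine ⟨hyE, (hL.isFeynman.legs_card y hyL).resolve_left fun h2 => ?_, hne⟩
  rcases hL.two_legs y hyL h2 with h | h
  · exact hne h
  · exact Set.disjoint_left.1 h (mem_legs_self hyE) hy.2

/-- Disjointness of the new edges is the uniqueness in `exists_partner`. -/
theorem isTrivalent_contract : (M.contract L).IsTrivalent where
  finite_verts := by
    refine hM.finite_halves.finite_subsets.subset fun v hv x hx => ?_
    exact hL.contract_halves_subset hM ⟨v, hv, hx⟩
  vert_card := by
    rintro v (⟨hv, -⟩ | ⟨h, -, rfl, h3, -⟩)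
    · exact hM.vert_card v hv
    · exact h3
  vert_disjoint := by
    have aux : ∀ v ∈ M.verts, v ∉ L.verts → ∀ h ∈ L.halves, Disjoint v (L.legs h) := by
      intro v hv hvL h hh
      refine Set.disjoint_left.2 fun x hx hx' => hvL (hL.mem_verts hM hx'.2.1 hv hx)
    rintro v (⟨hv, hvL⟩ | ⟨h, hh, rfl, -⟩) w (⟨hw, hwL⟩ | ⟨k, hk, rfl, -⟩) hne
    · exact hM.vert_disjoint hv hw hne
    · exact aux v hv hvL k hk
    · exact (aux w hw hwL h hh).symm
    · refine Set.disjoint_left.2 fun x hx hx' => hne ?_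
      rw [← legs_eq hx.1, ← legs_eq hx'.1]
  edge_card := by
    rintro e ⟨a, -, b, -, hab, -, rfl⟩
    exact Set.ncard_pair hab
  edge_disjoint := by
    have aux : ∀ e ∈ (M.contract L).edges, ∀ x ∈ e, ∃ y, x ∈ (M.contract L).halves ∧
        y ∈ (M.contract L).halves ∧ y ≠ x ∧ Chain M L x y ∧ e = {x, y} := by
      rintro e ⟨a, ha, b, hb, hab, hch, rfl⟩ x (rfl | rfl)
      · exact ⟨b, ha, hb, hab.symm, hch, rfl⟩
      · exact ⟨a, hb, ha, hab, Chain.symm hch, Set.pair_comm _ _⟩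
    intro e he e' he' hne
    refine Set.disjoint_left.2 fun x hx hx' => hne ?_
    obtain ⟨y, hxQ, hy, hyx, hxy, rfl⟩ := aux e he x hx
    obtain ⟨y', -, hy', hyx', hxy', rfl⟩ := aux e' he' x hx'
    have hxM : x ∉ M.ext_edges := fun h =>
      (((hL.ext_contract hM).ge ⟨hxQ, h⟩)).2 ⟨_, he, hx⟩
    obtain ⟨z, -, -, -, hz⟩ := hL.exists_partner hM hxQ hxM
    rw [(hz y hy hxy).resolve_left hyx, (hz y' hy' hxy').resolve_left hyx']
  edge_subset := by
    rintro e ⟨a, ha, b, hb, -, -, rfl⟩ x (rfl | rfl)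
    · exact ha
    · exact hb

end IsSubgraph

/-- The quotient of a Feynman graph by a subgraph is a Feynman graph. -/
theorem IsFeynman.contract {M L : HalfEdgeGraph S} (hM : M.IsFeynman) (hL : L.IsSubgraph M) :
    (M.contract L).IsFeynman := by
  refine (hL.isTrivalent_contract hM.isTrivalent).isFeynman (fun x hx => ?_) fun v hv => ?_
  · rw [hL.legs_contract hM.isTrivalent hx]
    exact hM.legs_card x (hL.contract_halves_subset hM.isTrivalent hx)
  · rw [hL.ext_contract hM.isTrivalent]
    intro hsub
    have hsub' := hsub.trans Set.inter_subset_right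
    rcases hv with ⟨hv, -⟩ | ⟨h, -, rfl, -, hne⟩
    · exact hM.not_vert_subset_ext hv hsub'
    · exact hne hsub'

end HalfEdgeGraph

/-! ### Flags of subgraphs -/

namespace HalfEdgeGraph

variable {S : Type u} {M N L K : HalfEdgeGraph S} {x y h : S}

theorem Chain.mono (he : N.edges ⊆ M.edges) (hxy : Chain N L x y) : Chain M L x y := by
  refine Relation.ReflTransGen.mono (fun a b hab => ?_) _ _ hxy
  rcases hab with ⟨e, h1, h2⟩ | h
  · exact Or.inl ⟨e, he h1, h2⟩
  · exact Or.inr h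

/-- A half-edge is on at most one edge of M, so a chain that starts on an edge of N continues along
edges of N; crossing a leg pair of L leads again to an edge of N because L satisfies `two_legs` in
N. -/
theorem Chain.of_free (hL : L.IsSubgraph N) (hM : M.IsTrivalent) (he : N.edges ⊆ M.edges)
    (hx : x ∈ ⋃₀ freeEdges N L) (hxy : Chain M L x y) :
    Chain N L x y ∧ y ∈ ⋃₀ freeEdges N L := by
  induction hxy with
  | refl => exact ⟨.refl, hx⟩
  | tail _ hab ih =>
    rcases hab with ⟨e, h1, h2, h3, h4⟩ | hab
    · obtain ⟨e', he', ha⟩ := ih.2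
      have := hM.edge_disjoint.eq_of_mem h1 (he he'.1) h3 ha
      subst this
      exact ⟨ih.1.trans (chain_of_freeEdges he' h3 h4), e, he', h4⟩
    · have hN : Linked N L _ _ := Or.inr hab
      exact ⟨ih.1.tail hN, hL.chain_free ih.2 (.single hN)⟩

theorem ext_edges_inter (he : N.edges ⊆ M.edges) (hx : x ∈ N.halves) (hxM : x ∈ M.ext_edges) :
    x ∈ N.ext_edges := ⟨hx, fun ⟨e, heN, hxe⟩ => hxM.2 ⟨e, he heN, hxe⟩⟩

namespace IsSubgraph

theorem refl (hM : M.IsFeynman) : M.IsSubgraph M where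
  isFeynman := hM
  verts_subset := subset_rfl
  edges_subset := subset_rfl
  two_legs _ _ _ := Or.inl legs_subset_ext

/-- A two-legged component of L with legs external in N is a whole component of N, where the
condition for N applies; otherwise its legs are internal in N, hence in M. -/
theorem trans (hL : L.IsSubgraph N) (hN : N.IsSubgraph M) : L.IsSubgraph M where
  isFeynman := hL.isFeynman
  verts_subset := hL.verts_subset.trans hN.verts_subset
  edges_subset := hL.edges_subset.trans hN.edges_subset
  two_legs h hh h2 := by
    rcases hL.two_legs h hh h2 with hl | hl
    · have := hL.legs_eq_of_legs_subset hN.isFeynman.isTrivalent hh hl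
      rw [← this]
      exact hN.two_legs h (hL.halves_subset hh) (by rw [this, h2])
    · exact Or.inr (Set.disjoint_left.2 fun x hx hxM => Set.disjoint_left.1 hl hx
        (hN.ext_of_ext (hL.halves_subset hx.2.1) hxM))

/-- A component that is not entirely removed by a contraction meets the quotient. -/
theorem exists_mem_contract (hL : L.IsSubgraph M) (hM : M.IsFeynman) (hh : h ∈ M.halves) :
    (∃ r ∈ (M.contract L).halves, r ∈ M.comp h) ∨ (h ∈ L.halves ∧ L.legs h ⊆ M.ext_edges) := by
  by_cases hr : ∃ r ∈ (M.contract L).halves, r ∈ M.comp h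
  · exact Or.inl hr
  · push Not at hr
    obtain ⟨l, hl⟩ := hM.exists_leg hh
    have hlL : l ∈ L.halves := by
      by_contra h
      exact hr l (hL.mem_contract_of_not_mem hM.isTrivalent hl.2.1 h) hl.1
    have hlE := hL.ext_of_ext hlL hl.2
    have hsub : L.legs l ⊆ M.ext_edges := by
      rcases hL.isFeynman.legs_card l hlL with h2 | h3
      · exact (hL.two_legs l hlL h2).resolve_right fun h =>
          Set.disjoint_left.1 h (mem_legs_self hlE) hl.2
      · by_contra hne
        exact hr l (mem_contract_of_leg hlL h3 hne (mem_legs_self hlE)) hl.1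
    have hhl : h ∈ L.comp l := by
      rw [← hL.comp_eq_of_legs_subset hM.isTrivalent hlL hsub]
      exact mem_comp_symm hl.1
    exact Or.inr ⟨hL.isFeynman.isTrivalent.comp_subset_halves hlL hhl, by rwa [legs_eq hhl]⟩

theorem not_ext_of_mem_edge (hL : L.IsSubgraph M) (hM : M.IsTrivalent)
    (hx : x ∈ ⋃₀ (M.contract L).edges) : x ∉ M.ext_edges := by
  obtain ⟨e, he, hxe⟩ := hx
  intro h
  exact ((hL.ext_contract hM).ge ⟨(hL.isTrivalent_contract hM).edge_subset e he hxe, h⟩).2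
    ⟨e, he, hxe⟩

theorem free_of_mem_edge (hL : L.IsSubgraph M) (hM : M.IsTrivalent)
    (hx : x ∈ ⋃₀ (M.contract L).edges) : x ∈ ⋃₀ freeEdges M L := by
  refine hL.free_of_mem_contract hM ?_ (hL.not_ext_of_mem_edge hM hx)
  obtain ⟨e, he, hxe⟩ := hx
  exact (hL.isTrivalent_contract hM).edge_subset e he hxe

theorem mem_edge_of_chain (hL : L.IsSubgraph M) (hM : M.IsTrivalent) {e : Set S}
    (he : e ∈ (M.contract L).edges) (hx : x ∈ e) (hy : y ∈ (M.contract L).halves)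
    (hxy : Chain M L x y) : y ∈ e := by
  by_cases h : x = y
  · exact h ▸ hx
  · have hxQ := (hL.isTrivalent_contract hM).edge_subset e he hx
    have he' : ({x, y} : Set S) ∈ (M.contract L).edges := ⟨x, hxQ, y, hy, h, hxy, rfl⟩
    rw [(hL.isTrivalent_contract hM).edge_disjoint.eq_of_mem he he' hx (by simp)]
    simp

/-- The condition on two-legged components passes from N to N/L because `legs_contract` identifies
their legs. -/
theorem contract_mono (hL : L.IsSubgraph N) (hN : N.IsSubgraph M) (hM : M.IsTrivalent) :
    (N.contract L).IsSubgraph (M.contract L) := by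
  have hLM := hL.trans hN
  have hNT := hN.isFeynman.isTrivalent
  have hv : (N.contract L).verts ⊆ (M.contract L).verts := by
    rintro v (⟨hv, hvL⟩ | ⟨h, hh, rfl, h3, hne⟩)
    · exact Or.inl ⟨hN.verts_subset hv, hvL⟩
    · refine Or.inr ⟨h, hh, rfl, h3, fun hsub => hne fun x hx => ?_⟩
      exact hN.ext_of_ext (hL.halves_subset hx.2.1) (hsub hx)
  have hhalves : (N.contract L).halves ⊆ (M.contract L).halves := Set.sUnion_subset_sUnion hv
  refine ⟨hN.isFeynman.contract hL, hv, ?_, fun h hh h2 => ?_⟩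
  · rintro e ⟨a, ha, b, hb, hab, hch, rfl⟩
    exact ⟨a, hhalves ha, b, hhalves hb, hab, Chain.mono hN.edges_subset hch, rfl⟩
  · rw [hLM.ext_contract hM]
    have hsub : (N.contract L).legs h ⊆ (M.contract L).halves :=
      legs_subset_halves.trans hhalves
    rw [hL.legs_contract hNT hh] at h2 hsub ⊢
    rcases hN.two_legs h (hL.contract_halves_subset hNT hh) h2 with hl | hl
    · exact Or.inl (Set.subset_inter hsub hl)
    · exact Or.inr (hl.mono_right Set.inter_subset_right)

/-- An edge of M/L is a chain outside L. Either it lies on free edges of N throughout, and is an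
edge of N/L, or it avoids them; in the latter case every leg pair of L that it crosses belongs to a
whole component of N, so it is a chain outside N. -/
theorem chain_contract (hL : L.IsSubgraph N) (hN : N.IsSubgraph M) (hM : M.IsTrivalent)
    (hxy : Chain (M.contract L) (N.contract L) x y) : Chain M N x y := by
  have hLM := hL.trans hN
  have hNT := hN.isFeynman.isTrivalent
  -- a chain outside `L` that avoids the edges of `N`
  have avoid : ∀ a b, a ∉ ⋃₀ freeEdges N L → Chain M L a b → Chain M N a b := by
    intro a b ha hab
    induction hab with
    | refl => exact .refl
    | @tail b c hab hbc ih =>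
      have hb : b ∉ ⋃₀ freeEdges N L := fun hb =>
        ha (Chain.of_free hL hM hN.edges_subset hb (Chain.symm hab)).2
      refine ih.tail ?_
      rcases hbc with ⟨e, h1, h2, h3, h4⟩ | ⟨h, hh, h2, h3, h4⟩
      · exact Or.inl ⟨e, h1, fun heN => hb ⟨e, ⟨heN, h2⟩, h3⟩, h3, h4⟩
      · have hbN : b ∈ N.ext_edges := by
          by_contra hbN
          exact hb (hL.free_of_ext h3.2 hbN)
        have hsub := (hL.two_legs h hh h2).resolve_right fun hd => Set.disjoint_left.1 hd h3 hbN
        have := hL.legs_eq_of_legs_subset hNT hh hsub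
        refine Or.inr ⟨h, hL.halves_subset hh, ?_⟩
        rw [this]
        exact ⟨h2, h3, h4⟩
  have hedge : ∀ a ∈ (M.contract L).halves, ∀ b ∈ (M.contract L).halves, a ≠ b → Chain M L a b →
      ({a, b} : Set S) ∉ (N.contract L).edges → Chain M N a b := by
    intro a ha b hb hab hch he
    refine avoid a b (fun haN => he ?_) hch
    have h1 := Chain.of_free hL hM hN.edges_subset haN hch
    have aux : ∀ z ∈ (M.contract L).halves, z ∈ ⋃₀ freeEdges N L → z ∈ (N.contract L).halves :=
      fun z hz hzN => hL.mem_contract_of_free hNT hzN (hLM.not_mem_legPairs hM hz)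
    exact ⟨a, aux a ha haN, b, aux b hb h1.2, hab, h1.1, rfl⟩
  induction hxy with
  | refl => exact .refl
  | tail _ hbc ih =>
    refine ih.trans ?_
    rcases hbc with ⟨e, ⟨a, ha, b, hb, hab, hch, rfl⟩, h2, h3, h4⟩ | ⟨h, hh, h2, h3, h4⟩
    · have := hedge a ha b hb hab hch h2
      rcases h3 with rfl | rfl <;> rcases h4 with rfl | rfl
      · exact .refl
      · exact this
      · exact this.symm
      · exact .refl
    · rw [hL.legs_contract hNT hh] at h2 h3 h4
      exact chain_of_legs (hL.contract_halves_subset hNT hh) h2 h3 h4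

theorem contract_contract (hL : L.IsSubgraph N) (hN : N.IsSubgraph M) (hM : M.IsTrivalent) :
    (M.contract L).contract (N.contract L) = M.contract N := by
  have hLM := hL.trans hN
  have hNT := hN.isFeynman.isTrivalent
  have hK := hL.contract_mono hN hM
  have hQT := hLM.isTrivalent_contract hM
  have hext := hLM.ext_contract hM
  have hverts : ((M.contract L).contract (N.contract L)).verts = (M.contract N).verts := by
    ext v
    constructor
    · rintro (⟨⟨hv, hvL⟩ | ⟨h, hh, rfl, h3, hne⟩, hvK⟩ | ⟨h, hh, rfl, h3, hne⟩)
      · exact Or.inl ⟨hv, fun hvN => hvK (Or.inl ⟨hvN, hvL⟩)⟩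
      · have hsub : L.legs h ⊆ N.ext_edges := by
          by_contra hne'
          exact hvK (Or.inr ⟨h, hh, rfl, h3, hne'⟩)
        exact Or.inr ⟨h, hL.halves_subset hh, (hL.legs_eq_of_legs_subset hNT hh hsub).symm, h3, hne⟩
      · have hsub : (N.contract L).legs h ⊆ (M.contract L).halves :=
          legs_subset_halves.trans hK.halves_subset
        refine Or.inr ⟨h, hL.contract_halves_subset hNT hh, hL.legs_contract hNT hh, h3,
          fun hM' => hne ?_⟩
        rw [hext]
        exact Set.subset_inter hsub hM'
    · have aux : ∀ v ∈ M.verts, v ∉ L.verts → ∀ h, v.Nonempty → v ≠ L.legs h := by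
        rintro v hv hvL h ⟨x, hx⟩ rfl
        exact hvL (hLM.mem_verts hM hx.2.1 hv hx)
      rintro (⟨hv, hvN⟩ | ⟨h, hh, rfl, h3, hne⟩)
      · have hvL : v ∉ L.verts := fun hvL => hvN (hL.verts_subset hvL)
        refine Or.inl ⟨Or.inl ⟨hv, hvL⟩, ?_⟩
        rintro (⟨hvN', -⟩ | ⟨h, -, hvh, -⟩)
        · exact hvN hvN'
        · exact aux v hv hvL h (hM.nonempty_of_vert hv) hvh
      · rcases hL.exists_mem_contract hN.isFeynman hh with ⟨r, hr, hrh⟩ | ⟨hhL, hsub⟩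
        · have hlr : N.legs h = (N.contract L).legs r := by
            rw [hL.legs_contract hNT hr, legs_eq hrh]
          refine Or.inr ⟨r, hr, hlr, h3, fun hs => hne (hs.trans ?_)⟩
          rw [hext]
          exact Set.inter_subset_right
        · have hlh := hL.legs_eq_of_legs_subset hNT hhL hsub
          rw [hlh] at h3 hne ⊢
          refine Or.inl ⟨Or.inr ⟨h, hhL, rfl, h3, hne⟩, ?_⟩
          rintro (⟨hvN, hvL⟩ | ⟨k, -, hk, -, hne'⟩)
          · exact aux _ (hN.verts_subset hvN) hvL h (hNT.nonempty_of_vert hvN) rfl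
          · exact hne' hsub
  refine HalfEdgeGraph.ext hverts ?_
  have hhalves : ((M.contract L).contract (N.contract L)).halves = (M.contract N).halves :=
    congrArg Set.sUnion hverts
  refine Set.Subset.antisymm ?_ fun e he => ?_
  · rintro e ⟨a, ha, b, hb, hab, hch, rfl⟩
    exact ⟨a, hhalves.le ha, b, hhalves.le hb, hab, hL.chain_contract hN hM hch, rfl⟩
  · obtain ⟨a, ha, b, hb, hab, hch, rfl⟩ := id he
    have haM := hN.not_ext_of_mem_edge hM ⟨_, he, Set.mem_insert a _⟩
    have ha' : a ∈ ((M.contract L).contract (N.contract L)).halves := hhalves ▸ ha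
    -- No chain has to be lifted to M/L: the partner of a in the iterated quotient is joined to a in
    -- M/N as well, hence equals b.
    obtain ⟨y, hy, hya, hay, -⟩ := hK.exists_partner hQT ha' (fun h => haM (hext ▸ h).2)
    have hyb : y ∈ ({a, b} : Set S) := hN.mem_edge_of_chain hM he (Set.mem_insert a _)
      (hhalves ▸ hy) (hL.chain_contract hN hM hay)
    obtain rfl : y = b := hyb.resolve_left hya
    exact ⟨a, ha', y, hy, hab, hay, rfl⟩

end IsSubgraph

/-- The subgraph between `L` and `M` with quotient `K` by `L`. -/
def lift (M L K : HalfEdgeGraph S) : HalfEdgeGraph S where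
  verts := L.verts ∪ {v | v ∈ M.verts ∧ v ∈ K.verts}
  -- Membership depends only on the chain through the edge, so a chain is included entirely or not
  -- at all.
  edges := L.edges ∪ {e | e ∈ freeEdges M L ∧ ∃ x ∈ e, ∃ a ∈ ⋃₀ K.edges, Chain M L x a}

section Lift

theorem mem_freeEdges_lift {e : Set S} : e ∈ freeEdges (lift M L K) L ↔
    e ∈ freeEdges M L ∧ ∃ x ∈ e, ∃ a ∈ ⋃₀ K.edges, Chain M L x a := by
  constructor
  · rintro ⟨he | he, heL⟩
    · exact (heL he).elim
    · exact he
  · exact fun he => ⟨Or.inr he, he.1.2⟩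

theorem free_lift_iff : x ∈ ⋃₀ freeEdges (lift M L K) L ↔
    x ∈ ⋃₀ freeEdges M L ∧ ∃ a ∈ ⋃₀ K.edges, Chain M L x a := by
  constructor
  · rintro ⟨e, he, hxe⟩
    obtain ⟨he, y, hy, a, ha, hya⟩ := mem_freeEdges_lift.1 he
    exact ⟨⟨e, he, hxe⟩, a, ha, (chain_of_freeEdges he hxe hy).trans hya⟩
  · rintro ⟨⟨e, he, hxe⟩, a, ha, hxa⟩
    exact ⟨e, mem_freeEdges_lift.2 ⟨he, x, hxe, a, ha, hxa⟩, hxe⟩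

variable (hL : L.IsSubgraph M) (hM : M.IsTrivalent) (hK : K.IsSubgraph (M.contract L))

include hL in
theorem lift_edges_subset : (lift M L K).edges ⊆ M.edges :=
  Set.union_subset hL.edges_subset fun _ he => he.1.1

include hL in
theorem lift_verts_subset : (lift M L K).verts ⊆ M.verts :=
  Set.union_subset hL.verts_subset fun _ hv => hv.1

theorem halves_subset_lift : L.halves ⊆ (lift M L K).halves :=
  Set.sUnion_subset_sUnion Set.subset_union_left

include hK in
theorem halves_subset_lift' : K.halves ⊆ (lift M L K).halves := by
  rintro x ⟨v, hv, hx⟩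
  rcases hK.verts_subset hv with ⟨hvM, -⟩ | ⟨h, -, rfl, -⟩
  · exact ⟨v, Or.inr ⟨hvM, hv⟩, hx⟩
  · exact halves_subset_lift hx.2.1

include hL hM hK

theorem free_lift_of_mem_edge (hx : x ∈ ⋃₀ K.edges) : x ∈ ⋃₀ freeEdges (lift M L K) L :=
  free_lift_iff.2 ⟨hL.free_of_mem_edge hM (Set.sUnion_subset_sUnion hK.edges_subset hx), x, hx,
    .refl⟩

theorem mem_edges_of_free_lift (hx : x ∈ ⋃₀ freeEdges (lift M L K) L)
    (hxQ : x ∈ (M.contract L).halves) : x ∈ ⋃₀ K.edges := by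
  obtain ⟨-, a, ⟨k, hk, hak⟩, hxa⟩ := free_lift_iff.1 hx
  exact ⟨k, hk, hL.mem_edge_of_chain hM (hK.edges_subset hk) hak hxQ hxa.symm⟩

theorem isTrivalent_lift : (lift M L K).IsTrivalent where
  finite_verts := hM.finite_verts.subset (lift_verts_subset hL)
  vert_card v hv := hM.vert_card v (lift_verts_subset hL hv)
  vert_disjoint := hM.vert_disjoint.subset (lift_verts_subset hL)
  edge_card e he := hM.edge_card e (lift_edges_subset hL he)
  edge_disjoint := hM.edge_disjoint.subset (lift_edges_subset hL)
  edge_subset := by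
    rintro e (he | he) x hx
    · exact halves_subset_lift (hL.isFeynman.edge_subset e he hx)
    · have hxF : x ∈ ⋃₀ freeEdges (lift M L K) L := ⟨e, mem_freeEdges_lift.2 he, hx⟩
      by_cases hxQ : x ∈ (M.contract L).halves
      · obtain ⟨k, hk, hxk⟩ := mem_edges_of_free_lift hL hM hK hxF hxQ
        exact halves_subset_lift' hK (hK.isFeynman.edge_subset k hk hxk)
      · by_contra hxN
        refine hxQ (hL.mem_contract_of_free hM ⟨e, he.1, hx⟩ fun hp => hxN ?_)
        exact halves_subset_lift (mem_legPairs_iff.1 hp).1.1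

omit hM hK in
-- The two legs of a pair are on the same chain, so the lift contains the edges at both or at
-- neither.
theorem isSubgraph_lift_left : L.IsSubgraph (lift M L K) where
  isFeynman := hL.isFeynman
  verts_subset := Set.subset_union_left
  edges_subset := Set.subset_union_left
  two_legs h hh h2 := by
    rcases hL.two_legs h hh h2 with hl | hl
    · exact Or.inl fun x hx => ext_edges_inter (lift_edges_subset hL)
        (halves_subset_lift hx.2.1) (hl hx)
    · by_contra! hcon
      obtain ⟨x, hx, hxN⟩ := Set.not_disjoint_iff.1 hcon.2
      obtain ⟨y, hy, hyN⟩ := Set.not_subset.1 hcon.1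
      have hyF : y ∈ ⋃₀ freeEdges (lift M L K) L :=
        free_of_not_ext (halves_subset_lift hy.2.1) hyN fun _ => ⟨hy.2.1, hy.2⟩
      obtain ⟨-, a, ha, hya⟩ := free_lift_iff.1 hyF
      refine not_ext_of_free (free_lift_iff.2 ⟨?_, a, ha, ?_⟩) hxN
      · exact hL.free_of_ext hx.2 (Set.disjoint_left.1 hl hx)
      · exact (chain_of_legs hh h2 hx hy).trans hya

/-- Surviving half-edges of the lift on its free edges are on edges of K, as a chain between
survivors is a single edge of M/L. -/
theorem contract_lift : (lift M L K).contract L = K := by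
  have hN := isTrivalent_lift hL hM hK
  have hLN := isSubgraph_lift_left (K := K) hL
  have hverts : ((lift M L K).contract L).verts = K.verts := by
    ext v
    constructor
    · rintro (⟨hv | hv, hvL⟩ | ⟨h, hh, rfl, h3, hne⟩)
      · exact (hvL hv).elim
      · exact hv.2
      · obtain ⟨x, hx, hxN⟩ := Set.not_subset.1 hne
        have hxF := hLN.free_of_ext hx.2 hxN
        have hvQ : L.legs h ∈ (M.contract L).verts := Or.inr ⟨h, hh, rfl, h3, fun hs =>
          not_ext_of_free (free_lift_iff.1 hxF).1 (hs hx)⟩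
        obtain ⟨k, hk, hxk⟩ := mem_edges_of_free_lift hL hM hK hxF ⟨_, hvQ, hx⟩
        obtain ⟨w, hw, hxw⟩ := hK.isFeynman.edge_subset k hk hxk
        rwa [(hL.isTrivalent_contract hM).vert_disjoint.eq_of_mem hvQ (hK.verts_subset hw) hx hxw]
    · intro hv
      rcases hK.verts_subset hv with ⟨hvM, hvL⟩ | ⟨h, hh, rfl, h3, hne⟩
      · exact Or.inl ⟨Or.inr ⟨hvM, hv⟩, hvL⟩
      · refine Or.inr ⟨h, hh, rfl, h3, fun hs => ?_⟩
        -- K has no isolated vertices, so some edge of K starts at this vertex; its chain keeps the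
        -- component of L from being a whole component of the lift.
        obtain ⟨x, hx, hxK⟩ := Set.not_subset.1 (hK.isFeynman.not_vert_subset_ext hv)
        have hxe : x ∈ ⋃₀ K.edges := by
          by_contra hxe
          exact hxK ⟨⟨_, hv, hx⟩, hxe⟩
        exact not_ext_of_free (free_lift_of_mem_edge hL hM hK hxe) (hs hx)
  have hhalves : ((lift M L K).contract L).halves = K.halves := congrArg Set.sUnion hverts
  refine HalfEdgeGraph.ext hverts (Set.Subset.antisymm (fun e he => ?_) fun k hk => ?_)
  · obtain ⟨a, ha, b, hb, hab, hch, rfl⟩ := id he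
    have hsub : ((lift M L K).contract L).halves ⊆ (M.contract L).halves :=
      hhalves ▸ hK.halves_subset
    obtain ⟨k, hk, hak⟩ := mem_edges_of_free_lift hL hM hK
      (hLN.free_of_mem_edge hN ⟨_, he, Set.mem_insert a _⟩) (hsub ha)
    have hbk := hL.mem_edge_of_chain hM (hK.edges_subset hk) hak (hsub hb)
      (Chain.mono (lift_edges_subset hL) hch)
    obtain ⟨c, d, -, rfl⟩ := Set.ncard_eq_two.1 (hK.isFeynman.edge_card k hk)
    have : ({a, b} : Set S) = {c, d} := by
      rcases hak with rfl | rfl <;> rcases hbk with rfl | rfl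
      · exact (hab rfl).elim
      · rfl
      · exact Set.pair_comm _ _
      · exact (hab rfl).elim
    rwa [this]
  · obtain ⟨a, -, b, -, hab, hch, rfl⟩ := hK.edges_subset hk
    have hsub := hK.isFeynman.edge_subset _ hk
    have haF := free_lift_of_mem_edge hL hM hK ⟨_, hk, Set.mem_insert a _⟩
    exact ⟨a, hhalves.ge (hsub (Set.mem_insert a _)), b, hhalves.ge (hsub (by simp)), hab,
      (Chain.of_free hLN hM (lift_edges_subset hL) haF hch).1, rfl⟩

/-- A component of the lift either survives in the quotient K or is entirely a component of L. This
reduces the conditions on legs of the lift to those on K and L. -/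
theorem exists_mem_of_lift (hh : h ∈ (lift M L K).halves) :
    (∃ r ∈ K.halves, (lift M L K).legs h = K.legs r) ∨
      (h ∈ L.halves ∧ (lift M L K).legs h = L.legs h) := by
  have hN := isTrivalent_lift hL hM hK
  have hLN := isSubgraph_lift_left (K := K) hL
  have hKN := contract_lift hL hM hK
  by_cases hr : ∃ r ∈ ((lift M L K).contract L).halves, r ∈ (lift M L K).comp h
  · obtain ⟨r, hr, hrh⟩ := hr
    have := hLN.legs_contract hN hr
    rw [hKN] at hr this
    exact Or.inl ⟨r, hr, by rw [this, legs_eq hrh]⟩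
  · push Not at hr
    have hhL : h ∈ L.halves := by
      by_contra hhL
      exact hr h (hLN.mem_contract_of_not_mem hN hh hhL) mem_comp_self
    refine Or.inr ⟨hhL, hLN.legs_eq_of_legs_subset hN hhL ?_⟩
    rcases hL.isFeynman.legs_card h hhL with h2 | h3
    · refine (hLN.two_legs h hhL h2).resolve_right fun hd => ?_
      obtain ⟨x, hx⟩ := hL.isFeynman.exists_leg hhL
      have hxF := hLN.free_of_ext hx.2 (Set.disjoint_left.1 hd hx)
      obtain ⟨-, a, ⟨k, hk, hak⟩, hxa⟩ := free_lift_iff.1 hxF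
      have := (Chain.of_free hLN hM (lift_edges_subset hL) hxF hxa).1
      refine hr a ?_ (mem_comp_trans (hLN.comp_subset_comp hx.1) (hLN.chain_subset_comp this))
      rw [hKN]
      exact hK.isFeynman.edge_subset k hk hak
    · by_contra hne
      obtain ⟨x, hx⟩ := hL.isFeynman.exists_leg hhL
      exact hr x (mem_contract_of_leg hhL h3 hne hx) (hLN.comp_subset_comp hx.1)

theorem isFeynman_lift : (lift M L K).IsFeynman := by
  have hN := isTrivalent_lift hL hM hK
  refine hN.isFeynman (fun h hh => ?_) fun v hv hve => ?_
  · rcases exists_mem_of_lift hL hM hK hh with ⟨r, hr, hl⟩ | ⟨hhL, hl⟩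
    · rw [hl]
      exact hK.isFeynman.legs_card r hr
    · rw [hl]
      exact hL.isFeynman.legs_card h hhL
  · rcases hv with hv | hv
    · exact hL.isFeynman.not_vert_subset_ext hv fun x hx =>
        ext_edges_inter Set.subset_union_left ⟨v, hv, hx⟩ (hve hx)
    · refine hK.isFeynman.not_vert_subset_ext hv.2 fun x hx => ⟨⟨v, hv.2, hx⟩, fun hxe => ?_⟩
      exact not_ext_of_free (free_lift_of_mem_edge hL hM hK hxe) (hve hx)

theorem isSubgraph_lift : (lift M L K).IsSubgraph M where
  isFeynman := isFeynman_lift hL hM hK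
  verts_subset := lift_verts_subset hL
  edges_subset := lift_edges_subset hL
  two_legs h hh h2 := by
    rcases exists_mem_of_lift hL hM hK hh with ⟨r, hr, hl⟩ | ⟨hhL, hl⟩
    · rw [hl] at h2 ⊢
      have h := hK.two_legs r hr h2
      rw [hL.ext_contract hM] at h
      refine h.imp (fun h => h.trans Set.inter_subset_right) fun h => ?_
      refine Set.disjoint_left.2 fun x hx hxM => Set.disjoint_left.1 h hx ⟨?_, hxM⟩
      exact hK.halves_subset hx.2.1
    · rw [hl] at h2 ⊢
      exact hL.two_legs h hhL h2

omit hL hK in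
-- For an edge of N outside L, `exists_end` continues its chain to a survivor, which is internal in
-- N/L. The alternative, a component removed entirely, contains no free edge.
theorem lift_contract (hL : L.IsSubgraph N) (hN : N.IsSubgraph M) :
    lift M L (N.contract L) = N := by
  have hNT := hN.isFeynman.isTrivalent
  have hLM := hL.trans hN
  refine HalfEdgeGraph.ext (Set.Subset.antisymm ?_ fun v hv => ?_)
    (Set.Subset.antisymm ?_ fun e he => ?_)
  · rintro v (hv | ⟨hvM, ⟨hv, -⟩ | ⟨h, hh, rfl, h3, -⟩⟩)
    · exact hL.verts_subset hv
    · exact hv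
    · obtain ⟨x, hx⟩ := hM.nonempty_of_vert hvM
      exact hL.verts_subset (hLM.mem_verts hM hx.2.1 hvM hx)
  · by_cases hvL : v ∈ L.verts
    · exact Or.inl hvL
    · exact Or.inr ⟨hN.verts_subset hv, Or.inl ⟨hv, hvL⟩⟩
  · rintro e (he | ⟨he, x, hx, a, ha, hxa⟩)
    · exact hL.edges_subset he
    · have haF := hL.free_of_mem_edge hNT ha
      obtain ⟨e', he', hx'⟩ := (Chain.of_free hL hM hN.edges_subset haF hxa.symm).2
      rw [hM.edge_disjoint.eq_of_mem he.1 (hN.edges_subset he'.1) hx hx']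
      exact he'.1
  · by_cases heL : e ∈ L.edges
    · exact Or.inl heL
    · obtain ⟨x, hx⟩ := hNT.nonempty_of_edge he
      have hxF : x ∈ ⋃₀ freeEdges N L := ⟨e, ⟨he, heL⟩, hx⟩
      refine Or.inr ⟨⟨hN.edges_subset he, heL⟩, x, hx, ?_⟩
      rcases hL.exists_mem_contract hN.isFeynman (hNT.edge_subset e he hx) with
        ⟨r, hr, hrx⟩ | ⟨hxL, hsub⟩
      · obtain ⟨z, hz, hxz⟩ := hL.exists_end hNT hxF hr hrx
        refine ⟨z, ?_, hxz.mono hN.edges_subset⟩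
        by_contra hze
        have : z ∈ (N.contract L).ext_edges := ⟨hz, hze⟩
        rw [hL.ext_contract hNT] at this
        exact not_ext_of_free (hL.chain_free hxF hxz) this.2
      · exact (not_ext_of_free hxF (hsub (mem_legs_self (hL.ext_of_free hNT hxF hxL)))).elim

end Lift

end HalfEdgeGraph

/-! ### Relabeling of graphs; the empty and the full subgraph -/

namespace HalfEdgeGraph

variable {S : Type u}

/-- The graph with half-edges relabeled by a permutation of the label set. -/
def map (σ : Equiv.Perm S) (G : HalfEdgeGraph S) : HalfEdgeGraph S :=
  ⟨(σ '' ·) '' G.verts, (σ '' ·) '' G.edges⟩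

section Map

variable (σ : Equiv.Perm S) {G M L : HalfEdgeGraph S}

@[simp]
theorem image_mem_verts_map {v : Set S} : σ '' v ∈ (G.map σ).verts ↔ v ∈ G.verts :=
  (Set.image_injective.2 σ.injective).mem_set_image

@[simp]
theorem image_mem_edges_map {e : Set S} : σ '' e ∈ (G.map σ).edges ↔ e ∈ G.edges :=
  (Set.image_injective.2 σ.injective).mem_set_image

theorem map_symm_map (G : HalfEdgeGraph S) : (G.map σ).map σ.symm = G := by
  have : ∀ X : Set (Set S), (σ.symm '' ·) '' ((σ '' ·) '' X) = X := fun X => by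
    rw [Set.image_image]
    simp
  exact HalfEdgeGraph.ext (this _) (this _)

theorem halves_map : (G.map σ).halves = σ '' G.halves := by
  rw [halves, halves, Set.image_sUnion]
  rfl

theorem ext_edges_map : (G.map σ).ext_edges = σ '' G.ext_edges := by
  rw [ext_edges, ext_edges, Set.image_sdiff σ.injective, halves_map, Set.image_sUnion]
  rfl

theorem comp_map (h : S) : (G.map σ).comp (σ h) = σ '' G.comp h := by
  -- One inclusion for all permutations suffices: the inverse permutation gives the other.
  have key : ∀ (τ : Equiv.Perm S) (K : HalfEdgeGraph S) (k : S),
      τ '' K.comp k ⊆ (K.map τ).comp (τ k) := by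
    rintro τ K k _ ⟨a, ha, rfl⟩
    refine Relation.ReflTransGen.lift τ ?_ _ _ ha
    rintro b c ⟨x, hx, hb, hc⟩
    exact ⟨τ '' x, hx.imp (image_mem_verts_map τ).2 (image_mem_edges_map τ).2,
      Set.mem_image_of_mem _ hb, Set.mem_image_of_mem _ hc⟩
  refine (Set.Subset.antisymm (fun a ha => ?_) (key σ G h))
  have := key σ.symm (G.map σ) (σ h) (Set.mem_image_of_mem _ ha)
  rw [map_symm_map, σ.symm_apply_apply] at this
  exact ⟨_, this, σ.apply_symm_apply a⟩

theorem legs_map (h : S) : (G.map σ).legs (σ h) = σ '' G.legs h := by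
  rw [legs, legs, comp_map, ext_edges_map, Set.image_inter σ.injective]

theorem IsTrivalent.map (hG : G.IsTrivalent) : (G.map σ).IsTrivalent where
  finite_verts := hG.finite_verts.image _
  vert_card := by
    rintro _ ⟨v, hv, rfl⟩
    rw [σ.injective.injOn.ncard_image, hG.vert_card v hv]
  vert_disjoint := by
    rintro _ ⟨v, hv, rfl⟩ _ ⟨w, hw, rfl⟩ hne
    exact (Set.disjoint_image_iff σ.injective).2 (hG.vert_disjoint hv hw fun h => hne (by rw [h]))
  edge_card := by
    rintro _ ⟨v, hv, rfl⟩
    rw [σ.injective.injOn.ncard_image, hG.edge_card v hv]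
  edge_disjoint := by
    rintro _ ⟨v, hv, rfl⟩ _ ⟨w, hw, rfl⟩ hne
    exact (Set.disjoint_image_iff σ.injective).2 (hG.edge_disjoint hv hw fun h => hne (by rw [h]))
  edge_subset := by
    rintro _ ⟨e, he, rfl⟩
    rw [halves_map]
    exact Set.image_mono (hG.edge_subset e he)

theorem IsFeynman.map (hG : G.IsFeynman) : (G.map σ).IsFeynman := by
  refine (hG.isTrivalent.map σ).isFeynman ?_ ?_
  · rw [halves_map]
    rintro _ ⟨h, hh, rfl⟩
    rw [legs_map, σ.injective.injOn.ncard_image]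
    exact hG.legs_card h hh
  · rintro _ ⟨v, hv, rfl⟩
    rw [ext_edges_map, Set.image_subset_image_iff σ.injective]
    exact hG.not_vert_subset_ext hv

theorem IsSubgraph.map (hL : L.IsSubgraph M) : (L.map σ).IsSubgraph (M.map σ) where
  isFeynman := hL.isFeynman.map σ
  verts_subset := Set.image_mono hL.verts_subset
  edges_subset := Set.image_mono hL.edges_subset
  two_legs := by
    rw [halves_map]
    rintro _ ⟨h, hh, rfl⟩
    rw [legs_map, σ.injective.injOn.ncard_image, ext_edges_map,
      Set.image_subset_image_iff σ.injective, Set.disjoint_image_iff σ.injective]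
    exact hL.two_legs h hh

theorem Linked.map {a b : S} (h : Linked M L a b) :
    Linked (M.map σ) (L.map σ) (σ a) (σ b) := by
  rcases h with ⟨e, h1, h2, h3, h4⟩ | ⟨h, hh, h2, h3, h4⟩
  · exact Or.inl ⟨σ '' e, (image_mem_edges_map σ).2 h1, fun h => h2 ((image_mem_edges_map σ).1 h),
      Set.mem_image_of_mem _ h3, Set.mem_image_of_mem _ h4⟩
  · refine Or.inr ⟨σ h, by rw [halves_map]; exact Set.mem_image_of_mem _ hh, ?_⟩
    rw [legs_map, σ.injective.injOn.ncard_image]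
    exact ⟨h2, Set.mem_image_of_mem _ h3, Set.mem_image_of_mem _ h4⟩

theorem contract_map : (M.map σ).contract (L.map σ) = (M.contract L).map σ := by
  have key : ∀ (τ : Equiv.Perm S) (G K : HalfEdgeGraph S),
      ((G.contract K).map τ).verts ⊆ ((G.map τ).contract (K.map τ)).verts ∧
      ((G.contract K).map τ).edges ⊆ ((G.map τ).contract (K.map τ)).edges := by
    intro τ G K
    have hv : ((G.contract K).map τ).verts ⊆ ((G.map τ).contract (K.map τ)).verts := by
      rintro _ ⟨v, ⟨hv, hv'⟩ | ⟨h, hh, rfl, h3, hne⟩, rfl⟩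
      · exact Or.inl ⟨(image_mem_verts_map τ).2 hv, fun h => hv' ((image_mem_verts_map τ).1 h)⟩
      · refine Or.inr ⟨τ h, by rw [halves_map]; exact Set.mem_image_of_mem _ hh,
          (legs_map τ h).symm, ?_, ?_⟩
        · rw [τ.injective.injOn.ncard_image, h3]
        · rwa [ext_edges_map, Set.image_subset_image_iff τ.injective]
    have hh : τ '' (G.contract K).halves ⊆ ((G.map τ).contract (K.map τ)).halves := by
      rw [← halves_map]
      exact Set.sUnion_subset_sUnion hv
    refine ⟨hv, ?_⟩
    rintro _ ⟨_, ⟨a, ha, b, hb, hab, hch, rfl⟩, rfl⟩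
    exact ⟨τ a, hh (Set.mem_image_of_mem _ ha), τ b, hh (Set.mem_image_of_mem _ hb),
      τ.injective.ne hab, Relation.ReflTransGen.lift τ (fun _ _ => Linked.map τ) _ _ hch,
      Set.image_pair _ _ _⟩
  have h1 := key σ M L
  have h2 := key σ.symm (M.map σ) (L.map σ)
  rw [map_symm_map, map_symm_map] at h2
  have h3 : ∀ X Y : Set (Set S), (σ.symm '' ·) '' X ⊆ Y → X ⊆ (σ '' ·) '' Y :=
    fun X Y h v hv => ⟨_, h (Set.mem_image_of_mem _ hv), by simp⟩
  exact HalfEdgeGraph.ext ((h3 _ _ h2.1).antisymm h1.1) ((h3 _ _ h2.2).antisymm h1.2)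

theorem isomorphic_map (G : HalfEdgeGraph S) : Isomorphic G (G.map σ) :=
  ⟨σ, by rw [halves_map]; exact σ.injective.injOn.bijOn_image, rfl, rfl⟩

variable {σ}

theorem Isomorphic.exists_perm {K : HalfEdgeGraph S} (hG : G.IsTrivalent)
    (h : Isomorphic G K) : ∃ σ, K = G.map σ := by
  obtain ⟨f, hf, hv, he⟩ := h
  obtain ⟨σ, hσ⟩ := hG.finite_halves.exists_perm_eqOn hf.injOn
  refine ⟨σ, HalfEdgeGraph.ext ?_ ?_⟩
  · rw [← hv]
    exact Set.image_congr fun v hv => (hσ.mono (Set.subset_sUnion_of_mem hv)).image_eq.symm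
  · rw [← he]
    exact Set.image_congr fun e he => (hσ.mono (hG.edge_subset e he)).image_eq.symm

end Map

theorem Isomorphic.ncard_verts_eq {G K : HalfEdgeGraph S} (hG : G.IsTrivalent)
    (h : Isomorphic G K) : G.verts.ncard = K.verts.ncard := by
  obtain ⟨σ, rfl⟩ := h.exists_perm hG
  exact ((Set.image_injective.2 σ.injective).injOn.ncard_image).symm

theorem finite_setOf_halves_subset {T : Set S} (hT : T.Finite) :
    {G : {G : HalfEdgeGraph S // G.IsFeynman} | G.1.halves ⊆ T}.Finite := by
  refine Set.Finite.of_finite_image (f := fun G => (G.1.verts, G.1.edges))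
    ((hT.finite_subsets.finite_subsets.prod hT.finite_subsets.finite_subsets).subset ?_) ?_
  · rintro _ ⟨G, hG, rfl⟩
    exact ⟨fun v hv => (Set.subset_sUnion_of_mem hv).trans hG,
      fun e he => (G.2.edge_subset e he).trans hG⟩
  · rintro G - K - h
    simp only [Prod.mk.injEq] at h
    exact Subtype.ext (HalfEdgeGraph.ext h.1 h.2)

theorem IsTrivalent.eq_empty_iff {G : HalfEdgeGraph S} (hG : G.IsTrivalent) :
    G = empty S ↔ G.verts = ∅ := by
  refine ⟨fun h => by rw [h]; rfl, fun h => HalfEdgeGraph.ext h ?_⟩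
  refine Set.eq_empty_of_forall_notMem fun e he => ?_
  obtain ⟨x, hx⟩ := hG.nonempty_of_edge he
  obtain ⟨v, hv, -⟩ := hG.edge_subset e he hx
  rw [h] at hv
  exact hv

theorem isomorphic_empty_iff {G : HalfEdgeGraph S} (hG : G.IsTrivalent) :
    Isomorphic G (empty S) ↔ G = empty S := by
  constructor
  · rintro ⟨f, -, hv, -⟩
    exact hG.eq_empty_iff.2 (Set.image_eq_empty.1 hv)
  · rintro rfl
    exact (isoSetoid S).refl ⟨_, isFeynman_empty S⟩

theorem isSubgraph_empty (M : HalfEdgeGraph S) : (empty S).IsSubgraph M where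
  isFeynman := isFeynman_empty S
  verts_subset := Set.empty_subset _
  edges_subset := Set.empty_subset _
  two_legs _ := fun ⟨_, hv, _⟩ => hv.elim

theorem contract_empty {M : HalfEdgeGraph S} (hM : M.IsTrivalent) : M.contract (empty S) = M := by
  have hv : (M.contract (empty S)).verts = M.verts := by
    refine Set.Subset.antisymm ?_ fun v hv => Or.inl ⟨hv, fun h => h⟩
    rintro v (⟨hv, -⟩ | ⟨h, ⟨_, hv, _⟩, _⟩)
    · exact hv
    · exact hv.elim
  have hQ := (isSubgraph_empty M).isTrivalent_contract hM
  have hh : (M.contract (empty S)).halves = M.halves := congrArg Set.sUnion hv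
  have hsub : M.edges ⊆ (M.contract (empty S)).edges := by
    intro e he
    obtain ⟨a, b, hab, rfl⟩ := Set.ncard_eq_two.1 (hM.edge_card e he)
    have := hM.edge_subset _ he
    exact ⟨a, hh.ge (this (by simp)), b, hh.ge (this (by simp)), hab,
      .single (Or.inl ⟨_, he, fun h => h, by simp, by simp⟩), rfl⟩
  refine HalfEdgeGraph.ext hv (Set.Subset.antisymm (fun e he => ?_) hsub)
  obtain ⟨x, hx⟩ := hQ.nonempty_of_edge he
  obtain ⟨e', he', hx'⟩ := (isSubgraph_empty M).free_of_mem_edge hM ⟨e, he, hx⟩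
  rw [hQ.edge_disjoint.eq_of_mem he (hsub he'.1) hx hx']
  exact he'.1

theorem contract_self_verts (M : HalfEdgeGraph S) : (M.contract M).verts = ∅ := by
  refine Set.eq_empty_of_forall_notMem ?_
  rintro v (⟨hv, hv'⟩ | ⟨h, -, rfl, -, hne⟩)
  · exact hv' hv
  · exact hne legs_subset_ext

/-- With nothing surviving, `exists_mem_contract` makes every component of M a whole component of L,
so no edge of M is free. -/
theorem IsSubgraph.eq_of_contract_verts {M L : HalfEdgeGraph S} (hL : L.IsSubgraph M)
    (hM : M.IsFeynman) (h : (M.contract L).verts = ∅) : L = M := by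
  have hv : M.verts ⊆ L.verts := fun v hv => by
    by_contra hvL
    have : v ∈ (M.contract L).verts := Or.inl ⟨hv, hvL⟩
    rw [h] at this
    exact this
  refine HalfEdgeGraph.ext (hL.verts_subset.antisymm hv)
    (hL.edges_subset.antisymm fun e he => ?_)
  by_contra heL
  obtain ⟨x, hx⟩ := hM.isTrivalent.nonempty_of_edge he
  have hxF : x ∈ ⋃₀ freeEdges M L := ⟨e, ⟨he, heL⟩, hx⟩
  rcases hL.exists_mem_contract hM (hM.edge_subset e he hx) with ⟨r, ⟨v, hv, -⟩, -⟩ | ⟨hxL, hsub⟩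
  · rw [h] at hv
    exact hv
  · exact not_ext_of_free hxF (hsub (mem_legs_self (hL.ext_of_free hM.isTrivalent hxF hxL)))

end HalfEdgeGraph

/-! ### Disjoint unions of graphs -/

namespace HalfEdgeGraph

variable {S : Type u}

/-- The union of two graphs. -/
def union (A B : HalfEdgeGraph S) : HalfEdgeGraph S := ⟨A.verts ∪ B.verts, A.edges ∪ B.edges⟩

/-- The part of a graph that lies in another graph. -/
def inter (G A : HalfEdgeGraph S) : HalfEdgeGraph S := ⟨G.verts ∩ A.verts, G.edges ∩ A.edges⟩

section Union

variable {A B M N : HalfEdgeGraph S} {h : S}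

theorem union_comm (A B : HalfEdgeGraph S) : A.union B = B.union A :=
  HalfEdgeGraph.ext (Set.union_comm _ _) (Set.union_comm _ _)

theorem halves_union (A B : HalfEdgeGraph S) : (A.union B).halves = A.halves ∪ B.halves :=
  Set.sUnion_union _ _

variable (hA : A.IsTrivalent) (hB : B.IsTrivalent) (hAB : Disjoint A.halves B.halves)

include hB hAB in
theorem mem_edges_of_mem_union {e : Set S} (he : e ∈ (A.union B).edges) {a : S} (ha : a ∈ e)
    (haA : a ∈ A.halves) : e ∈ A.edges :=
  he.resolve_right fun he => Set.disjoint_left.1 hAB haA (hB.edge_subset e he ha)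

include hAB in
theorem mem_verts_of_mem_union {v : Set S} (hv : v ∈ (A.union B).verts) {a : S} (ha : a ∈ v)
    (haA : a ∈ A.halves) : v ∈ A.verts :=
  hv.resolve_right fun hv => Set.disjoint_left.1 hAB haA ⟨v, hv, ha⟩

include hB hAB in
theorem ext_edges_union_iff (hh : h ∈ A.halves) : h ∈ (A.union B).ext_edges ↔ h ∈ A.ext_edges := by
  constructor
  · exact fun hx => ⟨hh, fun ⟨e, he, hxe⟩ => hx.2 ⟨e, Or.inl he, hxe⟩⟩
  · refine fun hx => ⟨?_, fun ⟨e, he, hxe⟩ =>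
      hx.2 ⟨e, mem_edges_of_mem_union hB hAB he hxe hh, hxe⟩⟩
    rw [halves_union]
    exact Or.inl hh

include hA hB hAB

theorem comp_union (hh : h ∈ A.halves) : (A.union B).comp h = A.comp h := by
  refine comp_eq_of_subset Set.subset_union_left Set.subset_union_left fun x hx a ha hah => ?_
  have haA := hA.comp_subset_halves hh hah
  exact hx.imp (fun hx => mem_verts_of_mem_union hAB hx ha haA)
    fun hx => mem_edges_of_mem_union hB hAB hx ha haA

theorem legs_union (hh : h ∈ A.halves) : (A.union B).legs h = A.legs h := by
  rw [legs, legs, comp_union hA hB hAB hh]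
  ext x
  exact and_congr_right fun hx => ext_edges_union_iff hB hAB (hA.comp_subset_halves hh hx)

theorem IsTrivalent.union : (A.union B).IsTrivalent where
  finite_verts := hA.finite_verts.union hB.finite_verts
  vert_card v hv := hv.elim (hA.vert_card v) (hB.vert_card v)
  vert_disjoint := by
    rintro v (hv | hv) w (hw | hw) hne
    · exact hA.vert_disjoint hv hw hne
    · exact hAB.mono (Set.subset_sUnion_of_mem hv) (Set.subset_sUnion_of_mem hw)
    · exact (hAB.mono (Set.subset_sUnion_of_mem hw) (Set.subset_sUnion_of_mem hv)).symm
    · exact hB.vert_disjoint hv hw hne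
  edge_card v hv := hv.elim (hA.edge_card v) (hB.edge_card v)
  edge_disjoint := by
    rintro v (hv | hv) w (hw | hw) hne
    · exact hA.edge_disjoint hv hw hne
    · exact hAB.mono (hA.edge_subset v hv) (hB.edge_subset w hw)
    · exact (hAB.mono (hA.edge_subset w hw) (hB.edge_subset v hv)).symm
    · exact hB.edge_disjoint hv hw hne
  edge_subset e he := by
    rw [halves_union]
    exact he.elim (fun h => (hA.edge_subset e h).trans Set.subset_union_left)
      fun h => (hB.edge_subset e h).trans Set.subset_union_right

theorem isFeynman_of_union (h : (A.union B).IsFeynman) : A.IsFeynman := by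
  have hsub : A.halves ⊆ (A.union B).halves := Set.sUnion_subset_sUnion Set.subset_union_left
  refine hA.isFeynman (fun x hx => ?_) fun v hv hve => ?_
  · rw [← legs_union hA hB hAB hx]
    exact h.legs_card x (hsub hx)
  · exact h.not_vert_subset_ext (Or.inl hv) fun x hx =>
      (ext_edges_union_iff hB hAB ⟨v, hv, hx⟩).2 (hve hx)

omit hA hB in
theorem IsFeynman.union (hA : A.IsFeynman) (hB : B.IsFeynman) : (A.union B).IsFeynman := by
  have hAT := hA.isTrivalent
  have hBT := hB.isTrivalent
  refine (hAT.union hBT hAB).isFeynman (fun x hx => ?_) ?_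
  · rw [halves_union] at hx
    rcases hx with hx | hx
    · rw [legs_union hAT hBT hAB hx]
      exact hA.legs_card x hx
    · rw [union_comm, legs_union hBT hAT hAB.symm hx]
      exact hB.legs_card x hx
  · rintro v (hv | hv) hve
    · exact hA.not_vert_subset_ext hv fun x hx =>
        (ext_edges_union_iff hBT hAB ⟨v, hv, hx⟩).1 (hve hx)
    · rw [union_comm] at hve
      exact hB.not_vert_subset_ext hv fun x hx =>
        (ext_edges_union_iff hAT hAB.symm ⟨v, hv, hx⟩).1 (hve hx)

omit hA hB hAB

variable (hM : M.IsTrivalent) (hN : N.IsTrivalent) (hMN : Disjoint M.halves N.halves)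

include hM hN hMN

theorem IsSubgraph.union (hA : A.IsSubgraph M) (hB : B.IsSubgraph N) :
    (A.union B).IsSubgraph (M.union N) := by
  have hAB : Disjoint A.halves B.halves := hMN.mono hA.halves_subset hB.halves_subset
  have hAT := hA.isFeynman.isTrivalent
  have hBT := hB.isFeynman.isTrivalent
  -- Quantified over all four graphs, so that exchanging the two summands gives the other half.
  have aux : ∀ {A B M N : HalfEdgeGraph S}, N.IsTrivalent →
      Disjoint M.halves N.halves → A.IsSubgraph M → B.IsSubgraph N → ∀ h ∈ A.halves,
      ((A.union B).legs h).ncard = 2 → (A.union B).legs h ⊆ (M.union N).ext_edges ∨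
        Disjoint ((A.union B).legs h) (M.union N).ext_edges := by
    intro A B M N hN hMN hA hB h hh
    have hAB : Disjoint A.halves B.halves := hMN.mono hA.halves_subset hB.halves_subset
    rw [legs_union hA.isFeynman.isTrivalent hB.isFeynman.isTrivalent hAB hh]
    have hiff : ∀ x ∈ A.legs h, x ∈ (M.union N).ext_edges ↔ x ∈ M.ext_edges := fun x hx =>
      ext_edges_union_iff hN hMN (hA.halves_subset hx.2.1)
    refine fun h2 => (hA.two_legs h hh h2).imp (fun h3 x hx => (hiff x hx).2 (h3 hx)) fun h3 => ?_
    exact Set.disjoint_left.2 fun x hx hx' => Set.disjoint_left.1 h3 hx ((hiff x hx).1 hx')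
  refine ⟨hA.isFeynman.union hAB hB.isFeynman,
    Set.union_subset_union hA.verts_subset hB.verts_subset,
    Set.union_subset_union hA.edges_subset hB.edges_subset, fun h hh => ?_⟩
  rw [halves_union] at hh
  rcases hh with hh | hh
  · exact aux hN hMN hA hB h hh
  · rw [union_comm A, union_comm M]
    exact aux hM hMN.symm hB hA h hh

omit hM in
theorem isSubgraph_of_union (hAT : A.IsTrivalent) (hBT : B.IsTrivalent) (hv : A.verts ⊆ M.verts)
    (he : A.edges ⊆ M.edges) (hv' : B.verts ⊆ N.verts)
    (h : (A.union B).IsSubgraph (M.union N)) : A.IsSubgraph M := by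
  have hAM : A.halves ⊆ M.halves := Set.sUnion_subset_sUnion hv
  have hAB : Disjoint A.halves B.halves := hMN.mono hAM (Set.sUnion_subset_sUnion hv')
  refine ⟨isFeynman_of_union hAT hBT hAB h.isFeynman, hv, he, fun x hx h2 => ?_⟩
  have hiff : ∀ y ∈ A.legs x, y ∈ (M.union N).ext_edges ↔ y ∈ M.ext_edges := fun y hy =>
    ext_edges_union_iff hN hMN (hAM hy.2.1)
  have := h.two_legs x (by rw [halves_union]; exact Or.inl hx)
  rw [legs_union hAT hBT hAB hx] at this
  refine (this h2).imp (fun h3 y hy => (hiff y hy).1 (h3 hy)) fun h3 => ?_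
  exact Set.disjoint_left.2 fun y hy hy' => Set.disjoint_left.1 h3 hy ((hiff y hy).2 hy')

omit hM in
-- An edge or leg pair through a half-edge of M lies entirely in M, so links do not cross between
-- the summands.
theorem linked_union_iff (hA : A.IsSubgraph M) (hB : B.IsSubgraph N) {a b : S}
    (ha : a ∈ M.halves) : Linked (M.union N) (A.union B) a b ↔ Linked M A a b := by
  have hAB : Disjoint A.halves B.halves := hMN.mono hA.halves_subset hB.halves_subset
  have hAT := hA.isFeynman.isTrivalent
  have hBT := hB.isFeynman.isTrivalent
  constructor
  · rintro (⟨e, h1, h2, h3, h4⟩ | ⟨h, hh, h2, h3, h4⟩)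
    · exact Or.inl ⟨e, mem_edges_of_mem_union hN hMN h1 h3 ha, fun h => h2 (Or.inl h), h3, h4⟩
    · rw [halves_union] at hh
      have hh : h ∈ A.halves := hh.resolve_right fun hh => by
        rw [union_comm, legs_union hBT hAT hAB.symm hh] at h3
        exact Set.disjoint_left.1 hMN ha (hB.halves_subset h3.2.1)
      rw [legs_union hAT hBT hAB hh] at h2 h3 h4
      exact Or.inr ⟨h, hh, h2, h3, h4⟩
  · rintro (⟨e, h1, h2, h3, h4⟩ | ⟨h, hh, h2, h3, h4⟩)
    · refine Or.inl ⟨e, Or.inl h1, ?_, h3, h4⟩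
      rintro (h | h)
      · exact h2 h
      · exact Set.disjoint_left.1 hMN ha (hN.edge_subset e (hB.edges_subset h) h3)
    · refine Or.inr ⟨h, by rw [halves_union]; exact Or.inl hh, ?_⟩
      rw [legs_union hAT hBT hAB hh]
      exact ⟨h2, h3, h4⟩

theorem chain_union_iff (hA : A.IsSubgraph M) (hB : B.IsSubgraph N) {a b : S}
    (ha : a ∈ M.halves) : Chain (M.union N) (A.union B) a b ↔ Chain M A a b := by
  have hmem : ∀ c, Chain M A a c → c ∈ M.halves := fun c hc =>
    hM.comp_subset_halves ha (hA.chain_subset_comp hc)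
  constructor
  · intro hab
    induction hab with
    | refl => exact .refl
    | tail _ h ih => exact ih.tail ((linked_union_iff hN hMN hA hB (hmem _ ih)).1 h)
  · intro hab
    induction hab with
    | refl => exact .refl
    | tail h' h ih => exact ih.tail ((linked_union_iff hN hMN hA hB (hmem _ h')).2 h)

theorem contract_union (hA : A.IsSubgraph M) (hB : B.IsSubgraph N) :
    (M.union N).contract (A.union B) = (M.contract A).union (N.contract B) := by
  have hverts : ∀ {A B M N : HalfEdgeGraph S}, M.IsTrivalent → N.IsTrivalent →
      Disjoint M.halves N.halves → A.IsSubgraph M → B.IsSubgraph N → ∀ v,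
      v ⊆ M.halves → v.Nonempty →
      (v ∈ ((M.union N).contract (A.union B)).verts ↔ v ∈ (M.contract A).verts) := by
    intro A B M N hM hN hMN hA hB v hvM ⟨x, hx⟩
    have hAB : Disjoint A.halves B.halves := hMN.mono hA.halves_subset hB.halves_subset
    have hAT := hA.isFeynman.isTrivalent
    have hBT := hB.isFeynman.isTrivalent
    have hiff : v ⊆ (M.union N).ext_edges ↔ v ⊆ M.ext_edges :=
      forall₂_congr fun y hy => ext_edges_union_iff hN hMN (hvM hy)
    constructor
    · rintro (⟨h1, h2⟩ | ⟨h, hh, hvh, h3, hne⟩)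
      · exact Or.inl ⟨mem_verts_of_mem_union hMN h1 hx (hvM hx), fun h => h2 (Or.inl h)⟩
      · rw [halves_union] at hh
        have hh : h ∈ A.halves := hh.resolve_right fun hh => by
          rw [union_comm, legs_union hBT hAT hAB.symm hh] at hvh
          rw [hvh] at hx
          exact Set.disjoint_left.1 hMN (hvM (hvh ▸ hx)) (hB.halves_subset hx.2.1)
        rw [legs_union hAT hBT hAB hh] at hvh
        exact Or.inr ⟨h, hh, hvh, h3, fun h => hne (hiff.2 h)⟩
    · rintro (⟨h1, h2⟩ | ⟨h, hh, hvh, h3, hne⟩)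
      · refine Or.inl ⟨Or.inl h1, ?_⟩
        rintro (h | h)
        · exact h2 h
        · exact Set.disjoint_left.1 hMN (hvM hx) ⟨v, hB.verts_subset h, hx⟩
      · refine Or.inr ⟨h, by rw [halves_union]; exact Or.inl hh, ?_, h3, fun h => hne (hiff.1 h)⟩
        rw [legs_union hAT hBT hAB hh, hvh]
  have hS := hA.union hM hN hMN hB
  have hT := hM.union hN hMN
  have hQ := hS.isTrivalent_contract hT
  have hQM := hA.isTrivalent_contract hM
  have hQN := hB.isTrivalent_contract hN
  have hv : ((M.union N).contract (A.union B)).verts =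
      ((M.contract A).union (N.contract B)).verts := by
    ext v
    constructor
    · intro hv
      have hsub : v ⊆ M.halves ∨ v ⊆ N.halves := by
        rcases hv with ⟨hv | hv, -⟩ | ⟨h, hh, rfl, -⟩
        · exact Or.inl (Set.subset_sUnion_of_mem hv)
        · exact Or.inr (Set.subset_sUnion_of_mem hv)
        · have hAB := hMN.mono hA.halves_subset hB.halves_subset
          have hAT := hA.isFeynman.isTrivalent
          have hBT := hB.isFeynman.isTrivalent
          rw [halves_union] at hh
          rcases hh with hh | hh
          · rw [legs_union hAT hBT hAB hh]
            exact Or.inl (legs_subset_halves.trans hA.halves_subset)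
          · rw [union_comm, legs_union hBT hAT hAB.symm hh]
            exact Or.inr (legs_subset_halves.trans hB.halves_subset)
      rcases hsub with hsub | hsub
      · exact Or.inl ((hverts hM hN hMN hA hB v hsub (hQ.nonempty_of_vert hv)).1 hv)
      · have hne := hQ.nonempty_of_vert hv
        rw [union_comm M, union_comm A] at hv
        exact Or.inr ((hverts hN hM hMN.symm hB hA v hsub hne).1 hv)
    · rintro (hv | hv)
      · refine (hverts hM hN hMN hA hB v ?_ (hQM.nonempty_of_vert hv)).2 hv
        exact (Set.subset_sUnion_of_mem hv).trans (hA.contract_halves_subset hM)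
      · rw [union_comm M, union_comm A]
        refine (hverts hN hM hMN.symm hB hA v ?_ (hQN.nonempty_of_vert hv)).2 hv
        exact (Set.subset_sUnion_of_mem hv).trans (hB.contract_halves_subset hN)
  have hh : ((M.union N).contract (A.union B)).halves =
      (M.contract A).halves ∪ (N.contract B).halves := by
    rw [← halves_union]
    exact congrArg Set.sUnion hv
  have hedges : ∀ {A B M N : HalfEdgeGraph S}, M.IsTrivalent → N.IsTrivalent →
      Disjoint M.halves N.halves → A.IsSubgraph M → B.IsSubgraph N →
      ∀ a ∈ (M.contract A).halves, ∀ b ∈ (M.contract A).halves ∪ (N.contract B).halves,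
      Chain (M.union N) (A.union B) a b → b ∈ (M.contract A).halves ∧ Chain M A a b := by
    intro A B M N hM hN hMN hA hB a ha b hb hab
    have haM := hA.contract_halves_subset hM ha
    have hab' := (chain_union_iff hM hN hMN hA hB haM).1 hab
    refine ⟨hb.resolve_right fun hb => ?_, hab'⟩
    exact Set.disjoint_left.1 hMN (hM.comp_subset_halves haM (hA.chain_subset_comp hab'))
      (hB.contract_halves_subset hN hb)
  refine HalfEdgeGraph.ext hv (Set.Subset.antisymm ?_ ?_)
  · rintro e ⟨a, ha, b, hb, hab, hch, rfl⟩
    replace ha := hh.le ha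
    replace hb := hh.le hb
    rcases ha with ha | ha
    · obtain ⟨hb, hch⟩ := hedges hM hN hMN hA hB a ha b hb hch
      exact Or.inl ⟨a, ha, b, hb, hab, hch, rfl⟩
    · rw [union_comm M, union_comm A] at hch
      obtain ⟨hb, hch⟩ := hedges hN hM hMN.symm hB hA a ha b hb.symm hch
      exact Or.inr ⟨a, ha, b, hb, hab, hch, rfl⟩
  · rintro e (⟨a, ha, b, hb, hab, hch, rfl⟩ | ⟨a, ha, b, hb, hab, hch, rfl⟩)
    · exact ⟨a, hh.ge (Or.inl ha), b, hh.ge (Or.inl hb), hab,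
        (chain_union_iff hM hN hMN hA hB (hA.contract_halves_subset hM ha)).2 hch, rfl⟩
    · refine ⟨a, hh.ge (Or.inr ha), b, hh.ge (Or.inr hb), hab, ?_, rfl⟩
      rw [union_comm M, union_comm A]
      exact (chain_union_iff hN hM hMN.symm hB hA (hB.contract_halves_subset hN ha)).2 hch

omit hN in
theorem isTrivalent_inter {L : HalfEdgeGraph S} (hL : L.IsSubgraph (M.union N)) :
    (L.inter M).IsTrivalent where
  finite_verts := hM.finite_verts.subset Set.inter_subset_right
  vert_card v hv := hM.vert_card v hv.2
  vert_disjoint := hM.vert_disjoint.subset Set.inter_subset_right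
  edge_card e he := hM.edge_card e he.2
  edge_disjoint := hM.edge_disjoint.subset Set.inter_subset_right
  edge_subset e he x hx := by
    obtain ⟨v, hv, hxv⟩ := hL.isFeynman.edge_subset e he.1 hx
    exact ⟨v, ⟨hv, mem_verts_of_mem_union hMN (hL.verts_subset hv) hxv
      (hM.edge_subset e he.2 hx)⟩, hxv⟩

omit hM hN hMN in
theorem inter_union_inter {L : HalfEdgeGraph S} (hL : L.IsSubgraph (M.union N)) :
    (L.inter M).union (L.inter N) = L := by
  refine HalfEdgeGraph.ext ?_ ?_
  · change L.verts ∩ M.verts ∪ L.verts ∩ N.verts = L.verts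
    rw [← Set.inter_union_distrib_left]
    exact Set.inter_eq_left.2 hL.verts_subset
  · change L.edges ∩ M.edges ∪ L.edges ∩ N.edges = L.edges
    rw [← Set.inter_union_distrib_left]
    exact Set.inter_eq_left.2 hL.edges_subset

omit hN in
theorem union_inter (hA : A.IsSubgraph M) (hB : B.IsSubgraph N) : (A.union B).inter M = A := by
  have hBT := hB.isFeynman.isTrivalent
  have hBM : Disjoint M.halves B.halves := hMN.mono_right hB.halves_subset
  refine HalfEdgeGraph.ext (Set.Subset.antisymm ?_ fun v hv => ⟨Or.inl hv, hA.verts_subset hv⟩)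
    (Set.Subset.antisymm ?_ fun v hv => ⟨Or.inl hv, hA.edges_subset hv⟩)
  · rintro v ⟨hv | hv, hvM⟩
    · exact hv
    · obtain ⟨x, hx⟩ := hBT.nonempty_of_vert hv
      exact (Set.disjoint_left.1 hBM ⟨v, hvM, hx⟩ ⟨v, hv, hx⟩).elim
  · rintro e ⟨he | he, heM⟩
    · exact he
    · obtain ⟨x, hx⟩ := hBT.nonempty_of_edge he
      exact (Set.disjoint_left.1 hBM (hM.edge_subset e heM hx) (hBT.edge_subset e he hx)).elim

end Union

end HalfEdgeGraph

/-! ### Feynman graphs are finitary; the theorem -/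

namespace HalfEdgeGraph

variable {S : Type u}

/-- The subgraphs of a graph that have a Feynman graph as quotient. -/
abbrev SubgraphOf (G : HalfEdgeGraph S) : Type u :=
  {γ : HalfEdgeGraph S // γ.IsSubgraph G ∧ (G.contract γ).IsFeynman}

/-- A subgraph of a Feynman graph, with its quotient. -/
def IsSubgraph.toSubgraphOf {L M : HalfEdgeGraph S} (hL : L.IsSubgraph M) (hM : M.IsFeynman) :
    SubgraphOf M := ⟨L, hL, hM.contract hL⟩

theorem cls_LFG_eq {G K : {G : HalfEdgeGraph S // G.IsFeynman}} :
    cls (C := LFG S) G = cls (C := LFG S) K ↔ Isomorphic G.1 K.1 :=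
  Quotient.eq (r := isoSetoid S)

theorem cls_LFG_congr {G K : {G : HalfEdgeGraph S // G.IsFeynman}} (h : G.1 = K.1) :
    cls (C := LFG S) G = cls (C := LFG S) K := congrArg _ (Subtype.ext h)

theorem cls_LFG_eq_of_map {G K : {G : HalfEdgeGraph S // G.IsFeynman}} (σ : Equiv.Perm S)
    (h : K.1 = G.1.map σ) : cls (C := LFG S) K = cls (C := LFG S) G :=
  (cls_LFG_eq.2 (h ▸ isomorphic_map σ G.1)).symm

theorem exists_subgraph_map_equiv (σ : Equiv.Perm S) {G : HalfEdgeGraph S} (hG : G.IsFeynman) :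
    ∃ e : SubgraphOf G ≃ SubgraphOf (G.map σ), ∀ γ, (e γ).1 = γ.1.map σ ∧
      (G.map σ).contract (e γ).1 = (G.contract γ.1).map σ := by
  have h : ∀ γ : SubgraphOf (G.map σ), (γ.1.map σ.symm).IsSubgraph G := fun γ => by
    have := γ.2.1.map σ.symm
    rwa [map_symm_map] at this
  exact ⟨{  toFun := fun γ => (γ.2.1.map σ).toSubgraphOf (hG.map σ)
            invFun := fun γ => (h γ).toSubgraphOf hG
            left_inv := fun γ => Subtype.ext (map_symm_map σ γ.1)
            right_inv := fun γ => Subtype.ext (map_symm_map σ.symm γ.1) },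
    fun γ => ⟨rfl, contract_map σ⟩⟩

theorem exists_subgraph_flag_equiv {M : HalfEdgeGraph S} (hM : M.IsFeynman) :
    ∃ e : (Σ N : SubgraphOf M, SubgraphOf N.1) ≃ (Σ L : SubgraphOf M, SubgraphOf (M.contract L.1)),
      ∀ x, (e x).1.1 = x.2.1 ∧ (e x).2.1 = x.1.1.contract x.2.1 ∧
        (M.contract (e x).1.1).contract (e x).2.1 = M.contract x.1.1 := by
  have hMT := hM.isTrivalent
  have sigma_ext : ∀ {f : HalfEdgeGraph S → HalfEdgeGraph S}
      {x y : Σ N : SubgraphOf M, SubgraphOf (f N.1)}, x.1.1 = y.1.1 → x.2.1 = y.2.1 → x = y := by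
    rintro f ⟨⟨N, hN⟩, ⟨L, hL⟩⟩ ⟨⟨N', hN'⟩, ⟨L', hL'⟩⟩ h h'
    obtain rfl : N = N' := h
    obtain rfl : L = L' := h'
    rfl
  refine ⟨{ toFun := fun x => ⟨(x.2.2.1.trans x.1.2.1).toSubgraphOf hM,
              (x.2.2.1.contract_mono x.1.2.1 hMT).toSubgraphOf
                (hM.contract (x.2.2.1.trans x.1.2.1))⟩
            invFun := fun x => ⟨(isSubgraph_lift x.1.2.1 hMT x.2.2.1).toSubgraphOf hM,
              (isSubgraph_lift_left x.1.2.1).toSubgraphOf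
                (isFeynman_lift x.1.2.1 hMT x.2.2.1)⟩
            left_inv := fun x => sigma_ext (f := id) (lift_contract hMT x.2.2.1 x.1.2.1) rfl
            right_inv := fun x => sigma_ext (f := fun L => M.contract L) rfl
              (contract_lift x.1.2.1 hMT x.2.2.1) }, fun x => ⟨rfl, rfl, ?_⟩⟩
  exact x.2.2.1.contract_contract x.1.2.1 hMT

theorem exists_subgraph_union_equiv {M N : HalfEdgeGraph S} (hM : M.IsFeynman) (hN : N.IsFeynman)
    (h : Disjoint M.halves N.halves) :
    ∃ e : SubgraphOf M × SubgraphOf N ≃ SubgraphOf (M.union N), ∀ x,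
      (e x).1 = x.1.1.union x.2.1 ∧
      (M.union N).contract (e x).1 = (M.contract x.1.1).union (N.contract x.2.1) := by
  have hMT := hM.isTrivalent
  have hNT := hN.isTrivalent
  have hinter : ∀ {M N L : HalfEdgeGraph S}, M.IsFeynman → N.IsFeynman →
      Disjoint M.halves N.halves → L.IsSubgraph (M.union N) → (L.inter M).IsSubgraph M := by
    intro M N L hM hN h hL
    have hL' : L.IsSubgraph (N.union M) := union_comm M N ▸ hL
    refine isSubgraph_of_union hN.isTrivalent h (isTrivalent_inter hM.isTrivalent h hL)
      (isTrivalent_inter hN.isTrivalent h.symm hL') Set.inter_subset_right Set.inter_subset_right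
      Set.inter_subset_right ?_
    rwa [inter_union_inter hL]
  have hinter' : ∀ γ : SubgraphOf (M.union N), (γ.1.inter N).IsSubgraph N := fun γ =>
    hinter hN hM h.symm (union_comm M N ▸ γ.2.1)
  refine ⟨{ toFun := fun x =>
              (x.1.2.1.union hMT hNT h x.2.2.1).toSubgraphOf (hM.union h hN)
            invFun := fun γ => ((hinter hM hN h γ.2.1).toSubgraphOf hM,
              (hinter' γ).toSubgraphOf hN)
            left_inv := fun x => Prod.ext (Subtype.ext (union_inter hMT h x.1.2.1 x.2.2.1))
              (Subtype.ext ?_)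
            right_inv := fun γ => Subtype.ext (inter_union_inter γ.2.1) }, fun x => ⟨rfl, ?_⟩⟩
  · change (x.1.1.union x.2.1).inter N = x.2.1
    rw [union_comm]
    exact union_inter hNT h.symm x.2.2.1 x.1.2.1
  · exact contract_union hMT hNT h x.1.2.1 x.2.2.1

theorem isFinitary_LFG [Infinite S] : (LFG S).IsFinitary where
  exists_equiv_of_cls_eq := by
    rintro ⟨G, hG⟩ ⟨K, hK⟩ h
    obtain ⟨σ, h⟩ := (cls_LFG_eq.1 h).exists_perm hG.isTrivalent
    obtain rfl : K = G.map σ := h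
    obtain ⟨e, he⟩ := exists_subgraph_map_equiv σ hG
    exact ⟨e, fun γ => ⟨cls_LFG_eq_of_map σ (he γ).1, cls_LFG_eq_of_map σ (he γ).2⟩⟩
  exists_flag_equiv := by
    rintro ⟨M, hM⟩
    obtain ⟨e, he⟩ := exists_subgraph_flag_equiv hM
    exact ⟨e, fun x => ⟨cls_LFG_congr (he x).1, cls_LFG_congr (he x).2.1,
      cls_LFG_congr (he x).2.2⟩⟩
  exists_union_equiv := by
    rintro ⟨M, hM⟩ ⟨N, hN⟩ ⟨T, hT⟩ ⟨h, hv, he⟩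
    obtain rfl : T = M.union N := HalfEdgeGraph.ext hv he
    obtain ⟨e, he⟩ := exists_subgraph_union_equiv hM hN h
    refine ⟨e, fun x => ⟨⟨h.mono x.1.2.1.halves_subset x.2.2.1.halves_subset,
      congrArg verts (he x).1, congrArg edges (he x).1⟩,
      ⟨h.mono (x.1.2.1.contract_halves_subset hM.isTrivalent)
        (x.2.2.1.contract_halves_subset hN.isTrivalent),
      congrArg verts (he x).2, congrArg edges (he x).2⟩⟩⟩
  exists_bot := by
    rintro ⟨M, hM⟩
    refine ⟨(isSubgraph_empty M).toSubgraphOf hM, cls_LFG_congr (contract_empty hM.isTrivalent),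
      fun γ => cls_LFG_eq.trans ((isomorphic_empty_iff γ.2.1.isFeynman.isTrivalent).trans ?_)⟩
    exact ⟨fun h => Subtype.ext h, fun h => congrArg Subtype.val h⟩
  exists_top := by
    rintro ⟨M, hM⟩
    refine ⟨(IsSubgraph.refl hM).toSubgraphOf hM, cls_LFG_congr rfl,
      fun γ => cls_LFG_eq.trans ((isomorphic_empty_iff γ.2.2.isTrivalent).trans
        (γ.2.2.isTrivalent.eq_empty_iff.trans ⟨fun h => ?_, ?_⟩))⟩
    · exact Subtype.ext (γ.2.1.eq_of_contract_verts hM h)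
    · rintro rfl
      exact contract_self_verts M
  exists_size := by
    refine ⟨Quotient.lift (s := isoSetoid S) (fun G => G.1.verts.ncard)
      fun G _ h => Isomorphic.ncard_verts_eq G.2.isTrivalent h, fun n => ?_, ?_⟩
    -- At most n vertices with three half-edges each.
    · obtain ⟨T, hT, hT'⟩ := exists_finite_label_set S (n * 3)
      refine ((finite_setOf_halves_subset hT).image (cls (C := LFG S))).subset fun A hA => ?_
      induction A using Quotient.inductionOn with | h G =>
      obtain ⟨G, hG⟩ := G
      have hGT := hG.isTrivalent
      have hcard : G.halves.ncard ≤ n * 3 := by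
        rw [halves, Set.ncard_sUnion_of_pairwiseDisjoint hGT.finite_verts hGT.vert_card
          (fun v => hGT.vert_finite) hGT.vert_disjoint]
        exact Nat.mul_le_mul_right 3 hA
      obtain ⟨σ, hσ⟩ := hT' G.halves hGT.finite_halves hcard
      exact ⟨⟨G.map σ, hG.map σ⟩, (halves_map σ).trans_subset hσ, cls_LFG_eq_of_map σ rfl⟩
    · rintro ⟨M, hM⟩ γ
      change M.verts.ncard ≤ γ.1.verts.ncard + (M.contract γ.1).verts.ncard
      -- Each vertex of M is in γ or survives; new vertices of the quotient only help.
      refine (Set.ncard_le_ncard (t := γ.1.verts ∪ (M.contract γ.1).verts) (fun v hv => ?_)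
        (γ.2.1.isFeynman.finite_verts.union γ.2.2.finite_verts)).trans (Set.ncard_union_le _ _)
      by_cases h : v ∈ γ.1.verts
      · exact Or.inl h
      · exact Or.inr (Or.inl ⟨hv, h⟩)

end HalfEdgeGraph

theorem HallData.isFinitary_of_eq {S : Type u} [Infinite S] {C : HallData.{u}}
    (hC : C = LRF S ∨ C = LFG S) : C.IsFinitary := by
  rcases hC with rfl | rfl
  · exact RootedForest.isFinitary_LRF
  · exact HalfEdgeGraph.isFinitary_LFG

theorem mainTheorem1 (S : Type u) [Infinite S] (C : HallData.{u}) (hC : C = LRF S ∨ C = LFG S) :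
    -- the quotient of a Feynman graph by any subgraph is a Feynman graph
    (∀ G γ : HalfEdgeGraph S, G.IsFeynman → γ.IsSubgraph G → (G.contract γ).IsFeynman) ∧
    -- the Ringel-Hall product, computed on any representative of an isomorphism class
    (∀ (f g : C.Iso → ℚ) (M : C.Obj),
      hallMul f g (cls M) = ∑ N : C.Sub M, f (cls (C.sub M N)) * g (cls (C.quo M N))) ∧
    -- `n_C` is a Lie algebra under the commutator bracket
    (∀ f ∈ C.hallLie, ∀ g ∈ C.hallLie, hallBracket f g ∈ C.hallLie) ∧
    (∀ f ∈ C.hallLie, ∀ g ∈ C.hallLie, ∀ h ∈ C.hallLie,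
      hallBracket f (hallBracket g h) =
        hallBracket (hallBracket f g) h + hallBracket g (hallBracket f h)) ∧
    -- the elimination action, computed on any representative of an isomorphism class
    (∀ (A : C.Iso) (B : C.Obj),
      elim (delta A) (phi (cls B)) =
        -∑ᶠ N : {N : C.Sub B // cls (C.sub B N) = A}, phi (cls (C.quo B N.1))) ∧
    -- it is a representation of the Lie algebra `n_C`
    (∀ f ∈ C.hallLie, ∀ g ∈ C.hallLie, elim (hallBracket f g) = ⁅elim f, elim g⁆) ∧
    -- for every `M`, `H_quot(M)` is a finite-dimensional subrepresentation
    ∀ M : C.Iso,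
      FiniteDimensional ℚ (hallQuot M) ∧
      (∀ A : C.Iso, ∀ φ ∈ hallQuot M, elim (delta A) φ ∈ hallQuot M) ∧
      (∀ f ∈ C.hallLie, ∀ φ ∈ hallQuot M, elim f φ ∈ hallQuot M) := by
  have hF := isFinitary_of_eq hC
  exact ⟨fun G γ hG hγ => hG.contract hγ, hF.hallMul_cls, fun f hf g hg => hF.hallBracket_mem hf hg,
    fun f _ g _ h _ => hF.hallBracket_jacobi f g h, hF.elim_delta_phi_cls,
    fun f _ g _ => hF.elim_hallBracket f g, fun M => ⟨hF.finiteDimensional_hallQuot M,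
      fun A φ hφ => hF.elim_mem_hallQuot (delta A) M hφ,
      fun f _ φ hφ => hF.elim_mem_hallQuot f M hφ⟩⟩
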